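/- Let $\ell$ be a prime, let $\mathcal O$ be the ring of integers of a finite extension $K$ of $\mathbb Q_\ell$, with residue field $k$, and let $G_{\mathbb Q}=\mathrm{Gal}(\overline{\mathbb Q}/\mathbb Q)$. For each place $\nu$ of $\mathbb Q$ fix a place of $\overline{\mathbb Q}$ above $\nu$, with decomposition group $G_\nu\subset G_{\mathbb Q}$ and inertia group $I_\nu\subset G_\nu$ (with $I_\infty=G_\infty$ generated by complex conjugation). A representation $r$ of $G_{\mathbb Q}$ or of $G_\ell$ in $GL_2(A)$ is called ordinary if, over $A$, \[ r|_{G_\ell}\simeq\begin{pmatrix}\chi_\ell & *\\ 0&\chi_0\end{pmatrix}\quad\text{with characters } \chi_\ell,\chi_0:G_\ell\to A^\times \text{ and } \chi_0|_{I_\ell}=1 \] (it is not required that $\chi_\ell$ be ramified). Let $\rho:G_{\mathbb Q}\to GL_2(\mathcal O)$ be a continuous representation which is ordinary and ramified at finitely many places, and whose residual representation $\overline\rho:G_{\mathbb Q}\to GL_2(k)$ is absolutely irreducible and wildly ramified at $\ell$ (nontrivial on the Sylow pro-$\ell$ subgroup of $I_\ell$). Let $\mathcal O'$ be a complete local Noetherian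 $\mathcal O$-algebra which is flat over $\mathcal O$ and whose structure map is local; let $k'$ be its residue field (an arbitrary extension of $k$) and $K'\supset K$ its total ring of fractions, i.e. its field of fractions if $\mathcal O'$ is a domain. For a finite set $\Sigma$ of places of $\mathbb Q$, a continuous representation $\rho':G_{\mathbb Q}\to GL_2(\mathcal O')$ is called a deformation of $\overline\rho$ of type $\Sigma$ if 1. $\overline{\rho'}\simeq\overline\rho\otimes_k k'$ and $\det\rho'=\det\rho$; 2. $\rho'|_{I_\nu}\otimes_{\mathcal O'}K'\simeq\rho|_{I_\nu}\otimes_{\mathcal O}K'$ for all $\nu\notin\Sigma$; 3. $\rho'$ is ordinary (so that $\chi_\ell=\det\rho\cdot\chi_0^{-1}$). Then the following hold. (a) For every finite set $\Sigma$ of places of $\mathbb Q$ (if $\ell\in\Sigma$, only condition (3) is imposed at $\ell$, apart from the condition on the determinant; if $\ell\notin\Sigma$, both (2) and (3) are imposed there) there exist a complete local Noetherian flat $\mathcal O$-algebra $R_\Sigma$ with residue field $k$ and a deformation $\rho^{\mathrm{univ}}_\Sigma:G_{\mathbb Q}\to GL_2(R_\Sigma)$ of $\overline\rho$ of type $\Sigma$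 such that for every $\mathcal O'$ as above and every deformation $\rho':G_{\mathbb Q}\to GL_2(\mathcal O')$ of $\overline\rho$ of type $\Sigma$ there is a unique $\mathcal O$-algebra homomorphism $\phi:R_\Sigma\to\mathcal O'$ with $\rho'\simeq\phi\circ\rho^{\mathrm{univ}}_\Sigma$ over $\mathcal O'$. (b) Being ordinary with determinant $\det\rho|_{G_\ell}$ is a deformation condition for $\overline\rho|_{G_\ell}$. That is, consider the pairs $(A,r)$ where $A$ is an Artinian local $\mathcal O$-algebra with residue field $k$ and $r:G_\ell\to GL_2(A)$ is a continuous representation whose reduction is isomorphic to $\overline\rho|_{G_\ell}$; a morphism $(A,r)\to(C,s)$ is an $\mathcal O$-algebra homomorphism $A\to C$ with $r\otimes_A C\simeq s$. Then: the pair $(k,\overline\rho|_{G_\ell})$ satisfies the condition; if $(A,r)\to(C,s)$ is a morphism and $(A,r)$ satisfies the condition, so does $(C,s)$; if $(A,r)\to(C,s)$ is a morphism with $A\to C$ injective and $(C,s)$ satisfies the condition, so does $(A,r)$; and if $D=A\times_C B$ is a fibre product, with morphisms from $(D,r_D)$ to $(A,r_A)$ and $(B,r_B)$ and from these to $(C,r_C)$,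 then $(D,r_D)$ satisfies the condition if and only if both $(A,r_A)$ and $(B,r_B)$ do. -/

import Mathlib

open IsLocalRing

universe u v

noncomputable section

namespace OrdinaryDeformation

/-! ### Galois groups of the rational numbers -/

instance isAlgebraic_algebraicClosure : Algebra.IsAlgebraic ℚ (AlgebraicClosure ℚ) := by
  have h : (DivisionRing.toRatAlgebra : Algebra ℚ (AlgebraicClosure ℚ)) =
      AlgebraicClosure.instAlgebra ℚ := Subsingleton.elim _ _
  rw [h]
  exact AlgebraicClosure.isAlgebraic ℚ

/-- The absolute Galois group of `ℚ`, with the Krull topology. -/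
abbrev GalQ : Type := AlgebraicClosure ℚ ≃ₐ[ℚ] AlgebraicClosure ℚ

/-- The places of `ℚ`: the prime numbers and the infinite place. -/
inductive Place : Type
  | finite (p : Nat.Primes)
  | infinite

/-- The valuation ring of `ℚ̄` induced by an embedding of `ℚ̄` into the algebraic closure
of `ℚ_p`: the elements whose image has `p`-adic absolute value at most one. -/
def padicValuationRing (p : ℕ) [Fact p.Prime] : ValuationSubring (AlgebraicClosure ℚ) :=
  ((PadicAlgCl.valued p).v.valuationSubring).comap
    (IsAlgClosed.lift : AlgebraicClosure ℚ →ₐ[ℚ] PadicAlgCl p).toRingHom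

/-- The infinite place of `ℚ̄` induced by an embedding of `ℚ̄` into `ℂ`. -/
def infinitePlace : NumberField.InfinitePlace (AlgebraicClosure ℚ) :=
  NumberField.InfinitePlace.mk (IsAlgClosed.lift : AlgebraicClosure ℚ →ₐ[ℚ] ℂ).toRingHom

/-- The decomposition group at a prime `p`: the stabilizer of the chosen place of `ℚ̄`
above `p`. -/
def decompositionGroup (p : ℕ) [Fact p.Prime] : Subgroup GalQ :=
  (padicValuationRing p).decompositionSubgroup ℚ

/-- The inertia group at a prime `p`: the elements of the decomposition group that act
trivially on the residue field of the chosen place above `p`. -/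
def inertiaGroup (p : ℕ) [Fact p.Prime] : Subgroup GalQ :=
  ((padicValuationRing p).inertiaSubgroup ℚ).map
    ((padicValuationRing p).decompositionSubgroup ℚ).subtype

/-- The inertia group at a place. At the infinite place it is the whole decomposition group,
namely the group generated by complex conjugation. -/
def Place.inertia : Place → Subgroup GalQ
  | .finite p => haveI : Fact (p : ℕ).Prime := ⟨p.2⟩; inertiaGroup p
  | .infinite => MulAction.stabilizer GalQ infinitePlace

/-- A subgroup `P` of a topological group `G` has only finite `p`-groups as images in the
quotients of `G` by open normal subgroups. For a closed subgroup of a profinite group this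
says that `P` is pro-`p`. -/
def IsProP (p : ℕ) {G : Type*} [Group G] [TopologicalSpace G] (P : Subgroup G) : Prop :=
  ∀ (N : Subgroup G) [N.Normal], IsOpen (N : Set G) →
    IsPGroup p (P.map (QuotientGroup.mk' N))

/-- `P` is a Sylow pro-`p` subgroup of the subgroup `I`. -/
def IsSylowProP (p : ℕ) {G : Type*} [Group G] [TopologicalSpace G] (I P : Subgroup G) : Prop :=
  Maximal (fun Q : Subgroup G => Q ≤ I ∧ IsClosed (Q : Set G) ∧ IsProP p Q) P

/-! ### Two-dimensional representations -/

section Representations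

variable {G : Type*} [Group G]

/-- Extension of scalars of a matrix representation along a ring homomorphism. -/
def baseChange {A B : Type*} [CommRing A] [CommRing B] (f : A →+* B)
    (r : G →* GL (Fin 2) A) : G →* GL (Fin 2) B :=
  (Matrix.GeneralLinearGroup.map f).comp r

/-- Two matrix representations over `A` are isomorphic, i.e. conjugate under `GL₂(A)`. -/
def Equivalent {A : Type*} [CommRing A] (r s : G →* GL (Fin 2) A) : Prop :=
  ∃ h : GL (Fin 2) A, ∀ g, r g = h * s g * h⁻¹

/-- The residual representation over the residue field of a local ring. -/
def residualRep {A : Type*} [CommRing A] [IsLocalRing A] (r : G →* GL (Fin 2) A) :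
    G →* GL (Fin 2) (ResidueField A) :=
  baseChange (residue A) r

/-- Continuity of a representation over a local ring `A`, where `A` carries the topology given
by the powers of its maximal ideal. -/
def IsContinuous [TopologicalSpace G] {A : Type*} [CommRing A] [IsLocalRing A]
    (r : G →* GL (Fin 2) A) : Prop :=
  letI : TopologicalSpace A := (maximalIdeal A).adicTopology
  Continuous r

/-- The linear representation on `F²` given by a matrix representation. -/
def toRepresentation {F : Type*} [Field F] (r : G →* GL (Fin 2) F) :
    Representation F G (Fin 2 → F) :=
  ((Matrix.toLinAlgEquiv' : Matrix (Fin 2) (Fin 2) F ≃ₐ[F] _) :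
    Matrix (Fin 2) (Fin 2) F →* Module.End F (Fin 2 → F)).comp
      ((Units.coeHom (Matrix (Fin 2) (Fin 2) F)).comp r)

/-- Irreducibility over an algebraic closure. -/
def IsAbsolutelyIrreducible {F : Type*} [Field F] (r : G →* GL (Fin 2) F) : Prop :=
  (toRepresentation (baseChange (algebraMap F (AlgebraicClosure F)) r)).IsIrreducible

end Representations

/-! ### Local conditions -/

/-- `r` is trivial on the inertia group at `w`. -/
def IsUnramifiedAt {A : Type*} [CommRing A] (r : GalQ →* GL (Fin 2) A) (w : Place) : Prop :=
  ∀ σ ∈ w.inertia, r σ = 1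

/-- `r` is nontrivial on the Sylow pro-`p` subgroup of the inertia group at `p`. -/
def IsWildlyRamifiedAt {A : Type*} [CommRing A] (r : GalQ →* GL (Fin 2) A)
    (p : ℕ) [Fact p.Prime] : Prop :=
  ∃ P : Subgroup GalQ, IsSylowProP p (inertiaGroup p) P ∧ ∃ σ ∈ P, r σ ≠ 1

/-- A representation of the decomposition group at `ℓ` is ordinary if it is conjugate over the
coefficient ring to an upper triangular representation with diagonal characters `χ`, `χ₀`, the
lower one `χ₀` being unramified. No condition is put on `χ`. -/
def IsOrdinaryLocal (ℓ : ℕ) [Fact ℓ.Prime] {A : Type*} [CommRing A]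
    (r : decompositionGroup ℓ →* GL (Fin 2) A) : Prop :=
  ∃ (h : GL (Fin 2) A) (χ χ₀ : decompositionGroup ℓ →* Aˣ),
    (∀ σ : decompositionGroup ℓ, (σ : GalQ) ∈ inertiaGroup ℓ → χ₀ σ = 1) ∧
    ∀ σ : decompositionGroup ℓ,
      (h⁻¹ * r σ * h).val 0 0 = χ σ ∧ (h⁻¹ * r σ * h).val 1 0 = 0 ∧
      (h⁻¹ * r σ * h).val 1 1 = χ₀ σ

/-- A representation of the absolute Galois group of `ℚ` is ordinary at `ℓ`. -/
def IsOrdinary (ℓ : ℕ) [Fact ℓ.Prime] {A : Type*} [CommRing A] (r : GalQ →* GL (Fin 2) A) :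
    Prop :=
  IsOrdinaryLocal ℓ (r.comp (decompositionGroup ℓ).subtype)

/-! ### Deformations of type `T` -/

section Deformations

variable (ℓ : ℕ) [Fact ℓ.Prime] {O : Type u} [CommRing O] [IsLocalRing O]
  (ρ : GalQ →* GL (Fin 2) O)

/-- `r` is a deformation of type `T` of the residual representation of `ρ`: it is continuous,
it lifts the residual representation of `ρ` up to isomorphism and has the same determinant
as `ρ`; on inertia at every place outside `T` it becomes isomorphic to `ρ` over the total ring
of fractions `K'` of the coefficient ring (the field of fractions, if that ring is a domain);
and it is ordinary at `ℓ`. As `χ * χ₀ = det r = det ρ` in the last condition, the upper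
character is `det ρ * χ₀⁻¹`. -/
structure IsDeformationOfType (T : Set Place) {O' : Type v} [CommRing O'] [IsLocalRing O']
    [Algebra O O'] [IsLocalHom (algebraMap O O')] (r : GalQ →* GL (Fin 2) O') : Prop where
  continuous : IsContinuous r
  residual_equiv : Equivalent (residualRep r)
    (baseChange (algebraMap (ResidueField O) (ResidueField O')) (residualRep ρ))
  det_eq : ∀ g, (r g).det = Units.map (algebraMap O O').toMonoidHom (ρ g).det
  inertia_equiv : ∀ w : Place, w ∉ T →
    Equivalent
      ((baseChange (algebraMap O' (FractionRing O')) r).comp w.inertia.subtype)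
      ((baseChange ((algebraMap O' (FractionRing O')).comp (algebraMap O O')) ρ).comp
        w.inertia.subtype)
  ordinary : IsOrdinary ℓ r

/-- `ru` over `R` is universal among deformations of type `T` over complete local Noetherian
flat `O`-algebras `O'`, with arbitrary residue field: it is of type `T`, and every deformation
of type `T` is induced by a unique `O`-algebra homomorphism `R → O'`. -/
def IsUniversalOfType (T : Set Place) {R : Type u} [CommRing R] [IsLocalRing R]
    [Algebra O R] [IsLocalHom (algebraMap O R)] (ru : GalQ →* GL (Fin 2) R) : Prop :=
  IsDeformationOfType ℓ ρ T ru ∧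
  ∀ (O' : Type v) [CommRing O'] [IsLocalRing O'] [IsNoetherianRing O']
    [IsAdicComplete (maximalIdeal O') O'] [Algebra O O'] [IsLocalHom (algebraMap O O')]
    [Module.Flat O O'] (r : GalQ →* GL (Fin 2) O'),
    IsDeformationOfType ℓ ρ T r →
      ∃! φ : R →ₐ[O] O', Equivalent r (baseChange φ.toRingHom ru)

end Deformations

/-! ### Deformation conditions -/

section DeformationConditions

variable {O : Type u} [CommRing O] [IsLocalRing O] {H : Type} [Group H] [TopologicalSpace H]

/-- `(A, r)` is a deformation to an Artinian coefficient ring of the representation `rbar`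
over the residue field `k` of `O`: the ring `A` is an Artinian local `O`-algebra with residue
field `k`, and `r` is a continuous representation over `A` that reduces to `rbar` up to
isomorphism. -/
structure IsArtinianDeformation (rbar : H →* GL (Fin 2) (ResidueField O))
    (A : Type u) [CommRing A] [IsLocalRing A] [Algebra O A] [IsLocalHom (algebraMap O A)]
    (r : H →* GL (Fin 2) A) : Prop where
  artinian : IsArtinianRing A
  residueField : Function.Bijective (algebraMap (ResidueField O) (ResidueField A))
  continuous : IsContinuous r
  residual_equiv : Equivalent (residualRep r)
    (baseChange (algebraMap (ResidueField O) (ResidueField A)) rbar)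

/-- A property `P` of representations over `O`-algebras is a deformation condition for `rbar`:
it holds for `rbar`, it is preserved by morphisms `(A, r) → (C, s)`, it descends along morphisms
with `A → C` injective, and it holds for an object over a fibre product `D` of `A` and `B`
over `C` if and only if it holds for the induced objects over `A` and `B`. Here a morphism
`(A, r) → (C, s)` is an `O`-algebra homomorphism `A → C` along which `r` induces `s` up to
isomorphism. -/
structure IsDeformationCondition (rbar : H →* GL (Fin 2) (ResidueField O))
    (P : ∀ (A : Type u) [CommRing A] [Algebra O A], (H →* GL (Fin 2) A) → Prop) : Prop where
  base : P (ResidueField O) rbar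
  push : ∀ (A C : Type u) [CommRing A] [IsLocalRing A] [Algebra O A]
    [IsLocalHom (algebraMap O A)] [CommRing C] [IsLocalRing C] [Algebra O C]
    [IsLocalHom (algebraMap O C)] (r : H →* GL (Fin 2) A) (s : H →* GL (Fin 2) C)
    (f : A →ₐ[O] C),
    IsArtinianDeformation rbar A r → IsArtinianDeformation rbar C s →
    Equivalent s (baseChange f.toRingHom r) → P A r → P C s
  descend : ∀ (A C : Type u) [CommRing A] [IsLocalRing A] [Algebra O A]
    [IsLocalHom (algebraMap O A)] [CommRing C] [IsLocalRing C] [Algebra O C]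
    [IsLocalHom (algebraMap O C)] (r : H →* GL (Fin 2) A) (s : H →* GL (Fin 2) C)
    (f : A →ₐ[O] C),
    IsArtinianDeformation rbar A r → IsArtinianDeformation rbar C s →
    Equivalent s (baseChange f.toRingHom r) → Function.Injective f → P C s → P A r
  fibreProduct : ∀ (D A B C : Type u) [CommRing D] [IsLocalRing D] [Algebra O D]
    [IsLocalHom (algebraMap O D)] [CommRing A] [IsLocalRing A] [Algebra O A]
    [IsLocalHom (algebraMap O A)] [CommRing B] [IsLocalRing B] [Algebra O B]
    [IsLocalHom (algebraMap O B)] [CommRing C] [IsLocalRing C] [Algebra O C]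
    [IsLocalHom (algebraMap O C)]
    (pA : D →ₐ[O] A) (pB : D →ₐ[O] B) (α : A →ₐ[O] C) (β : B →ₐ[O] C)
    (rD : H →* GL (Fin 2) D) (rA : H →* GL (Fin 2) A) (rB : H →* GL (Fin 2) B)
    (rC : H →* GL (Fin 2) C),
    (∀ d, α (pA d) = β (pB d)) →
    (∀ a b, α a = β b → ∃! d, pA d = a ∧ pB d = b) →
    IsArtinianDeformation rbar D rD → IsArtinianDeformation rbar A rA →
    IsArtinianDeformation rbar B rB → IsArtinianDeformation rbar C rC →
    Equivalent rA (baseChange pA.toRingHom rD) → Equivalent rB (baseChange pB.toRingHom rD) →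
    Equivalent rC (baseChange α.toRingHom rA) → Equivalent rC (baseChange β.toRingHom rB) →
    (P D rD ↔ P A rA ∧ P B rB)

/-- The ordinary condition with the determinant of `ρ`, for representations of the
decomposition group at `ℓ` over `O`-algebras. -/
def OrdinaryCondition (ℓ : ℕ) [Fact ℓ.Prime] (ρ : GalQ →* GL (Fin 2) O)
    (A : Type u) [CommRing A] [Algebra O A] (r : decompositionGroup ℓ →* GL (Fin 2) A) : Prop :=
  (∀ σ : decompositionGroup ℓ,
    (r σ).det = Units.map (algebraMap O A).toMonoidHom (ρ (σ : GalQ)).det) ∧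
  IsOrdinaryLocal ℓ r

end DeformationConditions

end OrdinaryDeformation

end

open IsLocalRing

noncomputable section

namespace OrdinaryDeformation

/-! ### Conjugation and extension of scalars -/

section Conjugation

variable {G : Type*} [Group G] {A B C : Type*} [CommRing A] [CommRing B] [CommRing C]

/-! Everything is reduced to equations between matrix entries, which can be tested on subrings and
factor by factor on products.

Wild inertia acts through an `ℓ`-group, and the diagonal characters of the residual representation
take values in a field of characteristic `ℓ`. So some `s` in inertia has a nontrivial unipotent
reduction (`exists_isResiduallyUnipotentAt`). This one element pins down the ordinary line: in a
basis where `r(s)` has lower right entry `1` and a unit in the upper right corner, `r` is ordinary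
only if it is visibly so (`IsOrdinaryLocal.isOrdinaryForm_conjRep`). Ordinarity can therefore be
checked along jointly injective families of homomorphisms (`isOrdinaryLocal_of_injective`). An
injection, or the two projections of a fibre product, form such a family, and this gives (b).

For (a), irreducibility gives an element `τ` that moves the ordinary line. Requiring `r(τ)` to send
the first basis vector to the second leaves only scalar conjugations, so equivalent normal forms are
equal (`IsNormalForm.eq_of_equivalent`). Isomorphism over the total ring of fractions is not visibly
inherited by subrings or products. It is replaced by `IsGenericallyIsomorphic`: the group ring
relations of `ρ` hold for `r`, and the determinants of certain explicit intertwiners have no common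
annihilator.

A bound on the different gives the theorem of Hermite and Minkowski for Galois extensions. A
Frattini argument in `ℓ`-groups then produces a finite set `s` generating every finite quotient
through which a lift modulo a power of the maximal ideal can factor. Hence a lift is determined by
its values on `s`, and it is defined over a quotient of a compact power series ring over `O`. The
product of all lifts over such quotients again satisfies the conditions. Its entries lie in the
image of the power series ring, which is closed by compactness, and this image is the universal
ring. A lift over any `O'`, whatever its residue field, is already defined over one of the
quotients, hence is induced from the universal one; rigidity of normal forms gives uniqueness. -/

/-- The representation `g ↦ h⁻¹ r(g) h`. -/
def conjRep (h : GL (Fin 2) A) (r : G →* GL (Fin 2) A) : G →* GL (Fin 2) A :=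
  (MulAut.conj h⁻¹).toMonoidHom.comp r

theorem conjRep_apply (h : GL (Fin 2) A) (r : G →* GL (Fin 2) A) (g : G) :
    conjRep h r g = h⁻¹ * r g * h := by
  simp [conjRep]

theorem conjRep_mul (h h' : GL (Fin 2) A) (r : G →* GL (Fin 2) A) :
    conjRep h' (conjRep h r) = conjRep (h * h') r := by
  ext1 g
  simp only [conjRep_apply]
  group

theorem baseChange_conjRep (f : A →+* B) (h : GL (Fin 2) A) (r : G →* GL (Fin 2) A) :
    baseChange f (conjRep h r) =
      conjRep (Matrix.GeneralLinearGroup.map f h) (baseChange f r) := by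
  ext1 g
  simp [conjRep_apply, baseChange]

theorem equivalent_iff_exists_conjRep {r s : G →* GL (Fin 2) A} :
    Equivalent r s ↔ ∃ h, s = conjRep h r := by
  refine exists_congr fun h => ⟨fun H => ?_, fun H g => ?_⟩
  · ext1 g
    rw [conjRep_apply, H]
    group
  · rw [H, conjRep_apply]
    group

theorem Equivalent.refl (r : G →* GL (Fin 2) A) : Equivalent r r := ⟨1, by simp⟩

theorem Equivalent.symm {r s : G →* GL (Fin 2) A} (h : Equivalent r s) : Equivalent s r := by
  obtain ⟨x, hx⟩ := h
  refine ⟨x⁻¹, fun g => ?_⟩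
  rw [hx]
  group

theorem Equivalent.trans {r s t : G →* GL (Fin 2) A} (h : Equivalent r s) (h' : Equivalent s t) :
    Equivalent r t := by
  obtain ⟨x, hx⟩ := h
  obtain ⟨y, hy⟩ := h'
  refine ⟨x * y, fun g => ?_⟩
  rw [hx, hy]
  group

theorem equivalent_conjRep (h : GL (Fin 2) A) (r : G →* GL (Fin 2) A) :
    Equivalent r (conjRep h r) :=
  equivalent_iff_exists_conjRep.2 ⟨h, rfl⟩

theorem Equivalent.baseChange {r s : G →* GL (Fin 2) A} (h : Equivalent r s) (f : A →+* B) :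
    Equivalent (baseChange f r) (OrdinaryDeformation.baseChange f s) := by
  obtain ⟨x, hx⟩ := h
  exact ⟨Matrix.GeneralLinearGroup.map f x, fun g => by
    simp [OrdinaryDeformation.baseChange, hx]⟩

theorem Equivalent.comp {H : Type*} [Group H] {r s : G →* GL (Fin 2) A} (h : Equivalent r s)
    (f : H →* G) : Equivalent (r.comp f) (s.comp f) := by
  obtain ⟨x, hx⟩ := h
  exact ⟨x, fun g => hx _⟩

theorem Equivalent.det_eq {r s : G →* GL (Fin 2) A} (h : Equivalent r s) (g : G) :
    (r g).det = (s g).det := by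
  obtain ⟨x, hx⟩ := h
  rw [hx]
  simp

theorem Equivalent.trace_eq {r s : G →* GL (Fin 2) A} (h : Equivalent r s) (g : G) :
    (r g).val.trace = (s g).val.trace := by
  obtain ⟨x, hx⟩ := h
  rw [hx, Units.val_mul, Units.val_mul, Matrix.trace_mul_comm, ← mul_assoc, ← Units.val_mul,
    inv_mul_cancel, Units.val_one, one_mul]

theorem Equivalent.eq_one_iff {r s : G →* GL (Fin 2) A} (h : Equivalent r s) (g : G) :
    r g = 1 ↔ s g = 1 := by
  obtain ⟨x, hx⟩ := h
  rw [hx]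
  exact conj_eq_one_iff

theorem baseChange_baseChange (f : A →+* B) (g : B →+* C) (r : G →* GL (Fin 2) A) :
    baseChange g (baseChange f r) = baseChange (g.comp f) r := by
  ext
  simp [baseChange]

@[simp]
theorem baseChange_apply (f : A →+* B) (r : G →* GL (Fin 2) A) (g : G) (i j : Fin 2) :
    (baseChange f r g).val i j = f ((r g).val i j) := rfl

theorem det_baseChange (f : A →+* B) (r : G →* GL (Fin 2) A) (g : G) :
    (baseChange f r g).det = Units.map f.toMonoidHom (r g).det := by
  ext
  simp [baseChange, Matrix.det_fin_two]

theorem val_mul_apply (x y : GL (Fin 2) A) (i j : Fin 2) :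
    (x * y).val i j = x.val i 0 * y.val 0 j + x.val i 1 * y.val 1 j := by
  rw [Units.val_mul, Matrix.mul_apply, Fin.sum_univ_two]

/-- Writing conjugation as an intertwining relation keeps the inverse of `h` out, so that each entry
gives a polynomial identity. -/
theorem conjRep_intertwine (h : GL (Fin 2) A) (r : G →* GL (Fin 2) A) (g : G) (i j : Fin 2) :
    h.val i 0 * (conjRep h r g).val 0 j + h.val i 1 * (conjRep h r g).val 1 j =
      (r g).val i 0 * h.val 0 j + (r g).val i 1 * h.val 1 j := by
  rw [← val_mul_apply, ← val_mul_apply, conjRep_apply]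
  group

theorem isUnit_det_val (h : GL (Fin 2) A) :
    IsUnit (h.val 0 0 * h.val 1 1 - h.val 0 1 * h.val 1 0) := by
  rw [← Matrix.det_fin_two]
  exact h.det.isUnit

theorem isUnit_diag_of_apply_one_zero {h : GL (Fin 2) A} (h0 : h.val 1 0 = 0) :
    IsUnit (h.val 0 0) ∧ IsUnit (h.val 1 1) := by
  have := isUnit_det_val h
  rwa [h0, mul_zero, sub_zero, IsUnit.mul_iff] at this

theorem exists_val_eq {M : Matrix (Fin 2) (Fin 2) A} (h : IsUnit M.det) :
    ∃ g : GL (Fin 2) A, g.val = M :=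
  (Matrix.isUnit_iff_isUnit_det M).2 h

end Conjugation

/-! ### Ordinary representations in upper triangular form -/

section OrdinaryForm

variable {ℓ : ℕ} [Fact ℓ.Prime] {A B : Type*} [CommRing A] [CommRing B]

/-- `r` is upper triangular with unramified lower character. -/
structure IsOrdinaryForm (ℓ : ℕ) [Fact ℓ.Prime] {A : Type*} [CommRing A]
    (r : decompositionGroup ℓ →* GL (Fin 2) A) : Prop where
  lower : ∀ σ, (r σ).val 1 0 = 0
  inertia : ∀ σ : decompositionGroup ℓ, (σ : GalQ) ∈ inertiaGroup ℓ → (r σ).val 1 1 = 1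

/-- The diagonal entries of upper triangular matrices are multiplicative, so the two characters need
not be carried along as data. -/
theorem isOrdinaryLocal_iff {r : decompositionGroup ℓ →* GL (Fin 2) A} :
    IsOrdinaryLocal ℓ r ↔ ∃ h, IsOrdinaryForm ℓ (conjRep h r) := by
  constructor
  · rintro ⟨h, χ, χ₀, h1, h2⟩
    refine ⟨h, ⟨fun σ => ?_, fun σ hσ => ?_⟩⟩
    · rw [conjRep_apply]
      exact (h2 σ).2.1
    · rw [conjRep_apply, (h2 σ).2.2, h1 σ hσ, Units.val_one]
  · rintro ⟨h, hl, hi⟩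
    have key : ∀ i, i = 0 ∨ i = 1 → ∃ χ : decompositionGroup ℓ →* A,
        ∀ σ, χ σ = (conjRep h r σ).val i i := by
      intro i hi
      refine ⟨{ toFun := fun σ => (conjRep h r σ).val i i, map_one' := by simp,
                map_mul' := fun σ τ => ?_ }, fun _ => rfl⟩
      rw [map_mul, val_mul_apply]
      rcases hi with rfl | rfl <;> simp [hl]
    obtain ⟨χ, hχ⟩ := key 0 (Or.inl rfl)
    obtain ⟨χ₀, hχ₀⟩ := key 1 (Or.inr rfl)
    refine ⟨h, χ.toHomUnits, χ₀.toHomUnits, fun σ hσ => ?_, fun σ => ?_⟩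
    · ext
      rw [MonoidHom.coe_toHomUnits, hχ₀, hi σ hσ, Units.val_one]
    · rw [MonoidHom.coe_toHomUnits, MonoidHom.coe_toHomUnits, hχ, hχ₀, ← conjRep_apply]
      exact ⟨rfl, hl σ, rfl⟩

theorem IsOrdinaryLocal.of_equivalent {r s : decompositionGroup ℓ →* GL (Fin 2) A}
    (h : IsOrdinaryLocal ℓ r) (hs : Equivalent r s) : IsOrdinaryLocal ℓ s := by
  rw [isOrdinaryLocal_iff] at h ⊢
  obtain ⟨x, hx⟩ := h
  obtain ⟨y, hy⟩ := equivalent_iff_exists_conjRep.1 hs.symm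
  exact ⟨y * x, by rwa [← conjRep_mul, ← hy]⟩

theorem IsOrdinaryForm.baseChange {r : decompositionGroup ℓ →* GL (Fin 2) A}
    (h : IsOrdinaryForm ℓ r) (f : A →+* B) : IsOrdinaryForm ℓ (baseChange f r) :=
  ⟨fun σ => by simp [h.lower], fun σ hσ => by simp [h.inertia σ hσ]⟩

theorem IsOrdinaryForm.isOrdinaryLocal {r : decompositionGroup ℓ →* GL (Fin 2) A}
    (h : IsOrdinaryForm ℓ r) : IsOrdinaryLocal ℓ r :=
  isOrdinaryLocal_iff.2 ⟨1, by
    have : conjRep 1 r = r := by ext1; simp [conjRep_apply]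
    rwa [this]⟩

theorem IsOrdinaryLocal.baseChange {r : decompositionGroup ℓ →* GL (Fin 2) A}
    (h : IsOrdinaryLocal ℓ r) (f : A →+* B) : IsOrdinaryLocal ℓ (baseChange f r) := by
  rw [isOrdinaryLocal_iff] at h ⊢
  obtain ⟨x, hx⟩ := h
  exact ⟨_, by rw [← baseChange_conjRep]; exact hx.baseChange f⟩

/-- Conjugation by an upper triangular matrix preserves the ordinary form. -/
theorem IsOrdinaryForm.conjRep {r : decompositionGroup ℓ →* GL (Fin 2) A}
    (hr : IsOrdinaryForm ℓ r) {g : GL (Fin 2) A} (hg : g.val 1 0 = 0) :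
    IsOrdinaryForm ℓ (conjRep g r) := by
  obtain ⟨-, h1⟩ := isUnit_diag_of_apply_one_zero hg
  refine ⟨fun σ => ?_, fun σ hσ => ?_⟩
  · have := conjRep_intertwine g r σ 1 0
    rw [hg, hr.lower] at this
    exact h1.mul_left_cancel (by linear_combination this)
  · have := conjRep_intertwine g r σ 1 1
    rw [hg, hr.lower, hr.inertia σ hσ] at this
    exact h1.mul_left_cancel (by linear_combination this)

/-- An upper triangular conjugate of an ordinary representation, with a unit in the upper right
corner at some element of inertia, is a conjugate by an upper triangular matrix. -/
theorem IsOrdinaryForm.apply_one_zero_eq_zero {r : decompositionGroup ℓ →* GL (Fin 2) A}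
    (hr : IsOrdinaryForm ℓ r) {g : GL (Fin 2) A} {s : decompositionGroup ℓ}
    (hs : (s : GalQ) ∈ inertiaGroup ℓ)
    (h11 : (OrdinaryDeformation.conjRep g r s).val 1 1 = 1)
    (h01 : IsUnit ((OrdinaryDeformation.conjRep g r s).val 0 1)) : g.val 1 0 = 0 := by
  -- With `b` the upper right entry of the conjugate, this entry of the relation reads `g₁₀ b + g₁₁
  -- = g₁₁`.
  have := conjRep_intertwine g r s 1 1
  rw [h11, hr.lower, hr.inertia s hs] at this
  exact h01.mul_left_eq_zero.1 (by linear_combination this)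

/-- A singular matrix over a local ring whose reduction is nilpotent and nonzero has the normal
form `(t 1; 0 0)`. -/
theorem exists_mul_eq_of_det_eq_zero [IsLocalRing A] (n : Matrix (Fin 2) (Fin 2) A)
    (hdet : n.det = 0) (htr : n.trace ∈ maximalIdeal A) (hn : ∃ i j, n i j ∉ maximalIdeal A) :
    ∃ g : GL (Fin 2) A, n * g.val = g.val * !![n.trace, 1; 0, 0] := by
  rw [Matrix.det_fin_two] at hdet
  rw [Matrix.trace_fin_two] at htr ⊢
  -- Otherwise the vanishing determinant puts the product of the diagonal entries in the maximal
  -- ideal, the trace then puts both of them there, and `n` reduces to zero.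
  have hu : IsUnit (n 0 1) ∨ IsUnit (n 1 0) := by
    by_contra! h
    have h1 : n 0 1 ∈ maximalIdeal A := h.1
    have h2 : n 1 0 ∈ maximalIdeal A := h.2
    have h3 : n 0 0 * n 1 1 ∈ maximalIdeal A := by
      rw [sub_eq_zero.1 hdet]
      exact Ideal.mul_mem_right _ _ h1
    have h4 : n 0 0 ∈ maximalIdeal A ∧ n 1 1 ∈ maximalIdeal A := by
      rcases (Ideal.IsPrime.mem_or_mem inferInstance h3) with h5 | h5
      · exact ⟨h5, (Ideal.add_mem_iff_right _ h5).1 htr⟩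
      · exact ⟨(Ideal.add_mem_iff_left _ h5).1 htr, h5⟩
    obtain ⟨i, j, hij⟩ := hn
    fin_cases i <;> fin_cases j <;> simp_all
  -- As the determinant vanishes, Cayley–Hamilton gives `n² = tr(n) n`. So the basis `(n e, e)`
  -- works for a standard vector `e`; the unit off the diagonal makes it a basis.
  rcases hu with hu | hu
  · obtain ⟨g, hg⟩ := exists_val_eq (M := !![n 0 1, 0; n 1 1, 1]) (by simpa using hu)
    refine ⟨g, ?_⟩
    ext i j
    rw [hg]
    fin_cases i <;> fin_cases j <;> simp [Matrix.mul_apply] <;>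
      first | linear_combination | linear_combination -hdet
  · obtain ⟨g, hg⟩ := exists_val_eq (M := !![n 0 0, 1; n 1 0, 0]) (by simpa using hu)
    refine ⟨g, ?_⟩
    ext i j
    rw [hg]
    fin_cases i <;> fin_cases j <;> simp [Matrix.mul_apply] <;>
      first | linear_combination | linear_combination -hdet

/-- Inertia acts trivially on the unramified quotient line, so `1` is an eigenvalue of `r s`. -/
theorem IsOrdinaryLocal.det_sub_one_eq_zero {r : decompositionGroup ℓ →* GL (Fin 2) A}
    (hr : IsOrdinaryLocal ℓ r) {s : decompositionGroup ℓ} (hs : (s : GalQ) ∈ inertiaGroup ℓ) :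
    ((r s).val - 1).det = 0 := by
  obtain ⟨h, hh⟩ := isOrdinaryLocal_iff.1 hr
  have h1 : (h⁻¹).val * ((r s).val - 1) * h.val = (conjRep h r s).val - 1 := by
    rw [conjRep_apply, mul_sub, sub_mul, mul_one, ← Units.val_mul h⁻¹ h, inv_mul_cancel]
    rfl
  have h2 : ((conjRep h r s).val - 1).det = 0 := by
    rw [Matrix.det_fin_two]
    simp [hh.lower, hh.inertia s hs]
  rw [← h1, Matrix.det_mul, Matrix.det_mul, mul_comm, ← mul_assoc, ← Matrix.det_mul,
    ← Units.val_mul, mul_inv_cancel] at h2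
  simpa using h2

/-- At `s` the reduction of `r` is a nontrivial unipotent matrix. -/
structure IsResiduallyUnipotentAt [IsLocalRing A] {G : Type*} [Group G]
    (r : G →* GL (Fin 2) A) (s : G) : Prop where
  trace_eq : (residualRep r s).val.trace = 2
  ne_one : residualRep r s ≠ 1

theorem IsResiduallyUnipotentAt.of_equivalent [IsLocalRing A] [IsLocalRing B] {G : Type*}
    [Group G] {r : G →* GL (Fin 2) A} {r' : G →* GL (Fin 2) B} {s : G}
    (h : IsResiduallyUnipotentAt r s) (f : ResidueField A →+* ResidueField B)
    (hr : Equivalent (residualRep r') (OrdinaryDeformation.baseChange f (residualRep r))) :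
    IsResiduallyUnipotentAt r' s := by
  refine ⟨?_, fun h1 => h.ne_one ?_⟩
  · rw [hr.trace_eq, Matrix.trace_fin_two, baseChange_apply, baseChange_apply, ← map_add,
      ← Matrix.trace_fin_two, h.trace_eq, map_ofNat]
  · rw [hr.eq_one_iff] at h1
    ext i j
    have h2 := congrArg (fun x : GL (Fin 2) (ResidueField B) => x.val i j) h1
    simp only [baseChange_apply] at h2
    apply f.injective
    rw [h2]
    fin_cases i <;> fin_cases j <;> simp

/-- In a suitable basis an ordinary representation takes the form `(* 1; 0 1)` at a given
element of inertia at which its reduction is a nontrivial unipotent matrix. -/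
theorem exists_conjRep_normal_at [IsLocalRing A] {r : decompositionGroup ℓ →* GL (Fin 2) A}
    {s : decompositionGroup ℓ} (hs : IsResiduallyUnipotentAt r s)
    (hdet : ((r s).val - 1).det = 0) :
    ∃ g, (conjRep g r s).val 0 1 = 1 ∧ (conjRep g r s).val 1 0 = 0 ∧
      (conjRep g r s).val 1 1 = 1 := by
  obtain ⟨g, hg⟩ := exists_mul_eq_of_det_eq_zero ((r s).val - 1) hdet (by
      rw [← residue_eq_zero_iff]
      have := hs.trace_eq
      rw [Matrix.trace_fin_two] at this ⊢
      simp only [residualRep, baseChange_apply] at this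
      simp only [Matrix.sub_apply, Matrix.one_apply_eq, map_add, map_sub, map_one]
      linear_combination this) (by
      by_contra! h
      refine hs.ne_one ?_
      ext i j
      have h1 := (residue_eq_zero_iff _).2 (h i j)
      rw [Matrix.sub_apply, map_sub, sub_eq_zero] at h1
      rw [residualRep, baseChange_apply, h1]
      fin_cases i <;> fin_cases j <;> simp)
  have h1 : (conjRep g r s).val = !![((r s).val - 1).trace, 1; 0, 0] + 1 := by
    rw [sub_mul, one_mul, sub_eq_iff_eq_add] at hg
    rw [conjRep_apply, mul_assoc, Units.val_mul, Units.val_mul, hg, mul_add, ← mul_assoc,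
      ← Units.val_mul, inv_mul_cancel, Units.val_one, one_mul]
  exact ⟨g, by rw [h1]; simp, by rw [h1]; simp, by rw [h1]; simp⟩

/-- The element `s` alone determines the ordinary line: a basis adapted to `r s` differs from an
ordinary basis by an upper triangular matrix. Hence the abstract existence of an ordinary basis
becomes a condition in a basis known beforehand. -/
theorem IsOrdinaryLocal.isOrdinaryForm_conjRep {r : decompositionGroup ℓ →* GL (Fin 2) A}
    (hr : IsOrdinaryLocal ℓ r) {s : decompositionGroup ℓ} (hs : (s : GalQ) ∈ inertiaGroup ℓ)
    {g : GL (Fin 2) A} (h11 : (conjRep g r s).val 1 1 = 1)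
    (h01 : IsUnit ((conjRep g r s).val 0 1)) : IsOrdinaryForm ℓ (conjRep g r) := by
  obtain ⟨h, hh⟩ := isOrdinaryLocal_iff.1 hr
  have e : conjRep g r = conjRep (h⁻¹ * g) (conjRep h r) := by
    rw [conjRep_mul, mul_inv_cancel_left]
  rw [e] at h11 h01 ⊢
  exact hh.conjRep (hh.apply_one_zero_eq_zero hs h11 h01)

/-- Being ordinary may be checked after extension of scalars along a jointly injective family. -/
theorem isOrdinaryLocal_of_injective [IsLocalRing A] {r : decompositionGroup ℓ →* GL (Fin 2) A}
    {s : decompositionGroup ℓ} (hs : (s : GalQ) ∈ inertiaGroup ℓ)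
    (hres : IsResiduallyUnipotentAt r s)
    (hf : ∀ a : A, (∀ (S : Type v) [CommRing S] (f : A →+* S),
      IsOrdinaryLocal ℓ (baseChange f r) → f a = 0) → a = 0) : IsOrdinaryLocal ℓ r := by
  have hdet : ((r s).val - 1).det = 0 := hf _ fun S _ f hr => by
    rw [← hr.det_sub_one_eq_zero hs, RingHom.map_det, map_sub, map_one]
    rfl
  obtain ⟨g, h01, -, h11⟩ := exists_conjRep_normal_at hres hdet
  -- The basis `g` was chosen over `A`, independently of `f`. Ordinarity over each `S` is thus the
  -- vanishing of the images of the same elements of `A`.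
  have key : ∀ (S : Type v) [CommRing S] (f : A →+* S), IsOrdinaryLocal ℓ (baseChange f r) →
      IsOrdinaryForm ℓ (baseChange f (conjRep g r)) := fun S _ f hr => by
    rw [baseChange_conjRep]
    refine hr.isOrdinaryForm_conjRep hs ?_ ?_ <;> rw [← baseChange_conjRep] <;>
      simp [h01, h11]
  refine isOrdinaryLocal_iff.2 ⟨g, ⟨fun σ => hf _ fun S _ f hr => ?_, fun σ hσ => ?_⟩⟩
  · simpa using (key S f hr).lower σ
  · refine sub_eq_zero.1 (hf _ fun S _ f hr => ?_)
    simpa [sub_eq_zero] using (key S f hr).inertia σ hσ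

end OrdinaryForm


/-! ### The residual representation at a wildly ramified prime -/

section Continuity

variable {G : Type*} [Group G] {A : Type*} [CommRing A] [IsLocalRing A]

theorem IsContinuous.isOpen_ker_pow [TopologicalSpace G] {r : G →* GL (Fin 2) A} (hr : IsContinuous r) (n : ℕ) :
    IsOpen {g | ∀ i j, (r g).val i j - (1 : Matrix (Fin 2) (Fin 2) A) i j ∈
      maximalIdeal A ^ n} := by
  let _ : TopologicalSpace A := (maximalIdeal A).adicTopology
  have : IsTopologicalRing A := (maximalIdeal A).nonarchimedean.toIsTopologicalRing
  have h1 : IsAdic (maximalIdeal A) := rfl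
  have h2 : IsOpen ((maximalIdeal A ^ n : Ideal A) : Set A) := (isAdic_iff.1 h1).1 n
  have h3 : Continuous r := hr
  have : {g | ∀ i j, (r g).val i j - (1 : Matrix (Fin 2) (Fin 2) A) i j ∈ maximalIdeal A ^ n} =
      ⋂ i, ⋂ j, (fun g => (r g).val i j - (1 : Matrix (Fin 2) (Fin 2) A) i j) ⁻¹'
        ((maximalIdeal A ^ n : Ideal A) : Set A) := by
    ext; simp
  rw [this]
  refine isOpen_iInter_of_finite fun i => isOpen_iInter_of_finite fun j => h2.preimage ?_
  exact ((Units.continuous_val.comp h3).matrix_elem i j).sub continuous_const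

theorem residualRep_eq_one_iff (r : G →* GL (Fin 2) A) (g : G) :
    residualRep r g = 1 ↔
      ∀ i j, (r g).val i j - (1 : Matrix (Fin 2) (Fin 2) A) i j ∈ maximalIdeal A := by
  have h : ∀ i j, residue A ((1 : Matrix (Fin 2) (Fin 2) A) i j) =
      (1 : Matrix (Fin 2) (Fin 2) (ResidueField A)) i j := fun i j => by
    fin_cases i <;> fin_cases j <;> simp
  simp_rw [← residue_eq_zero_iff, map_sub, sub_eq_zero, h]
  exact ⟨fun h i j => by rw [← baseChange_apply, ← residualRep, h]; rfl,
    fun h => by ext i j; exact h i j⟩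

theorem IsContinuous.isOpen_ker_residualRep [TopologicalSpace G] {r : G →* GL (Fin 2) A} (hr : IsContinuous r) :
    IsOpen ((residualRep r).ker : Set G) := by
  convert hr.isOpen_ker_pow 1 using 1
  ext g
  simp [residualRep_eq_one_iff]

end Continuity

section Wild

variable {ℓ : ℕ} [Fact ℓ.Prime] {O : Type u} [CommRing O] [IsLocalRing O]

/-- If `ℓ` were invertible, multiplication by the maximal ideal of `ℤ_[ℓ]` would be surjective on
the finite module `O`, and Nakayama would give `O = 0`. -/
theorem natCast_mem_maximalIdeal [Algebra ℤ_[ℓ] O] [Module.Finite ℤ_[ℓ] O] :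
    (ℓ : O) ∈ maximalIdeal O := by
  intro hu
  have h : (⊤ : Submodule ℤ_[ℓ] O) ≤ maximalIdeal ℤ_[ℓ] • ⊤ := fun x _ => by
    obtain ⟨u, hu⟩ := hu
    have : x = (ℓ : ℤ_[ℓ]) • ((u⁻¹ : Oˣ) * x) := by
      rw [Algebra.smul_def, map_natCast, ← hu, Units.mul_inv_cancel_left]
    rw [this]
    refine Submodule.smul_mem_smul ?_ trivial
    rw [PadicInt.maximalIdeal_eq_span_p]
    exact Ideal.mem_span_singleton_self _
  have := Submodule.eq_bot_of_le_smul_of_le_jacobson_bot _ _ Module.Finite.fg_top h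
    (by rw [IsLocalRing.jacobson_eq_maximalIdeal _ bot_ne_top])
  have h1 : (1 : O) ∈ (⊤ : Submodule ℤ_[ℓ] O) := trivial
  rw [this, Submodule.mem_bot] at h1
  exact one_ne_zero h1

theorem charP_residueField [Algebra ℤ_[ℓ] O] [Module.Finite ℤ_[ℓ] O] :
    CharP (ResidueField O) ℓ := by
  have : ((ℓ : ℕ) : ResidueField O) = 0 := by
    rw [← map_natCast (residue O), residue_eq_zero_iff]
    exact natCast_mem_maximalIdeal
  obtain ⟨p, hp⟩ := CharP.exists (ResidueField O)
  have h1 : p ∣ ℓ := (CharP.cast_eq_zero_iff _ p ℓ).1 this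
  rcases (Nat.dvd_prime (Fact.out : ℓ.Prime)).1 h1 with h2 | h2
  · subst h2
    exact absurd rfl (CharP.char_ne_one (ResidueField O) 1)
  · rwa [h2] at hp

/-- An ordinary residual representation that is wildly ramified at `ℓ` takes a nontrivial
unipotent value on inertia at `ℓ`. -/
theorem exists_isResiduallyUnipotentAt [Algebra ℤ_[ℓ] O] [Module.Finite ℤ_[ℓ] O]
    {ρ : GalQ →* GL (Fin 2) O} (hcont : IsContinuous ρ) (hord : IsOrdinary ℓ ρ)
    (hwild : IsWildlyRamifiedAt (residualRep ρ) ℓ) :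
    ∃ s : decompositionGroup ℓ, (s : GalQ) ∈ inertiaGroup ℓ ∧
      IsResiduallyUnipotentAt (ρ.comp (decompositionGroup ℓ).subtype) s := by
  have := charP_residueField (ℓ := ℓ) (O := O)
  obtain ⟨P, ⟨⟨hPI, -, hP⟩, -⟩, σ, hσ, hne⟩ := hwild
  have hσI := hPI hσ
  have hσD : σ ∈ decompositionGroup ℓ := by
    obtain ⟨x, -, rfl⟩ := hσI
    exact x.2
  refine ⟨⟨σ, hσD⟩, hσI, ?_, hne⟩
  obtain ⟨k, hk⟩ := hP (residualRep ρ).ker hcont.isOpen_ker_residualRep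
    ⟨QuotientGroup.mk' _ σ, Subgroup.mem_map_of_mem _ hσ⟩
  have hk1 : residualRep ρ σ ^ ℓ ^ k = 1 := by
    rw [← map_pow, ← MonoidHom.mem_ker, ← QuotientGroup.eq_one_iff]
    simpa [Subtype.ext_iff] using hk
  obtain ⟨h, hh⟩ := isOrdinaryLocal_iff.1 (IsOrdinaryLocal.baseChange hord (residue O))
  set r := baseChange (residue O) (ρ.comp (decompositionGroup ℓ).subtype) with hr
  set s : decompositionGroup ℓ := ⟨σ, hσD⟩
  have h10 : ∀ n : ℕ, ((conjRep h r (s ^ n)).val 0 0) = ((conjRep h r s).val 0 0) ^ n := by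
    intro n
    induction n with
    | zero => simp
    | succ n ih => rw [pow_succ, map_mul, val_mul_apply, ih, hh.lower, mul_zero, add_zero, pow_succ]
  have h2 : conjRep h r (s ^ ℓ ^ k) = 1 := by
    have h3 : r (s ^ ℓ ^ k) = 1 := by
      rw [map_pow]
      exact hk1
    rw [conjRep_apply, h3, mul_one, inv_mul_cancel]
  -- In characteristic `ℓ` the only root of unity of `ℓ`-power order is `1`, by Frobenius. So the
  -- upper character is trivial at `s` as well, and the trace is `2`.
  have h4 : (conjRep h r s).val 0 0 = 1 := by
    have h5 := h10 (ℓ ^ k)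
    rw [h2, Units.val_one, Matrix.one_apply_eq] at h5
    have h6 : ((conjRep h r s).val 0 0 - 1) ^ ℓ ^ k = 0 := by
      rw [sub_pow_char_pow, one_pow, ← h5, sub_self]
    exact sub_eq_zero.1 (pow_eq_zero_iff (by have := (Fact.out : ℓ.Prime).pos; positivity) |>.1 h6)
  change (r s).val.trace = 2
  rw [(equivalent_conjRep h r).trace_eq s, Matrix.trace_fin_two, h4, hh.inertia s hσI]
  norm_num

end Wild

/-! ### The ordinary condition is a deformation condition -/

section DeformationCondition

variable {ℓ : ℕ} [Fact ℓ.Prime] {O : Type u} [CommRing O] [IsLocalRing O]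

/-- Pushing forward is formal. Descent and the fibre product are both instances of `hpull`: over a
deformation ring the condition holds as soon as it holds along a jointly injective family of maps.
-/
theorem isDeformationCondition_ordinaryCondition {ρ : GalQ →* GL (Fin 2) O}
    (hord : IsOrdinary ℓ ρ) {s : decompositionGroup ℓ} (hs : (s : GalQ) ∈ inertiaGroup ℓ)
    (hres : IsResiduallyUnipotentAt (ρ.comp (decompositionGroup ℓ).subtype) s) :
    IsDeformationCondition ((residualRep ρ).comp (decompositionGroup ℓ).subtype)
      (fun A _ _ r => OrdinaryCondition ℓ ρ A r) := by
  have hdet : ∀ {A C : Type u} [CommRing A] [Algebra O A] [CommRing C] [Algebra O C]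
      (f : A →ₐ[O] C) (σ : decompositionGroup ℓ),
      Units.map f.toRingHom.toMonoidHom
        (Units.map (algebraMap O A).toMonoidHom (ρ (σ : GalQ)).det) =
      Units.map (algebraMap O C).toMonoidHom (ρ (σ : GalQ)).det := by
    intro A C _ _ _ _ f σ
    ext
    simp
  have hequiv : ∀ (C : Type u) [CommRing C] [Algebra O C]
      (r r' : decompositionGroup ℓ →* GL (Fin 2) C), Equivalent r r' →
      OrdinaryCondition ℓ ρ C r → OrdinaryCondition ℓ ρ C r' := fun C _ _ r r' h hr =>
    ⟨fun σ => by rw [← h.det_eq, hr.1], hr.2.of_equivalent h⟩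
  have hpush : ∀ (A C : Type u) [CommRing A] [Algebra O A] [CommRing C] [Algebra O C]
      (r : decompositionGroup ℓ →* GL (Fin 2) A) (s : decompositionGroup ℓ →* GL (Fin 2) C)
      (f : A →ₐ[O] C), Equivalent s (baseChange f.toRingHom r) →
      OrdinaryCondition ℓ ρ A r → OrdinaryCondition ℓ ρ C s := by
    intro A C _ _ _ _ r s f hf hr
    refine hequiv C _ _ hf.symm ⟨fun σ => ?_, hr.2.baseChange f.toRingHom⟩
    rw [det_baseChange, hr.1, hdet]
  have hpull : ∀ (D : Type u) [CommRing D] [IsLocalRing D] [Algebra O D]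
      [IsLocalHom (algebraMap O D)] (rD : decompositionGroup ℓ →* GL (Fin 2) D),
      IsArtinianDeformation ((residualRep ρ).comp (decompositionGroup ℓ).subtype) D rD →
      (∀ a, (∀ (S : Type u) [CommRing S] [Algebra O S] (f : D →ₐ[O] S),
        OrdinaryCondition ℓ ρ S (baseChange f.toRingHom rD) → f a = 0) → a = 0) →
      OrdinaryCondition ℓ ρ D rD := by
    intro D _ _ _ _ rD hD hf
    refine ⟨fun σ => ?_, ?_⟩
    · ext
      refine sub_eq_zero.1 (hf _ fun S _ _ f hr => ?_)
      have h1 := hr.1 σ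
      rw [det_baseChange, ← hdet f] at h1
      rw [map_sub, sub_eq_zero]
      exact congrArg Units.val h1
    · refine isOrdinaryLocal_of_injective hs (hres.of_equivalent _ hD.residual_equiv)
        fun a ha => hf a fun S _ _ f hr => ha S f.toRingHom hr.2
  refine ⟨?_, ?_, ?_, ?_⟩
  · exact ⟨fun σ => det_baseChange _ _ _, IsOrdinaryLocal.baseChange hord (residue O)⟩
  · intro A C _ _ _ _ _ _ _ _ r s f _ _ hf hr
    exact hpush A C r s f hf hr
  · intro A C _ _ _ _ _ _ _ _ r s f hr _ hf hinj hC
    exact hpull A r hr fun a ha => (map_eq_zero_iff f hinj).1 (ha C f (hequiv C _ _ hf hC))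
  · intro D A B C _ _ _ _ _ _ _ _ _ _ _ _ _ _ _ _ pA pB α β rD rA rB rC _ hfib hD _ _ _ hA hB _ _
    refine ⟨fun h => ⟨hpush D A rD rA pA hA h, hpush D B rD rB pB hB h⟩, fun ⟨h1, h2⟩ => ?_⟩
    refine hpull D rD hD fun a ha => ?_
    -- Uniqueness of the preimage of `(0, 0)` makes the two projections jointly injective.
    obtain ⟨d, -, hd⟩ := hfib 0 0 (by simp)
    rw [hd a ⟨ha A pA (hequiv A _ _ hA h1), ha B pB (hequiv B _ _ hB h2)⟩,
      hd 0 ⟨map_zero _, map_zero _⟩]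

end DeformationCondition

/-! ### A bound for discriminants of Galois extensions of the rational numbers -/

section Discriminant

open NumberField Pointwise nonZeroDivisors

variable (M : Type*) [Field M] [NumberField M]

/-- The inverse of the different is the trace dual of the ring of integers, so the different lies in
`I` exactly when `I⁻¹` has integral traces. Stated on elements, so that Galois automorphisms can be
applied. -/
theorem differentIdeal_le_iff_trace {I : Ideal (𝓞 M)} (hI : I ≠ ⊥) :
    differentIdeal ℤ (𝓞 M) ≤ I ↔ ∀ x : M, (∀ y ∈ I, ∃ z : 𝓞 M, algebraMap _ M z = x * algebraMap (𝓞 M) M y) →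
      ∃ t : ℤ, (t : ℚ) = Algebra.trace ℚ M x := by
  have hI' : (I : FractionalIdeal (𝓞 M)⁰ M) ≠ 0 := FractionalIdeal.coeIdeal_ne_zero.2 hI
  rw [differentialIdeal_le_iff (K := ℚ) (L := M) hI, Submodule.map_le_iff_le_comap]
  refine forall_congr' fun x => ?_
  have h1 : x ∈ ((I : FractionalIdeal (𝓞 M)⁰ M)⁻¹ : FractionalIdeal (𝓞 M)⁰ M) ↔
      ∀ y ∈ I, ∃ z : 𝓞 M, algebraMap _ M z = x * algebraMap (𝓞 M) M y := by
    rw [FractionalIdeal.mem_inv_iff hI']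
    simp [FractionalIdeal.mem_coeIdeal, FractionalIdeal.mem_one_iff]
  rw [← h1]
  refine imp_congr Iff.rfl ?_
  simp [Submodule.mem_one]

/-- Holds because the trace is invariant under automorphisms. -/
theorem differentIdeal_le_smul (σ : M ≃ₐ[ℚ] M) {I : Ideal (𝓞 M)} (hI : I ≠ ⊥)
    (h : differentIdeal ℤ (𝓞 M) ≤ I) : differentIdeal ℤ (𝓞 M) ≤ σ • I := by
  have hI' : σ • I ≠ ⊥ := by
    intro h0
    apply hI
    rw [← inv_smul_smul σ I, h0, Ideal.pointwise_smul_def, Ideal.map_bot]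
  rw [differentIdeal_le_iff_trace M hI] at h
  rw [differentIdeal_le_iff_trace M hI']
  intro x hx
  obtain ⟨t, ht⟩ := h (σ⁻¹ x) fun y hy => by
    obtain ⟨z, hz⟩ := hx (σ • y) (Ideal.smul_mem_pointwise_smul _ _ _ hy)
    refine ⟨σ⁻¹ • z, ?_⟩
    have : ∀ (τ : M ≃ₐ[ℚ] M) (y : 𝓞 M), algebraMap (𝓞 M) M (τ • y) = τ (algebraMap (𝓞 M) M y) :=
      fun _ _ => rfl
    rw [this, hz, map_mul, ← this σ⁻¹ (σ • y), inv_smul_smul]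
  refine ⟨t, ht.trans ?_⟩
  exact Algebra.trace_eq_of_algEquiv σ⁻¹ x

/-- In a Galois extension of degree `n`, if a rational prime `p` divides the different to a higher
order than `p ^ n` at one prime above `p`, it does so at all of them; but `p ^ n` does not divide
the different, by computing the trace of `p ^ (-n)`. -/
theorem pow_dvd_of_pow_dvd_differentIdeal [IsGalois ℚ M] {p : ℕ} (hp : p.Prime)
    {P : Ideal (𝓞 M)} [P.IsPrime] (hpP : (p : 𝓞 M) ∈ P) {k : ℕ}
    (hk : P ^ k ∣ differentIdeal ℤ (𝓞 M)) :
    P ^ k ∣ Ideal.span {(p : 𝓞 M) ^ Module.finrank ℚ M} := by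
  set n := Module.finrank ℚ M with hn
  by_contra hcon
  have hp0 : (p : 𝓞 M) ^ n ≠ 0 := pow_ne_zero _ (Nat.cast_ne_zero.2 hp.ne_zero)
  have hspan : Ideal.span {(p : 𝓞 M) ^ n} ≠ ⊥ := by simpa using hp0
  have hPbot : P ≠ ⊥ := by
    rintro rfl
    exact hp.ne_zero (by simpa using hpP)
  have hunder : ∀ (Q : Ideal (𝓞 M)) [Q.IsPrime], (p : 𝓞 M) ∈ Q →
      Q.LiesOver (Ideal.span {(p : ℤ)}) := by
    intro Q hQ hpQ
    refine ⟨?_⟩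
    have hmax : (Ideal.span {(p : ℤ)}).IsMaximal :=
      PrincipalIdealRing.isMaximal_of_irreducible (Nat.prime_iff_prime_int.1 hp).irreducible
    refine hmax.eq_of_le (Ideal.IsPrime.ne_top inferInstance) ?_
    rw [Ideal.span_singleton_le_iff_mem]
    simpa [Ideal.under_def] using hpQ
  have key : ∀ (Q : Ideal (𝓞 M)) [Q.IsPrime], (p : 𝓞 M) ∈ Q →
      Q ^ k ∣ differentIdeal ℤ (𝓞 M) ∧ ¬ Q ^ k ∣ Ideal.span {(p : 𝓞 M) ^ n} := by
    intro Q hQ hpQ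
    have h1 := hunder P hpP
    have h2 := hunder Q hpQ
    obtain ⟨σ, hσ⟩ := Ideal.exists_smul_eq_of_isGaloisGroup (Ideal.span {(p : ℤ)}) P Q Gal(M/ℚ)
    subst hσ
    rw [Ideal.dvd_iff_le] at hk ⊢
    rw [Ideal.dvd_iff_le, Ideal.span_singleton_le_iff_mem] at hcon ⊢
    have hpow : (σ • P) ^ k = σ • P ^ k := by
      simp only [Ideal.pointwise_smul_def, Ideal.map_pow]
    rw [hpow]
    refine ⟨differentIdeal_le_smul M σ (pow_ne_zero _ hPbot) hk, fun h => hcon ?_⟩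
    rw [Ideal.mem_pointwise_smul_iff_inv_smul_mem, smul_pow'] at h
    have h3 : σ⁻¹ • (p : 𝓞 M) = p := map_natCast (MulSemiringAction.toRingHom _ (𝓞 M) σ⁻¹) p
    rwa [h3] at h
  -- By transitivity of the Galois action, at every prime above `p` the exponent in `p ^ n` is below
  -- `k` and that in the different is at least `k`. Other primes do not divide `p ^ n`.
  have hdvd : Ideal.span {(p : 𝓞 M) ^ n} ∣ differentIdeal ℤ (𝓞 M) := by
    rw [UniqueFactorizationMonoid.dvd_iff_emultiplicity_le hspan]
    intro Q hQ
    have hQ' : Q.IsPrime := Ideal.isPrime_of_prime hQ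
    rw [emultiplicity_le_emultiplicity_iff]
    intro j hj
    rcases Nat.eq_zero_or_pos j with rfl | hj0
    · simp
    have hpQ : (p : 𝓞 M) ∈ Q := by
      have h1 : (p : 𝓞 M) ^ n ∈ Q ^ j := by
        rwa [Ideal.dvd_iff_le, Ideal.span_singleton_le_iff_mem] at hj
      exact hQ'.mem_of_pow_mem _ (Ideal.pow_le_self hj0.ne' h1)
    obtain ⟨h1, h2⟩ := key Q hpQ
    refine (pow_dvd_pow Q ?_).trans h1
    by_contra! h3
    exact h2 ((pow_dvd_pow Q h3.le).trans hj)
  rw [Ideal.dvd_iff_le, differentIdeal_le_iff_trace M hspan] at hdvd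
  -- The trace of `p ^ (-n)` is `n / p ^ n`, which is not an integer since `0 < n < p ^ n`.
  obtain ⟨t, ht⟩ := hdvd (algebraMap ℚ M ((p : ℚ) ^ n)⁻¹) fun y hy => by
    obtain ⟨z, rfl⟩ := Ideal.mem_span_singleton'.1 hy
    refine ⟨z, ?_⟩
    have hp0' : (p : M) ^ n ≠ 0 := pow_ne_zero _ (Nat.cast_ne_zero.2 hp.ne_zero)
    simp only [map_inv₀, map_pow, map_natCast, map_mul]
    field_simp
  rw [Algebra.trace_algebraMap, ← hn, nsmul_eq_mul, ← div_eq_mul_inv,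
    eq_div_iff (pow_ne_zero _ (Nat.cast_ne_zero.2 hp.ne_zero))] at ht
  have ht' : t * (p : ℤ) ^ n = n := by exact_mod_cast ht
  have h4 : (p ^ n) ∣ n := by
    have : ((p ^ n : ℕ) : ℤ) ∣ (n : ℤ) := ⟨t, by push_cast; linarith⟩
    exact_mod_cast this
  exact absurd (Nat.le_of_dvd Module.finrank_pos h4) (not_le.2 (Nat.lt_pow_self hp.one_lt))

/-- The discriminant of a Galois extension of `ℚ` unramified outside `S` is bounded in terms of
`S` and the degree. -/
theorem natAbs_discr_le_of_isUnramifiedAt [IsGalois ℚ M] (S : Finset ℕ)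
    (hS : ∀ p ∈ S, p.Prime)
    (h : ∀ p : ℕ, p.Prime → p ∉ S → ∀ (P : Ideal (𝓞 M)) [P.IsPrime], (p : 𝓞 M) ∈ P →
      Algebra.IsUnramifiedAt ℤ P) :
    (discr M).natAbs ≤ ((∏ p ∈ S, p) ^ Module.finrank ℚ M) ^ Module.finrank ℚ M := by
  set n := Module.finrank ℚ M with hn
  set c : ℕ := (∏ p ∈ S, p) ^ n with hc
  have hc0 : c ≠ 0 := pow_ne_zero _ (Finset.prod_ne_zero_iff.2 fun p hp => (hS p hp).ne_zero)
  have hD : differentIdeal ℤ (𝓞 M) ≠ ⊥ := differentIdeal_ne_bot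
  have hdvd : differentIdeal ℤ (𝓞 M) ∣ Ideal.span {(c : 𝓞 M)} := by
    rw [UniqueFactorizationMonoid.dvd_iff_emultiplicity_le hD]
    intro P hP
    have hP' : P.IsPrime := Ideal.isPrime_of_prime hP
    rw [emultiplicity_le_emultiplicity_iff]
    intro k hk
    rcases Nat.eq_zero_or_pos k with rfl | hk0
    · simp
    have hmax : P.IsMaximal := hP'.isMaximal hP.ne_zero
    obtain ⟨p, hp, hpP⟩ : ∃ p : ℕ, p.Prime ∧ (p : 𝓞 M) ∈ P := by
      have h0 := Ideal.absNorm_mem P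
      have h1 : Ideal.absNorm P ≠ 1 := by
        rw [Ne, Ideal.absNorm_eq_one_iff]
        exact hP'.ne_top
      have h2 : Ideal.absNorm P ≠ 0 := by
        rw [Ne, Ideal.absNorm_eq_zero_iff]
        exact hP.ne_zero
      by_contra! hno
      have : ∀ m : ℕ, m ≠ 0 → (m : 𝓞 M) ∉ P := by
        intro m
        induction m using Nat.recOnMul with
        | zero => simp
        | one => exact fun _ => by simpa using (Ideal.ne_top_iff_one P).1 hP'.ne_top
        | prime p hp => exact fun _ => hno p hp
        | mul a b ha hb =>
          intro hab h
          rw [Nat.cast_mul] at h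
          rcases hP'.mem_or_mem h with h | h
          · exact ha (left_ne_zero_of_mul hab) h
          · exact hb (right_ne_zero_of_mul hab) h
      exact this _ h2 h0
    have hpS : p ∈ S := by
      by_contra hpS
      have h1 := h p hp hpS P hpP
      rw [← not_dvd_differentIdeal_iff] at h1
      exact h1 ((dvd_pow_self P hk0.ne').trans hk)
    refine (pow_dvd_of_pow_dvd_differentIdeal M hp hpP hk).trans ?_
    rw [Ideal.dvd_span_singleton, Ideal.mem_span_singleton, hc, Nat.cast_pow]
    exact pow_dvd_pow_of_dvd (Nat.cast_dvd_cast (Finset.dvd_prod_of_mem _ hpS)) _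
  -- Taking norms turns the different into the discriminant and `c` into `c ^ n`; this is the source
  -- of the outer exponent.
  have h1 := Ideal.absNorm_dvd_absNorm_of_le (Ideal.dvd_iff_le.1 hdvd)
  rw [absNorm_differentIdeal M, Ideal.absNorm_span_singleton] at h1
  have h2 : (Algebra.norm ℤ (c : 𝓞 M)).natAbs = c ^ n := by
    rw [← map_natCast (algebraMap ℤ (𝓞 M)), Algebra.norm_algebraMap,
      RingOfIntegers.rank, Int.natAbs_pow]
    simp [hn]
  rw [h2] at h1
  exact Nat.le_of_dvd (pow_pos (Nat.pos_of_ne_zero hc0) _) h1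

end Discriminant

/-! ### Lifting inertia to the absolute Galois group -/

section Inertia

open NumberField Pointwise

/-- The algebraic closure of `ℚ` fixed in the definitions. -/
local notation "Ω" => AlgebraicClosure ℚ

instance : IsAlgClosure ℚ Ω := ⟨inferInstance, inferInstance⟩

instance : IsGalois ℚ Ω where
  to_normal := IsAlgClosure.normal ℚ Ω

instance (M : IntermediateField ℚ Ω) : IsGalois M Ω := IsGalois.tower_top_intermediateField M

variable (p : ℕ) [Fact p.Prime]

theorem ringOfIntegers_mem_valuationSubring (A : ValuationSubring Ω) (b : 𝓞 Ω) :
    algebraMap (𝓞 Ω) Ω b ∈ A := by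
  have h : IsIntegral A (algebraMap (𝓞 Ω) Ω b) := (RingOfIntegers.isIntegral_coe b).tower_top
  obtain ⟨y, hy⟩ := IsIntegrallyClosed.isIntegral_iff.1 h
  rw [← hy]
  exact y.2

/-- The inclusion of the ring of algebraic integers in the chosen valuation ring. -/
def integersToValuationRing : 𝓞 Ω →+* padicValuationRing p :=
  (algebraMap (𝓞 Ω) Ω).codRestrict (padicValuationRing p).toSubring
    (ringOfIntegers_mem_valuationSubring _)

/-- The prime of the ring of algebraic integers below the chosen place above `p`. -/
def primeAbove : Ideal (𝓞 Ω) := (maximalIdeal (padicValuationRing p)).comap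
  (integersToValuationRing p)

instance : (primeAbove p).IsPrime := Ideal.IsPrime.comap _

theorem mem_primeAbove_iff {b : 𝓞 Ω} : b ∈ primeAbove p ↔
    integersToValuationRing p b ∈ maximalIdeal (padicValuationRing p) := Iff.rfl

theorem natCast_mem_primeAbove : (p : 𝓞 Ω) ∈ primeAbove p := by
  rw [mem_primeAbove_iff, mem_maximalIdeal, mem_nonunits_iff]
  intro hu
  obtain ⟨y, hy⟩ := hu.exists_right_inv
  have h1 : (p : Ω) * (y : Ω) = 1 := by
    have := congrArg (Subtype.val) hy
    simpa [integersToValuationRing] using this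
  have h2 := y.2
  change (PadicAlgCl.valued p).v (IsAlgClosed.lift (y : Ω)) ≤ 1 at h2
  set f : Ω →ₐ[ℚ] PadicAlgCl p := IsAlgClosed.lift
  have h3 := congrArg f h1
  rw [map_mul, map_natCast, map_one] at h3
  have h4 := congrArg (PadicAlgCl.valued p).v h3
  rw [map_mul, map_one] at h4
  have h5 : (PadicAlgCl.valued p).v (p : PadicAlgCl p) = 1 / p := PadicAlgCl.valuation_p p
  rw [h5] at h4
  have hp : (1 : NNReal) / p < 1 := by
    rw [div_lt_one (by exact_mod_cast (Fact.out : p.Prime).pos)]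
    exact_mod_cast (Fact.out : p.Prime).one_lt
  have h6 : (1 : NNReal) / p * (PadicAlgCl.valued p).v (f y) < 1 :=
    mul_lt_one_of_nonneg_of_lt_one_left zero_le hp h2
  exact h6.ne h4

/-- The elements of the chosen valuation ring are quotients of algebraic integers with
denominator prime to the chosen place. -/
theorem exists_eq_div_of_mem_padicValuationRing {x : Ω} (hx : x ∈ padicValuationRing p) :
    ∃ b c : 𝓞 Ω, c ∉ primeAbove p ∧ algebraMap (𝓞 Ω) Ω c * x = algebraMap (𝓞 Ω) Ω b := by
  let F := IntermediateField.adjoin ℚ {x}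
  have : FiniteDimensional ℚ F := IntermediateField.adjoin.finiteDimensional
    (Algebra.IsIntegral.isIntegral x)
  have : NumberField F := NumberField.mk
  let P := (primeAbove p).comap (algebraMap (𝓞 F) (𝓞 Ω))
  have hP : P.IsPrime := Ideal.IsPrime.comap _
  have hP0 : P ≠ ⊥ := by
    intro h
    have : (p : 𝓞 F) ∈ P := by
      rw [Ideal.mem_comap, map_natCast]
      exact natCast_mem_primeAbove p
    rw [h, Ideal.mem_bot, Nat.cast_eq_zero] at this
    exact (Fact.out : p.Prime).ne_zero this
  have hdvr : IsDiscreteValuationRing (Localization.AtPrime P) :=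
    IsLocalization.AtPrime.isDiscreteValuationRing_of_dedekind_domain (𝓞 F) hP0 _
  obtain ⟨a, b, hb, hab⟩ := IsFractionRing.div_surjective (A := 𝓞 F)
    (⟨x, IntermediateField.mem_adjoin_simple_self ℚ x⟩ : F)
  have hb0 : b ≠ 0 := nonZeroDivisors.ne_zero hb
  have hmap : ∀ y : 𝓞 F, algebraMap (𝓞 Ω) Ω (algebraMap (𝓞 F) (𝓞 Ω) y) =
      ((algebraMap (𝓞 F) F y : F) : Ω) := fun _ => rfl
  have hab' : algebraMap (𝓞 Ω) Ω (algebraMap (𝓞 F) (𝓞 Ω) b) * x =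
      algebraMap (𝓞 Ω) Ω (algebraMap (𝓞 F) (𝓞 Ω) a) := by
    have h1 := congrArg (fun z : F => algebraMap (𝓞 F) F b * z) hab
    beta_reduce at h1
    rw [mul_div_cancel₀ _ (by simpa using hb0)] at h1
    rw [hmap, hmap, h1]
    rfl
  have hb0' : algebraMap (𝓞 Ω) Ω (algebraMap (𝓞 F) (𝓞 Ω) b) ≠ 0 := by
    rw [hmap]
    simpa using hb0
  -- The local ring of `F` at the prime below the place is a valuation ring, so one of numerator and
  -- denominator divides the other there.
  have hdiv := ValuationRing.cond (algebraMap (𝓞 F) (Localization.AtPrime P) a)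
    (algebraMap (𝓞 F) (Localization.AtPrime P) b)
  have key : ∀ a b : 𝓞 F, (∃ c : Localization.AtPrime P,
      algebraMap (𝓞 F) (Localization.AtPrime P) a * c =
        algebraMap (𝓞 F) (Localization.AtPrime P) b) →
      ∃ d s : 𝓞 F, s ∉ P ∧ a * d = b * s := by
    rintro a b ⟨c, hc⟩
    obtain ⟨d, s, rfl⟩ := IsLocalization.exists_mk'_eq P.primeCompl c
    refine ⟨d, s, s.2, ?_⟩
    rw [IsLocalization.mul_mk'_eq_mk'_of_mul, IsLocalization.mk'_eq_iff_eq_mul,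
      ← map_mul] at hc
    exact IsLocalization.injective _ P.primeCompl_le_nonZeroDivisors hc
  obtain ⟨c, hc | hc⟩ := hdiv
  · obtain ⟨d, s, hs, hds⟩ := key a b ⟨c, hc⟩
    have h1 : algebraMap (𝓞 Ω) Ω (algebraMap (𝓞 F) (𝓞 Ω) d) * x =
        algebraMap (𝓞 Ω) Ω (algebraMap (𝓞 F) (𝓞 Ω) s) := by
      have h2 := congrArg (fun y => algebraMap (𝓞 Ω) Ω (algebraMap (𝓞 F) (𝓞 Ω) y)) hds
      simp only [map_mul] at h2
      refine mul_left_cancel₀ hb0' ?_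
      linear_combination h2 + algebraMap (𝓞 Ω) Ω (algebraMap (𝓞 F) (𝓞 Ω) d) * hab'
    -- Here `d x = s` with `s` a unit at the place. Since `x` is integral at the place, `d` must be
    -- a unit too.
    refine ⟨_, _, fun hd => hs ?_, h1⟩
    have h3 : integersToValuationRing p (algebraMap (𝓞 F) (𝓞 Ω) d) * ⟨x, hx⟩ =
        integersToValuationRing p (algebraMap (𝓞 F) (𝓞 Ω) s) := Subtype.ext h1
    rw [Ideal.mem_comap, mem_primeAbove_iff, ← h3]
    exact Ideal.mul_mem_right _ _ hd
  · obtain ⟨d, s, hs, hds⟩ := key b a ⟨c, hc⟩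
    refine ⟨algebraMap (𝓞 F) (𝓞 Ω) d, algebraMap (𝓞 F) (𝓞 Ω) s, hs, ?_⟩
    have h2 := congrArg (fun y => algebraMap (𝓞 Ω) Ω (algebraMap (𝓞 F) (𝓞 Ω) y)) hds
    simp only [map_mul] at h2
    refine mul_left_cancel₀ hb0' ?_
    linear_combination -h2 + algebraMap (𝓞 Ω) Ω (algebraMap (𝓞 F) (𝓞 Ω) s) * hab'

/-- The inertia group of the prime of the ring of algebraic integers below the chosen place is
contained in the inertia group of that place. -/
theorem inertia_primeAbove_le {τ : GalQ} (hτ : ∀ b : 𝓞 Ω, τ • b - b ∈ primeAbove p) :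
    τ ∈ inertiaGroup p := by
  have hcoe : ∀ (τ : GalQ) (b : 𝓞 Ω), algebraMap (𝓞 Ω) Ω (τ • b) = τ (algebraMap (𝓞 Ω) Ω b) :=
    fun _ _ => rfl
  have key : ∀ τ : GalQ, (∀ b : 𝓞 Ω, τ • b - b ∈ primeAbove p) →
      ∀ x : padicValuationRing p, ∃ h : τ (x : Ω) ∈ padicValuationRing p,
        (⟨τ x, h⟩ : padicValuationRing p) - x ∈ maximalIdeal (padicValuationRing p) := by
    rintro τ hτ ⟨x, hx⟩
    obtain ⟨b, c, hc, hbc⟩ := exists_eq_div_of_mem_padicValuationRing p hx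
    have hτc : τ • c ∉ primeAbove p := fun h => hc <| by
      have := (primeAbove p).sub_mem h (hτ c)
      rwa [sub_sub_cancel] at this
    have hu : IsUnit (integersToValuationRing p (τ • c)) := by
      by_contra h
      exact hτc h
    have hu' : IsUnit (integersToValuationRing p c) := by
      by_contra h
      exact hc h
    obtain ⟨w, hw⟩ := hu.exists_left_inv
    obtain ⟨w', hw'⟩ := hu'.exists_left_inv
    have h1 : τ (algebraMap (𝓞 Ω) Ω c) * τ x = τ (algebraMap (𝓞 Ω) Ω b) := by
      rw [← map_mul, hbc]
    have hw1 : (w : Ω) * τ (algebraMap (𝓞 Ω) Ω c) = 1 := congrArg Subtype.val hw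
    have h2 : τ x = w * algebraMap (𝓞 Ω) Ω (τ • b) := by
      rw [hcoe, ← h1, ← mul_assoc, hw1, one_mul]
    have h3 : τ x ∈ padicValuationRing p := by
      rw [h2]
      exact mul_mem w.2 (ringOfIntegers_mem_valuationSubring _ _)
    refine ⟨h3, ?_⟩
    have h4 : (⟨τ x, h3⟩ : padicValuationRing p) = w * integersToValuationRing p (τ • b) :=
      Subtype.ext h2
    have h5 : (integersToValuationRing p c) * ⟨x, hx⟩ = integersToValuationRing p b :=
      Subtype.ext hbc
    -- With `x = b / c` this is `τx - x = (τc)⁻¹ ((τb - b) - (τc - c) x)`.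
    have h6 : (⟨τ x, h3⟩ : padicValuationRing p) - ⟨x, hx⟩ =
        w * (integersToValuationRing p (τ • b - b) -
          integersToValuationRing p (τ • c - c) * ⟨x, hx⟩) := by
      rw [h4, map_sub, map_sub]
      linear_combination (-w) * h5 + (⟨x, hx⟩ : padicValuationRing p) * hw
    rw [h6]
    exact Ideal.mul_mem_left _ _ (Ideal.sub_mem _ (hτ b) (Ideal.mul_mem_right _ _ (hτ c)))
  have hτ' : ∀ b : 𝓞 Ω, τ⁻¹ • b - b ∈ primeAbove p := fun b => by
    have := (primeAbove p).neg_mem (hτ (τ⁻¹ • b))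
    rwa [smul_inv_smul, neg_sub] at this
  -- `key` gives only one inclusion between the valuation ring and its translate; applying it to
  -- `τ⁻¹` gives the other.
  have hD : τ ∈ decompositionGroup p := by
    change τ • padicValuationRing p = padicValuationRing p
    ext x
    rw [ValuationSubring.mem_pointwise_smul_iff_inv_smul_mem]
    refine ⟨fun h => ?_, fun h => (key τ⁻¹ hτ' ⟨x, h⟩).1⟩
    have := (key τ hτ ⟨_, h⟩).1
    rwa [← AlgEquiv.smul_def, smul_inv_smul] at this
  refine ⟨⟨τ, hD⟩, ?_, rfl⟩
  change _ = _
  ext y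
  obtain ⟨x, rfl⟩ := residue_surjective y
  change residue _ _ = residue _ _
  rw [← sub_eq_zero, ← map_sub, residue_eq_zero_iff]
  exact (key τ hτ x).2

theorem isOpen_stabilizer_ringOfIntegers (M : IntermediateField ℚ Ω) (b : 𝓞 Ω) :
    IsOpen (MulAction.stabilizer (Ω ≃ₐ[M] Ω) b : Set (Ω ≃ₐ[M] Ω)) := by
  let x := algebraMap (𝓞 Ω) Ω b
  have : FiniteDimensional M (IntermediateField.adjoin M {x}) :=
    IntermediateField.adjoin.finiteDimensional (Algebra.IsIntegral.isIntegral x)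
  refine Subgroup.isOpen_mono (H₁ := (IntermediateField.adjoin M {x}).fixingSubgroup) ?_
    (IntermediateField.fixingSubgroup_isOpen _)
  intro τ hτ
  rw [IntermediateField.mem_fixingSubgroup_iff] at hτ
  exact RingOfIntegers.ext (hτ x (IntermediateField.mem_adjoin_simple_self M x))

/-- Infinite Galois theory restricted to integers. It makes available, for `Gal(Ω/M)`, the
transitivity on primes over a given prime and the surjectivity of decomposition groups onto residual
automorphisms. -/
instance (M : IntermediateField ℚ Ω) :
    Algebra.IsInvariant (𝓞 M) (𝓞 Ω) (Ω ≃ₐ[M] Ω) where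
  isInvariant b hb := by
    have h1 : algebraMap (𝓞 Ω) Ω b ∈ Set.range (algebraMap M Ω) := by
      rw [InfiniteGalois.mem_range_algebraMap_iff_fixed]
      intro τ
      exact congrArg (algebraMap (𝓞 Ω) Ω) (hb τ)
    obtain ⟨y, hy⟩ := h1
    have h2 : IsIntegral ℤ y := by
      rw [← isIntegral_algebraMap_iff (algebraMap M Ω).injective, hy]
      exact RingOfIntegers.isIntegral_coe b
    exact ⟨⟨y, h2⟩, RingOfIntegers.ext hy⟩

instance (M : IntermediateField ℚ Ω) : SMulCommClass (Ω ≃ₐ[M] Ω) (𝓞 M) (𝓞 Ω) where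
  smul_comm τ a b := by
    apply RingOfIntegers.ext
    rw [Algebra.smul_def, Algebra.smul_def]
    change τ (_ * _) = _ * τ _
    rw [map_mul]
    congr 1
    exact τ.commutes a

attribute [local instance] Ideal.Quotient.field in
/-- An automorphism of a finite normal extension that lies in the inertia group of the prime below
the chosen place lifts to the inertia group of that place. -/
theorem exists_lift_inertia (M : IntermediateField ℚ Ω) [Normal ℚ M] (σ : M ≃ₐ[ℚ] M)
    (hσ : ∀ b : 𝓞 M, σ • b - b ∈ (primeAbove p).comap (algebraMap (𝓞 M) (𝓞 Ω))) :
    ∃ τ : GalQ, (∀ b : 𝓞 Ω, τ • b - b ∈ primeAbove p) ∧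
      ∀ x : M, τ (x : Ω) = (σ x : M) := by
  let _ : TopologicalSpace (𝓞 Ω) := ⊥
  have : DiscreteTopology (𝓞 Ω) := ⟨rfl⟩
  have : ContinuousSMul (Ω ≃ₐ[M] Ω) (𝓞 Ω) :=
    continuousSMul_iff_stabilizer_isOpen.2 (isOpen_stabilizer_ringOfIntegers M)
  set Q := primeAbove p with hQ
  set P := Q.comap (algebraMap (𝓞 M) (𝓞 Ω)) with hP
  obtain ⟨τ₀, hτ₀⟩ := AlgEquiv.restrictNormalHom_surjective (F := ℚ) (K₁ := M) Ω σ
  have hres : ∀ x : M, τ₀ (x : Ω) = (σ x : M) := fun x => by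
    rw [← hτ₀]
    exact (AlgEquiv.restrictNormal_commutes τ₀ M x).symm
  have hres' : ∀ b : 𝓞 M, τ₀ • algebraMap (𝓞 M) (𝓞 Ω) b = algebraMap (𝓞 M) (𝓞 Ω) (σ • b) :=
    fun b => RingOfIntegers.ext (hres b)
  have hQ' : (τ₀ • Q).under (𝓞 M) = Q.under (𝓞 M) := by
    ext b
    rw [Ideal.mem_comap, Ideal.mem_pointwise_smul_iff_inv_smul_mem]
    have h1 : τ₀⁻¹ • algebraMap (𝓞 M) (𝓞 Ω) b = algebraMap (𝓞 M) (𝓞 Ω) (σ⁻¹ • b) := by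
      rw [inv_smul_eq_iff, hres', smul_inv_smul]
    rw [h1, ← Ideal.mem_comap]
    have h2 := hσ (σ⁻¹ • b)
    rw [smul_inv_smul] at h2
    change σ⁻¹ • b ∈ P ↔ b ∈ P
    exact ⟨fun h => by simpa using Ideal.add_mem _ h2 h,
      fun h => by simpa using Ideal.sub_mem _ h h2⟩
  have hprime : (τ₀ • Q).IsPrime := inferInstance
  -- The arbitrary lift `τ₀` of `σ` may move `Q` to another prime over `P`. An element of `Gal(Ω/M)`
  -- moves it back without changing the restriction to `M`.
  obtain ⟨g, hg⟩ := Algebra.IsInvariant.exists_smul_of_under_eq_of_profinite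
    (A := 𝓞 M) (G := Ω ≃ₐ[M] Ω) (τ₀ • Q) Q hQ'
  set τ₁ : GalQ := (g.restrictScalars ℚ) * τ₀ with hτ₁
  have hgsmul : ∀ (g : Ω ≃ₐ[M] Ω) (b : 𝓞 Ω), g.restrictScalars ℚ • b = g • b := fun _ _ => rfl
  have hstab : ∀ b, τ₁ • b ∈ Q ↔ b ∈ Q := fun b => by
    conv_lhs => rw [hg]
    rw [hτ₁, mul_smul, hgsmul, Ideal.smul_mem_pointwise_smul_iff,
      Ideal.smul_mem_pointwise_smul_iff]
  have hres₁ : ∀ b : 𝓞 M, τ₁ • algebraMap (𝓞 M) (𝓞 Ω) b = algebraMap (𝓞 M) (𝓞 Ω) (σ • b) :=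
    fun b => by
      rw [hτ₁, mul_smul, hres', hgsmul]
      exact RingOfIntegers.ext (g.commutes ((σ • b : 𝓞 M) : M))
  have : Q.LiesOver P := ⟨rfl⟩
  have hmap : Q = Q.map (MulSemiringAction.toRingEquiv GalQ (𝓞 Ω) τ₁ : 𝓞 Ω →+* 𝓞 Ω) := by
    have : Q = τ₁ • Q := by
      ext b
      rw [Ideal.mem_pointwise_smul_iff_inv_smul_mem, ← hstab (τ₁⁻¹ • b), smul_inv_smul]
    exact this
  let e₀ : (𝓞 Ω ⧸ Q) ≃+* (𝓞 Ω ⧸ Q) :=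
    Ideal.quotientEquiv Q Q (MulSemiringAction.toRingEquiv GalQ (𝓞 Ω) τ₁) hmap
  have he₀ : ∀ b : 𝓞 Ω, e₀ (Ideal.Quotient.mk Q b) = Ideal.Quotient.mk Q (τ₁ • b) := fun _ => rfl
  let e : (𝓞 Ω ⧸ Q) ≃ₐ[𝓞 M ⧸ P] (𝓞 Ω ⧸ Q) := AlgEquiv.ofRingEquiv (f := e₀) fun y => by
    obtain ⟨b, rfl⟩ := Ideal.Quotient.mk_surjective y
    rw [Ideal.Quotient.algebraMap_mk_of_liesOver, he₀, hres₁, Ideal.Quotient.eq, ← map_sub]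
    exact hσ b
  -- As `σ` is trivial modulo `P`, the automorphism of the residue field of `Q` induced by `τ₁` is
  -- linear over that of `P`. It is therefore also induced by some `γ` trivial on `M`, and `γ⁻¹ τ₁`
  -- is inertial.
  obtain ⟨γ, hγ⟩ := Ideal.Quotient.stabilizerHom_surjective_of_profinite (G := Ω ≃ₐ[M] Ω) P Q e
  have hγ' : ∀ b : 𝓞 Ω, (γ : Ω ≃ₐ[M] Ω) • b - τ₁ • b ∈ Q := fun b => by
    have h1 := DFunLike.congr_fun hγ (Ideal.Quotient.mk Q b)
    rw [← Ideal.Quotient.eq]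
    exact h1
  refine ⟨((γ : Ω ≃ₐ[M] Ω).restrictScalars ℚ)⁻¹ * τ₁, fun b => ?_, fun x => ?_⟩
  · have h1 := hγ' b
    have h2 : (γ : Ω ≃ₐ[M] Ω)⁻¹ • ((γ : Ω ≃ₐ[M] Ω) • b - τ₁ • b) ∈ Q := by
      have h3 : (γ : Ω ≃ₐ[M] Ω)⁻¹ • Q = Q := (γ⁻¹).2
      have h4 := Ideal.smul_mem_pointwise_smul (γ : Ω ≃ₐ[M] Ω)⁻¹ _ Q h1
      rwa [h3] at h4
    rw [smul_sub, inv_smul_smul] at h2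
    have h4 := Q.neg_mem h2
    rw [neg_sub] at h4
    exact h4
  · change (γ : Ω ≃ₐ[M] Ω)⁻¹ (g (τ₀ (x : Ω))) = _
    rw [hres, show g ((σ x : M) : Ω) = (σ x : M) from g.commutes _]
    exact (γ : Ω ≃ₐ[M] Ω)⁻¹.commutes _

/-- If inertia at `p` acts trivially on a finite Galois extension of `ℚ` then this extension is
unramified at the primes above `p`. -/
theorem isUnramifiedAt_of_inertiaGroup_le (M : IntermediateField ℚ Ω) [FiniteDimensional ℚ M]
    [Normal ℚ M] (h : inertiaGroup p ≤ M.fixingSubgroup) [NumberField M]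
    (P : Ideal (𝓞 M)) [P.IsPrime] (hP : (p : 𝓞 M) ∈ P) : Algebra.IsUnramifiedAt ℤ P := by
  have : IsGalois ℚ M := ⟨⟩
  set P₀ := (primeAbove p).comap (algebraMap (𝓞 M) (𝓞 Ω)) with hP₀
  have hp : p.Prime := Fact.out
  have hprime : P₀.IsPrime := Ideal.IsPrime.comap _
  have hP₀p : (p : 𝓞 M) ∈ P₀ := by
    rw [hP₀, Ideal.mem_comap, map_natCast]
    exact natCast_mem_primeAbove p
  have hmax : (Ideal.span {(p : ℤ)}).IsMaximal :=
    PrincipalIdealRing.isMaximal_of_irreducible (Nat.prime_iff_prime_int.1 hp).irreducible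
  have hunder : ∀ (Q : Ideal (𝓞 M)) [Q.IsPrime], (p : 𝓞 M) ∈ Q →
      Q.LiesOver (Ideal.span {(p : ℤ)}) := by
    intro Q hQ hpQ
    refine ⟨hmax.eq_of_le (Ideal.IsPrime.ne_top inferInstance) ?_⟩
    rw [Ideal.span_singleton_le_iff_mem]
    simpa [Ideal.under_def] using hpQ
  have h1 := hunder P hP
  have h2 := hunder P₀ hP₀p
  have hperf (q : Ideal ℤ) [q.IsPrime] (hq : q = Ideal.span {(p : ℤ)}) :
      PerfectField q.ResidueField := by
    subst hq
    have : Finite (ℤ ⧸ Ideal.span {(p : ℤ)}) :=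
      Ring.HasFiniteQuotients.finiteQuotient (by simpa using hp.ne_zero)
    have : Finite (Ideal.span {(p : ℤ)}).ResidueField :=
      Finite.of_surjective _ (Ideal.bijective_algebraMap_quotient_residueField _).surjective
    infer_instance
  have := hperf _ rfl
  have hcard := Ideal.card_inertia_eq_ramificationIdxIn (G := Gal(M/ℚ)) (Ideal.span {(p : ℤ)}) P₀
  rw [Ideal.ramificationIdxIn_eq_ramificationIdx (Ideal.span {(p : ℤ)}) P Gal(M/ℚ)] at hcard
  -- The order of this group is the ramification index, which is the same at all primes above `p` in
  -- a Galois extension. Its elements lift to inertia in the absolute group, which fixes `M`.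
  have htriv : P₀.inertia Gal(M/ℚ) = ⊥ := by
    rw [eq_bot_iff]
    intro σ hσ
    obtain ⟨τ, hτ, hτσ⟩ := exists_lift_inertia p M σ hσ
    have h3 := h (inertia_primeAbove_le p hτ)
    rw [IntermediateField.mem_fixingSubgroup_iff] at h3
    rw [Subgroup.mem_bot]
    ext x
    rw [← hτσ x, h3 x x.2]
    rfl
  rw [htriv, Subgroup.card_bot] at hcard
  have hunder' : P.under ℤ = Ideal.span {(p : ℤ)} := h1.over.symm
  have : PerfectField (P.under ℤ).ResidueField := hperf (P.under ℤ) hunder'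
  exact Ideal.ramificationIdx_eq_one_iff.1 hcard.symm

end Inertia

/-! ### Generators of Galois groups with restricted ramification -/

section Generation

/-- An analogue of the finiteness theorem of Hermite and Minkowski implies that the extensions
of `p`-power degree of a fixed one are generated by finitely many elements. -/
theorem exists_finite_closure_sup_eq_top {G : Type*} [Group G] {p : ℕ} [Fact p.Prime]
    (F : Set (Subgroup G)) (htop : ⊤ ∈ F) (hnormal : ∀ N ∈ F, N.Normal)
    (hindex : ∀ N ∈ F, N.FiniteIndex) (hinf : ∀ N ∈ F, ∀ N' ∈ F, N ⊓ N' ∈ F)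
    (hup : ∀ N ∈ F, ∀ N' : Subgroup G, N'.Normal → N ≤ N' → N' ∈ F)
    (hfin : ∀ n : ℕ, {N ∈ F | N.index ≤ n}.Finite) {H : Subgroup G} (hH : H ∈ F) :
    ∃ s : Set G, s.Finite ∧ ∀ N ∈ F, (∀ h ∈ H, ∃ k : ℕ, h ^ p ^ k ∈ N) →
      Subgroup.closure s ⊔ N = ⊤ := by
  have hp : p.Prime := Fact.out
  -- A bound for the index of the normal core of any subgroup of index `H.index * p`, through the
  -- action on cosets.
  let m := Nat.factorial (H.index * p)
  obtain ⟨U, hU, hUH, hUm⟩ : ∃ U ∈ F, U ≤ H ∧ ∀ N ∈ F, N.index ≤ m → U ≤ N := by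
    have key : ∀ s : Finset (Subgroup G), (∀ N ∈ s, N ∈ F) → s.inf id ∈ F := by
      intro s
      classical
      induction s using Finset.induction_on with
      | empty => exact fun _ => htop
      | insert a s _ ih =>
        intro h
        rw [Finset.inf_insert]
        exact hinf _ (h a (by simp)) _ (ih fun N hN => h N (by simp [hN]))
    refine ⟨H ⊓ (hfin m).toFinset.inf id, hinf _ hH _ (key _ fun N hN => ?_), inf_le_left,
      fun N hN hNm => inf_le_right.trans (Finset.inf_le (f := id) ?_)⟩
    · exact ((hfin m).mem_toFinset.1 hN).1
    · exact (hfin m).mem_toFinset.2 ⟨hN, hNm⟩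
  have := hnormal U hU
  have := hindex U hU
  have := hindex H hH
  have : Finite (Quotient (QuotientGroup.leftRel U)) := inferInstanceAs (Finite (G ⧸ U))
  refine ⟨Set.range (Quotient.out : G ⧸ U → G), Set.finite_range _, ?_⟩
  set S := Subgroup.closure (Set.range (Quotient.out : G ⧸ U → G)) with hS
  have hSU : S ⊔ U = ⊤ := by
    rw [eq_top_iff]
    intro g _
    have h1 : (Quotient.out (g : G ⧸ U)) ∈ S := Subgroup.subset_closure ⟨_, rfl⟩
    have h2 : (Quotient.out (g : G ⧸ U))⁻¹ * g ∈ U := by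
      rw [← QuotientGroup.eq]
      exact Quotient.out_eq _
    have := Subgroup.mul_mem_sup h1 h2
    rwa [mul_inv_cancel_left] at this
  suffices key : ∀ N ∈ F, N ≤ H → (∀ h ∈ H, ∃ k : ℕ, h ^ p ^ k ∈ N) → S ⊔ N = ⊤ by
    intro N hN h
    rw [eq_top_iff, ← key (H ⊓ N) (hinf _ hH _ hN) inf_le_left fun x hx => ?_]
    · exact sup_le_sup_left inf_le_right _
    · obtain ⟨k, hk⟩ := h x hx
      exact ⟨k, H.pow_mem hx _, hk⟩
  intro N hN hNH hpow
  have := hnormal N hN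
  have := hindex N hN
  by_contra hne
  set D := S ⊔ N with hD
  have hND : N ≤ D := le_sup_right
  have hHD : ¬ H ≤ D := fun h => hne <| by
    rw [eq_top_iff, ← hSU]
    exact sup_le le_sup_left (hUH.trans h)
  let π := QuotientGroup.mk' N
  have hker : π.ker = N := QuotientGroup.ker_mk' N
  have hcomap : ∀ K : Subgroup G, N ≤ K → (K.map π).comap π = K := fun K hK => by
    rw [Subgroup.comap_map_eq, hker, sup_eq_left.2 hK]
  have hpg : IsPGroup p (H.map π) := by
    rintro ⟨_, h, hh, rfl⟩
    obtain ⟨k, hk⟩ := hpow h hh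
    refine ⟨k, Subtype.ext ?_⟩
    change π h ^ p ^ k = 1
    rw [← map_pow, ← MonoidHom.mem_ker, hker]
    exact hk
  have hfinite : Finite (G ⧸ N) := inferInstance
  obtain ⟨a, ha⟩ := IsPGroup.iff_card.1 hpg
  let E := ((D ⊓ H).map π).subgroupOf (H.map π)
  have hEle : (D ⊓ H).map π ≤ H.map π := Subgroup.map_mono inf_le_right
  obtain ⟨b, hb⟩ := IsPGroup.iff_card.1 (hpg.to_subgroup E)
  have hba : b < a := by
    have h1 : p ^ b ∣ p ^ a := by
      rw [← ha, ← hb]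
      exact Subgroup.card_subgroup_dvd_card _
    refine lt_of_le_of_ne ((Nat.pow_dvd_pow_iff_le_right hp.one_lt).1 h1) fun hab => hHD ?_
    have h2 : E = ⊤ := Subgroup.eq_top_of_card_eq _ (by rw [hb, ha, hab])
    have h3 : H.map π ≤ (D ⊓ H).map π := Subgroup.subgroupOf_eq_top.1 h2
    have h4 := Subgroup.comap_mono (f := π) h3
    rw [hcomap _ hNH, hcomap _ (le_inf hND hNH)] at h4
    exact h4.trans inf_le_left
  -- Frattini argument: a proper subgroup of the `p`-group `H / N` lies in one of index `p`. The
  -- preimage of the latter in `G` has index `H.index * p`, hence contains `U`. Since `D` and `U`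
  -- generate `G` and `U ≤ H`, that preimage would then contain `H`, which is absurd.
  obtain ⟨K, hK, hEK⟩ := Sylow.exists_subgroup_card_pow_prime_le p (m := a - 1)
    (by rw [ha]; exact pow_dvd_pow _ (Nat.sub_le _ _)) E hb (Nat.le_sub_one_of_lt hba)
  set K' := K.map (H.map π).subtype with hK'
  have hK'card : Nat.card K' = p ^ (a - 1) := by
    rw [← hK]
    exact Nat.card_congr (K.equivMapOfInjective _ (H.map π).subtype_injective).toEquiv.symm
  have hH'index : (K'.comap π).index = H.index * p := by
    have h1 : (K'.comap π).index = K'.index :=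
      K'.index_comap_of_surjective (QuotientGroup.mk'_surjective N)
    have h2 : H.index = (H.map π).index := by
      conv_lhs => rw [← hcomap H hNH]
      exact (H.map π).index_comap_of_surjective (QuotientGroup.mk'_surjective N)
    have h3 := (H.map π).card_mul_index
    have h4 := K'.card_mul_index
    rw [h1, h2]
    rw [hK'card, ← h3, ha] at h4
    have h5 : p ^ a = p ^ (a - 1) * p := by
      rw [← pow_succ, Nat.sub_add_cancel (by omega)]
    rw [h5, mul_assoc] at h4
    rw [Nat.eq_of_mul_eq_mul_left (pow_pos hp.pos _) h4, mul_comm]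
  have hNH' : N ≤ K'.comap π := by
    conv_lhs => rw [← hker]
    exact Subgroup.ker_le_comap π K'
  have hcoreF := hup N hN (K'.comap π).normalCore inferInstance (Subgroup.normal_le_normalCore.2 hNH')
  have hcoreindex : (K'.comap π).normalCore.index ≤ m := by
    have : (K'.comap π).FiniteIndex := ⟨by
      rw [hH'index]
      exact mul_ne_zero Subgroup.FiniteIndex.index_ne_zero hp.ne_zero⟩
    refine Nat.le_of_dvd (Nat.factorial_pos _) ?_
    change _ ∣ (H.index * p).factorial
    rw [← hH'index, Subgroup.normalCore_eq_ker, Subgroup.index_ker, Subgroup.index_eq_card,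
      ← Nat.card_perm]
    exact Subgroup.card_subgroup_dvd_card _
  have hUK : U ≤ K'.comap π := (hUm _ hcoreF hcoreindex).trans (Subgroup.normalCore_le _)
  have hHK : H ≤ K'.comap π := by
    intro h hh
    have h1 : h ∈ D ⊔ U := by
      have : D ⊔ U = ⊤ := eq_top_iff.2 (hSU ▸ sup_le_sup_right le_sup_left _)
      rw [this]
      trivial
    obtain ⟨d, hd, u, hu, rfl⟩ := Subgroup.mem_sup_of_normal_right.1 h1
    have hdH : d ∈ H := (H.mul_mem_cancel_right (hUH hu)).1 hh
    refine mul_mem ?_ (hUK hu)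
    have h2 : π d ∈ (D ⊓ H).map π := Subgroup.mem_map_of_mem _ ⟨hd, hdH⟩
    exact ⟨⟨π d, hEle h2⟩, hEK h2, rfl⟩
  have hle := Subgroup.card_le_of_le (show H.map π ≤ K' from Subgroup.map_le_iff_le_comap.2 hHK)
  rw [ha, hK'card] at hle
  exact absurd hle (not_le.2 (Nat.pow_lt_pow_right hp.one_lt (by omega)))

open NumberField

/-- The open normal subgroups of the absolute Galois group of `ℚ` that contain inertia at the
primes outside `S`. -/
def openNormalSubgroupsUnramifiedOutside (S : Set ℕ) : Set (Subgroup GalQ) :=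
  {N | N.Normal ∧ IsOpen (N : Set GalQ) ∧ ∀ (p : ℕ) [Fact p.Prime], p ∉ S → inertiaGroup p ≤ N}

instance : CompactSpace GalQ := inferInstance

/-- The theorem of Hermite and Minkowski for normal extensions of `ℚ`. -/
theorem finite_openNormalSubgroupsUnramifiedOutside (S : Finset ℕ) (n : ℕ) :
    {N ∈ openNormalSubgroupsUnramifiedOutside S | N.index ≤ n}.Finite := by
  let S' := S.filter Nat.Prime
  let B : ℕ := ((∏ p ∈ S', p) ^ n) ^ n
  have hpos : 0 < ∏ p ∈ S', p := Finset.prod_pos fun p hp => (Finset.mem_filter.1 hp).2.pos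
  have hfin := NumberField.finite_of_discr_bdd (AlgebraicClosure ℚ) B
  refine Set.Finite.subset (hfin.image fun K => K.1.fixingSubgroup) ?_
  rintro N ⟨⟨hN, hopen, hI⟩, hn⟩
  let M := IntermediateField.fixedField N
  have hMN : M.fixingSubgroup = N :=
    InfiniteGalois.fixingSubgroup_fixedField ⟨N, Subgroup.isClosed_of_isOpen N hopen⟩
  have hfd : FiniteDimensional ℚ M :=
    (InfiniteGalois.isOpen_iff_finite M).1 (by rw [hMN]; exact hopen)
  have hgal : IsGalois ℚ M := (InfiniteGalois.normal_iff_isGalois M).1 (by rw [hMN]; exact hN)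
  have hNF : NumberField M := NumberField.mk
  refine ⟨⟨M, hfd⟩, ?_, hMN⟩
  have h1 : (discr M).natAbs ≤ _ := natAbs_discr_le_of_isUnramifiedAt M S'
    (fun p hp => (Finset.mem_filter.1 hp).2) fun p hp hpS P _ hP => by
      have : Fact p.Prime := ⟨hp⟩
      refine isUnramifiedAt_of_inertiaGroup_le p M ?_ P hP
      rw [hMN]
      exact hI p fun h => hpS (Finset.mem_filter.2 ⟨h, hp⟩)
  have h2 : Module.finrank ℚ M ≤ n := by
    rw [IntermediateField.finrank_eq_fixingSubgroup_index, hMN]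
    exact hn
  have h3 : (discr M).natAbs ≤ B := h1.trans <| by
    change _ ≤ ((∏ p ∈ S', p) ^ n) ^ n
    rw [← pow_mul, ← pow_mul]
    exact Nat.pow_le_pow_right hpos (Nat.mul_le_mul h2 h2)
  change |discr M| ≤ B
  rw [Int.abs_eq_natAbs]
  exact_mod_cast h3

/-- There are finitely many elements that generate, topologically, every Galois group of a pro-`p`
extension, unramified outside `S`, of a fixed number field that is Galois over `ℚ`. -/
theorem exists_finite_closure_sup_eq_top_of_unramifiedOutside {p : ℕ} [Fact p.Prime]
    (S : Finset ℕ) {H : Subgroup GalQ} (hH : H ∈ openNormalSubgroupsUnramifiedOutside S) :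
    ∃ s : Set GalQ, s.Finite ∧ ∀ N ∈ openNormalSubgroupsUnramifiedOutside S,
      (∀ h ∈ H, ∃ k : ℕ, h ^ p ^ k ∈ N) → Subgroup.closure s ⊔ N = ⊤ := by
  refine exists_finite_closure_sup_eq_top (openNormalSubgroupsUnramifiedOutside S)
    ⟨inferInstance, isOpen_univ, fun _ _ _ => le_top⟩
    (fun N hN => hN.1) (fun N hN => ?_) (fun N hN N' hN' => ?_) (fun N hN N' h h' => ?_)
    (finite_openNormalSubgroupsUnramifiedOutside S) hH
  · have := Subgroup.quotient_finite_of_isOpen N hN.2.1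
    exact Subgroup.finiteIndex_of_finite_quotient
  · have := hN.1
    have := hN'.1
    exact ⟨inferInstance, hN.2.1.inter hN'.2.1, fun q _ hq => le_inf (hN.2.2 q hq) (hN'.2.2 q hq)⟩
  · exact ⟨h, Subgroup.isOpen_mono h' hN.2.1, fun q _ hq => (hN.2.2 q hq).trans h'⟩

end Generation

/-! ### Isomorphism over the total ring of fractions -/

section Intertwining

open Matrix

/-- A nonscalar subalgebra of `M₂(K)` contains a left ideal isomorphic to the standard module. -/
theorem exists_leftIdeal_equiv {K : Type*} [Field K] (A : Subalgebra K (Matrix (Fin 2) (Fin 2) K))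
    (hA : A ≠ ⊥) : ∃ (v : Fin 2 → K) (f : Fin 2 → Matrix (Fin 2) (Fin 2) K),
      (∀ j, f j ∈ A) ∧ (∀ j, f j *ᵥ v = Pi.single j 1) ∧
        ∀ a ∈ A, ∀ j, a * f j = ∑ i, a i j • f i := by
  obtain ⟨a, ha, has⟩ : ∃ a ∈ A, a ∉ (⊥ : Subalgebra K (Matrix (Fin 2) (Fin 2) K)) :=
    SetLike.exists_of_lt (bot_lt_iff_ne_bot.2 hA)
  obtain ⟨v, hv⟩ : ∃ v : Fin 2 → K, v 0 * (a *ᵥ v) 1 - v 1 * (a *ᵥ v) 0 ≠ 0 := by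
    by_contra! h
    have h1 := h ![1, 0]
    have h2 := h ![0, 1]
    have h3 := h ![1, 1]
    simp [Matrix.mulVec, dotProduct, Fin.sum_univ_two] at h1 h2 h3
    refine has (Algebra.mem_bot.2 ⟨a 0 0, ?_⟩)
    ext i j
    fin_cases i <;> fin_cases j <;> simp [Matrix.algebraMap_matrix_apply, h1, h2]
    rw [h1, h2] at h3
    linear_combination -h3
  -- The vector `v` is not an eigenvector of `a`, so `v` and `a v` span; the coefficients come from
  -- Cramer's rule.
  have hcyc : ∀ x : Fin 2 → K, ∃ b ∈ A, b *ᵥ v = x := by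
    intro x
    let D := v 0 * (a *ᵥ v) 1 - v 1 * (a *ᵥ v) 0
    refine ⟨((x 0 * (a *ᵥ v) 1 - x 1 * (a *ᵥ v) 0) / D) • 1 + ((v 0 * x 1 - v 1 * x 0) / D) • a,
      A.add_mem (A.smul_mem A.one_mem _) (A.smul_mem ha _), ?_⟩
    have hD : D ≠ 0 := hv
    rw [Matrix.add_mulVec, Matrix.smul_mulVec, Matrix.smul_mulVec, Matrix.one_mulVec]
    ext i
    fin_cases i <;> simp only [Fin.zero_eta, Fin.mk_one, Pi.add_apply, Pi.smul_apply,
      smul_eq_mul] <;> rw [div_mul_eq_mul_div, div_mul_eq_mul_div, ← add_div,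
      div_eq_iff hD] <;> simp only [D] <;> ring
  -- Multiplying a rank one matrix `x wᵀ` on the left by `A`, with `x` cyclic, gives all `y wᵀ`: a
  -- copy of the standard module.
  have hrank : ∀ x w : Fin 2 → K, w ≠ 0 → vecMulVec x w ∈ A →
      (∀ y : Fin 2 → K, ∃ b ∈ A, b *ᵥ x = y) →
      ∃ (v : Fin 2 → K) (f : Fin 2 → Matrix (Fin 2) (Fin 2) K),
      (∀ j, f j ∈ A) ∧ (∀ j, f j *ᵥ v = Pi.single j 1) ∧
        ∀ a ∈ A, ∀ j, a * f j = ∑ i, a i j • f i := by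
    intro x w hw hm hx
    obtain ⟨v', hv'⟩ : ∃ v' : Fin 2 → K, w 0 * v' 0 + w 1 * v' 1 = 1 := by
      by_cases h0 : w 0 = 0
      · have h1 : w 1 ≠ 0 := fun h1 => hw (by ext i; fin_cases i <;> simp [h0, h1])
        exact ⟨![0, (w 1)⁻¹], by simp [h1]⟩
      · exact ⟨![(w 0)⁻¹, 0], by simp [h0]⟩
    refine ⟨v', fun j => vecMulVec (Pi.single j 1) w, fun j => ?_, fun j => ?_, fun a _ j => ?_⟩
    · obtain ⟨b, hb, hbx⟩ := hx (Pi.single j 1)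
      have := A.mul_mem hb hm
      rwa [Matrix.mul_vecMulVec, hbx] at this
    · ext i
      simp only [Matrix.mulVec, dotProduct, vecMulVec_apply, Fin.sum_univ_two, mul_assoc,
        ← mul_add, hv', mul_one]
    · ext i k
      rw [Matrix.mul_vecMulVec, vecMulVec_apply, Matrix.sum_apply]
      simp [vecMulVec_apply, Pi.single_apply]
  -- If evaluation at `v` is injective, `A` itself is the standard module. Otherwise `A` contains a
  -- rank one matrix that kills `v`.
  by_cases hinj : ∀ n ∈ A, n *ᵥ v = 0 → n = 0
  · choose f hfA hf using fun j : Fin 2 => hcyc (Pi.single j 1)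
    refine ⟨v, f, hfA, hf, fun b hb j => sub_eq_zero.1 (hinj _ (A.sub_mem (A.mul_mem hb (hfA j))
      (A.sum_mem fun i _ => A.smul_mem (hfA i) _)) ?_)⟩
    rw [Matrix.sub_mulVec, ← Matrix.mulVec_mulVec, hf, Fin.sum_univ_two, Matrix.add_mulVec,
      Matrix.smul_mulVec, Matrix.smul_mulVec, hf, hf, sub_eq_zero]
    ext i
    fin_cases i <;> simp
  · push Not at hinj
    obtain ⟨n, hn, hnv, hn0⟩ := hinj
    have hv0 : v 0 ≠ 0 ∨ v 1 ≠ 0 := by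
      by_contra! h
      exact hv (by rw [h.1, h.2]; ring)
    have h0 := congrFun hnv 0
    have h1 := congrFun hnv 1
    simp only [Matrix.mulVec, dotProduct, Fin.sum_univ_two, Pi.zero_apply] at h0 h1
    let w : Fin 2 → K := ![v 1, -v 0]
    have hw : w ≠ 0 := fun h => by
      have h2 := congrFun h 0
      have h3 := congrFun h 1
      simp [w] at h2 h3
      simp_all
    obtain ⟨x, rfl⟩ : ∃ x, n = vecMulVec x w := by
      rcases hv0 with hv0 | hv0
      · refine ⟨fun i => -n i 1 / v 0, ?_⟩
        ext i j
        fin_cases i <;> fin_cases j <;> simp [vecMulVec_apply, w] <;> field_simp <;>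
          first | linear_combination h0 | linear_combination h1
      · refine ⟨fun i => n i 0 / v 1, ?_⟩
        ext i j
        fin_cases i <;> fin_cases j <;> simp [vecMulVec_apply, w] <;> field_simp <;>
          first | linear_combination h0 | linear_combination h1
    -- The quantity tested is `wᵀ x`. If it vanishes, `x` is proportional to the cyclic vector `v`.
    -- If not, `n` divided by it is idempotent, and the complementary idempotent has image spanned
    -- by `v`.
    by_cases hδ : v 1 * x 0 - v 0 * x 1 = 0
    · refine hrank x w hw hn fun y => ?_
      obtain ⟨t, ht⟩ : ∃ t, x = t • v := by
        rcases hv0 with hv0 | hv0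
        · exact ⟨x 0 / v 0, by ext i; fin_cases i <;> simp <;> field_simp; linear_combination -hδ⟩
        · exact ⟨x 1 / v 1, by ext i; fin_cases i <;> simp <;> field_simp; linear_combination hδ⟩
      have ht0 : t ≠ 0 := by
        rintro rfl
        rw [zero_smul] at ht
        exact hn0 (by rw [ht]; ext; simp [vecMulVec_apply])
      obtain ⟨b, hb, hby⟩ := hcyc (t⁻¹ • y)
      exact ⟨b, hb, by rw [ht, Matrix.mulVec_smul, hby, smul_inv_smul₀ ht0]⟩
    · set δ := v 1 * x 0 - v 0 * x 1
      have hm : 1 - δ⁻¹ • vecMulVec x w = vecMulVec v ![-x 1 / δ, x 0 / δ] := by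
        ext i j
        fin_cases i <;> fin_cases j <;> simp [vecMulVec_apply, w] <;> field_simp <;>
          simp only [δ] <;> ring
      refine hrank v ![-x 1 / δ, x 0 / δ] (fun h => hδ ?_) ?_ hcyc
      · have h2 := congrFun h 0
        have h3 := congrFun h 1
        simp [hδ] at h2 h3
        simp [δ, h2, h3]
      · rw [← hm]
        exact A.sub_mem A.one_mem (A.smul_mem hn _)

variable {Γ : Type*} [Group Γ] {O : Type*} [CommRing O] {S : Type*} [CommRing S] [Algebra O S]

/-- The linear extension of a representation to the group ring over `O`. -/
def linearExtension (O : Type*) [CommRing O] {S : Type*} [CommRing S] [Algebra O S]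
    (r : Γ →* GL (Fin 2) S) : (Γ →₀ O) →ₗ[O] Matrix (Fin 2) (Fin 2) S :=
  Finsupp.linearCombination O fun g => (r g).val

theorem linearExtension_single (r : Γ →* GL (Fin 2) S) (g : Γ) (a : O) :
    linearExtension O r (Finsupp.single g a) = a • (r g).val :=
  Finsupp.linearCombination_single _ _ _

theorem linearExtension_mapDomain (r : Γ →* GL (Fin 2) S) (g : Γ) (c : Γ →₀ O) :
    linearExtension O r (c.mapDomain (g * ·)) = (r g).val * linearExtension O r c := by
  induction c using Finsupp.induction_linear with
  | zero => simp
  | add c c' h h' => rw [Finsupp.mapDomain_add, map_add, map_add, mul_add, h, h']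
  | single h a =>
    rw [Finsupp.mapDomain_single, linearExtension_single, linearExtension_single, map_mul,
      Units.val_mul, mul_smul_comm]

theorem linearExtension_baseChange {S' : Type*} [CommRing S'] [Algebra O S'] (f : S →ₐ[O] S')
    (r : Γ →* GL (Fin 2) S) (c : Γ →₀ O) :
    linearExtension O (baseChange f.toRingHom r) c = (linearExtension O r c).map f := by
  induction c using Finsupp.induction_linear with
  | zero => ext; simp
  | add c c' h h' => rw [map_add, map_add, h, h', Matrix.map_add _ (map_add f)]
  | single h a =>
    rw [linearExtension_single, linearExtension_single]
    ext i j
    simp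

/-- `c` gives two elements of the image of the group ring that span a left ideal isomorphic to
`ρ`, after extension of scalars to the field of fractions. -/
structure IsIntertwiningData (ρ : Γ →* GL (Fin 2) O) (c : Fin 2 → Γ →₀ O) : Prop where
  mul_eq : ∀ g j, (ρ g).val * linearExtension O ρ (c j) =
    ∑ i, (ρ g).val i j • linearExtension O ρ (c i)
  exists_mulVec_eq : ∃ (v : Fin 2 → O) (d : O), d ≠ 0 ∧
    ∀ j, linearExtension O ρ (c j) *ᵥ v = Pi.single j d

/-- The matrix with columns `r(c₀)y` and `r(c₁)y`. -/
def intertwiner (r : Γ →* GL (Fin 2) S) (c : Fin 2 → Γ →₀ O) (y : Fin 2 → S) :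
    Matrix (Fin 2) (Fin 2) S :=
  Matrix.of fun i j => (linearExtension O r (c j) *ᵥ y) i

/-- A criterion for `r` to become isomorphic to `ρ` over the total ring of fractions, in terms of
the entries of `r` only. -/
structure IsGenericallyIsomorphic (ρ : Γ →* GL (Fin 2) O) (r : Γ →* GL (Fin 2) S) : Prop where
  relations : ∀ c : Γ →₀ O, linearExtension O ρ c = 0 → linearExtension O r c = 0
  nondegenerate : ∀ c : Fin 2 → Γ →₀ O, IsIntertwiningData ρ c → ∀ x : S,
    (∀ y : Fin 2 → O, (intertwiner r c fun i => algebraMap O S (y i)).det * x = 0) → x = 0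

theorem map_det_intertwiner {S' : Type*} [CommRing S'] [Algebra O S'] (f : S →ₐ[O] S')
    (r : Γ →* GL (Fin 2) S) (c : Fin 2 → Γ →₀ O) (y : Fin 2 → S) :
    f (intertwiner r c y).det =
      (intertwiner (baseChange f.toRingHom r) c fun i => f (y i)).det := by
  simp only [intertwiner, Matrix.det_fin_two, linearExtension_baseChange, Matrix.mulVec, dotProduct,
    Fin.sum_univ_two, Matrix.of_apply, Matrix.map_apply, map_sub, map_mul, map_add]

/-- Both clauses of the criterion conclude that an element of `S` vanishes, from hypotheses that
persist under homomorphisms. Hence it is enough to conclude after applying each `f` of a jointly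
injective family. -/
theorem IsGenericallyIsomorphic.of_injective {ρ : Γ →* GL (Fin 2) O} {r : Γ →* GL (Fin 2) S}
    (h : ∀ a : S, (∀ (S' : Type v) [CommRing S'] [Algebra O S'] (f : S →ₐ[O] S'),
      IsGenericallyIsomorphic ρ (baseChange f.toRingHom r) → f a = 0) → a = 0) :
    IsGenericallyIsomorphic ρ r := by
  refine ⟨fun c hc => ?_, fun c hc x hx => h x fun S' _ _ f hf => ?_⟩
  · ext i j
    refine h _ fun S' _ _ f hf => ?_
    have := hf.relations c hc
    rw [linearExtension_baseChange] at this
    exact congrFun (congrFun this i) j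
  · refine hf.nondegenerate c hc _ fun y => ?_
    have := congrArg f (hx y)
    rw [map_mul, map_zero, map_det_intertwiner] at this
    simpa using this

theorem linearExtension_eq_of_equivalent {ρ r : Γ →* GL (Fin 2) S} {h : GL (Fin 2) S}
    (hr : ∀ g, r g = h * ρ g * h⁻¹) (c : Γ →₀ O) :
    linearExtension O r c = h.val * linearExtension O ρ c * h⁻¹.val := by
  induction c using Finsupp.induction_linear with
  | zero => simp
  | add c c' h h' => rw [map_add, map_add, mul_add, add_mul, h, h']
  | single g a =>
    rw [linearExtension_single, linearExtension_single, hr, Units.val_mul, Units.val_mul,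
      mul_smul_comm, smul_mul_assoc]

/-- Relations are transported by the isomorphism `x`. For nondegeneracy, the intertwiner built from
the vector `x v` is `d x`, whose determinant is `d ^ 2` times a unit, and `d` acts injectively. -/
theorem isGenericallyIsomorphic_of_equivalent [Nontrivial O] {S' : Type*} [CommRing S'] [Algebra S S']
    (hinj : Function.Injective (algebraMap S S'))
    (htf : ∀ d : O, d ≠ 0 → ∀ x : S, d • x = 0 → x = 0) {ρ : Γ →* GL (Fin 2) O}
    {r : Γ →* GL (Fin 2) S}
    (h : Equivalent (baseChange (algebraMap S S') r)
      (baseChange ((algebraMap S S').comp (algebraMap O S)) ρ)) :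
    IsGenericallyIsomorphic ρ r := by
  let _ : Algebra O S' := ((algebraMap S S').comp (algebraMap O S)).toAlgebra
  have : IsScalarTower O S S' := IsScalarTower.of_algebraMap_eq fun _ => rfl
  let f : S →ₐ[O] S' := IsScalarTower.toAlgHom O S S'
  let φ : O →ₐ[O] S' := Algebra.ofId O S'
  obtain ⟨x, hx⟩ := h
  have key : ∀ c : Γ →₀ O, (linearExtension O r c).map f =
      x.val * (linearExtension O ρ c).map φ * x⁻¹.val := fun c => by
    rw [← linearExtension_baseChange, ← linearExtension_baseChange]
    exact linearExtension_eq_of_equivalent hx c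
  refine ⟨fun c hc => ?_, fun c hc z hz => ?_⟩
  · have h1 := key c
    rw [hc] at h1
    ext i j
    have h2 : f (linearExtension O r c i j) = 0 := by
      have h2 := congrFun (congrFun h1 i) j
      simpa using h2
    exact hinj (h2.trans (map_zero _).symm)
  · obtain ⟨v, d, hd, hv⟩ := hc.exists_mulVec_eq
    let F : Fin 2 → Fin 2 → Fin 2 → S := fun j => linearExtension O r (c j)
    -- The vector `x v` need not have entries in `O`. But the determinant is a binary quadratic form
    -- in `y`, so its values at these three vectors determine all others.
    have h1 := hz ![1, 0]
    have h2 := hz ![0, 1]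
    have h3 := hz ![1, 1]
    have hA : (F 0 0 0 * F 1 1 0 - F 1 0 0 * F 0 1 0) * z = 0 := by
      simpa [intertwiner, Matrix.det_fin_two, Matrix.mulVec, dotProduct, Fin.sum_univ_two] using h1
    have hC : (F 0 0 1 * F 1 1 1 - F 1 0 1 * F 0 1 1) * z = 0 := by
      simpa [intertwiner, Matrix.det_fin_two, Matrix.mulVec, dotProduct, Fin.sum_univ_two] using h2
    have hABC : ((F 0 0 0 + F 0 0 1) * (F 1 1 0 + F 1 1 1) -
        (F 1 0 0 + F 1 0 1) * (F 0 1 0 + F 0 1 1)) * z = 0 := by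
      simpa [intertwiner, Matrix.det_fin_two, Matrix.mulVec, dotProduct, Fin.sum_univ_two] using h3
    have hform : ∀ y : Fin 2 → S', (intertwiner (baseChange f.toRingHom r) c y).det * f z = 0 := by
      intro y
      have e1 := congrArg f hA
      have e2 := congrArg f hC
      have e3 := congrArg f hABC
      simp only [map_mul, map_sub, map_add, map_zero] at e1 e2 e3
      have e4 : ∀ i j k, f (linearExtension O r (c j) i k) = f (F j i k) := fun _ _ _ => rfl
      simp only [intertwiner, Matrix.det_fin_two, Matrix.mulVec, dotProduct, Fin.sum_univ_two,
        linearExtension_baseChange, Matrix.of_apply, Matrix.map_apply, e4]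
      linear_combination (y 0 ^ 2 - y 0 * y 1) * e1 + (y 1 ^ 2 - y 0 * y 1) * e2 + y 0 * y 1 * e3
    have h4 := hform (x.val *ᵥ fun i => φ (v i))
    have h5 : intertwiner (baseChange f.toRingHom r) c (x.val *ᵥ fun i => φ (v i)) =
        φ d • x.val := by
      ext i j
      rw [intertwiner, Matrix.of_apply, linearExtension_baseChange, key, Matrix.mulVec_mulVec,
        mul_assoc, ← Units.val_mul, inv_mul_cancel, Units.val_one, mul_one,
        ← Matrix.mulVec_mulVec]
      have h6 : (linearExtension O ρ (c j)).map φ *ᵥ (fun i => φ (v i)) = Pi.single j (φ d) := by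
        ext k
        have h7 := congrArg φ (congrFun (hv j) k)
        simp only [Matrix.mulVec, dotProduct, Fin.sum_univ_two, map_add, map_mul,
          Matrix.map_apply] at h7 ⊢
        rw [h7]
        simp only [Pi.single_apply]
        split_ifs <;> simp
      rw [h6]
      fin_cases j <;> simp [Matrix.mulVec, dotProduct, Fin.sum_univ_two, mul_comm]
    rw [h5, Matrix.det_smul, Fintype.card_fin] at h4
    have h6 : f (d • d • z) = 0 := by
      rw [map_smul, map_smul, Algebra.smul_def, Algebra.smul_def]
      have h7 : x.val.det * x⁻¹.val.det = 1 := by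
        rw [← Matrix.det_mul, ← Units.val_mul, mul_inv_cancel, Units.val_one, Matrix.det_one]
      have h8 : φ d = algebraMap O S' d := rfl
      rw [h8] at h4
      linear_combination x⁻¹.val.det * h4 - (algebraMap O S' d) ^ 2 * f z * h7
    have h7 : d • d • z = 0 := hinj (by rw [map_zero]; exact h6)
    exact htf d hd _ (htf d hd _ h7)

/-- The group ring element `g c_j - ∑ ρ(g)_{ij} c_i` is a relation for `ρ`, hence for `r`; apply it
to `y`. -/
theorem intertwiner_mul {ρ : Γ →* GL (Fin 2) O} {r : Γ →* GL (Fin 2) S}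
    (h : IsGenericallyIsomorphic ρ r) {c : Fin 2 → Γ →₀ O} (hc : IsIntertwiningData ρ c)
    (y : Fin 2 → S) (g : Γ) :
    (r g).val * intertwiner r c y = intertwiner r c y * (baseChange (algebraMap O S) ρ g).val := by
  have key : ∀ j, (r g).val * linearExtension O r (c j) =
      ∑ i, (ρ g).val i j • linearExtension O r (c i) := fun j => by
    rw [← sub_eq_zero, ← linearExtension_mapDomain]
    simp only [← map_smul, ← map_sum, ← map_sub]
    apply h.relations
    simp only [map_smul, map_sum, map_sub]
    rw [linearExtension_mapDomain, hc.mul_eq, sub_self]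
  ext i j
  have h1 : ((r g).val * intertwiner r c y) i j =
      (((r g).val * linearExtension O r (c j)) *ᵥ y) i := by
    rw [← Matrix.mulVec_mulVec]
    rfl
  rw [h1, key, Fin.sum_univ_two, Matrix.add_mulVec, Matrix.smul_mulVec, Matrix.smul_mulVec,
    Matrix.mul_apply, Fin.sum_univ_two, baseChange_apply, baseChange_apply]
  rw [Pi.add_apply, Pi.smul_apply, Pi.smul_apply, Algebra.smul_def, Algebra.smul_def,
    mul_comm, mul_comm (algebraMap O S ((ρ g).val 1 j))]
  rfl

variable [IsDomain O]

/-- Apply `exists_leftIdeal_equiv` to the algebra spanned by the image of `ρ` over the field of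
fractions, then clear denominators. -/
theorem exists_isIntertwiningData {ρ : Γ →* GL (Fin 2) O}
    (hρ : ¬ ∀ g, ∃ t : O, (ρ g).val = t • 1) : ∃ c, IsIntertwiningData ρ c := by
  let K := FractionRing O
  let φ : O →ₐ[O] K := Algebra.ofId O K
  have hφ : Function.Injective φ := IsFractionRing.injective O K
  let m : Γ →* Matrix (Fin 2) (Fin 2) K :=
    (Units.coeHom _).comp (baseChange (algebraMap O K) ρ)
  let A : Subalgebra K (Matrix (Fin 2) (Fin 2) K) := Algebra.adjoin K (MonoidHom.mrange m)
  have hmem : ∀ g, (ρ g).val.map φ ∈ A := fun g => Algebra.subset_adjoin ⟨g, rfl⟩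
  have hA : A ≠ ⊥ := by
    intro h
    refine hρ fun g => ⟨(ρ g).val 0 0, ?_⟩
    have h1 := hmem g
    rw [h, Algebra.mem_bot] at h1
    obtain ⟨t, ht⟩ := h1
    have h2 : ∀ i j, φ ((ρ g).val i j) = (algebraMap K (Matrix (Fin 2) (Fin 2) K) t) i j :=
      fun i j => (congrFun (congrFun ht i) j).symm
    ext i j
    apply hφ
    have h00 := h2 0 0
    have := h2 i j
    rw [this, Matrix.smul_apply, smul_eq_mul, map_mul, h00]
    fin_cases i <;> fin_cases j <;> simp [Matrix.algebraMap_matrix_apply]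
  obtain ⟨v, f, hfA, hfv, hf⟩ := exists_leftIdeal_equiv A hA
  have hclear : ∀ x ∈ A, ∃ (d : O) (c : Γ →₀ O), d ≠ 0 ∧
      φ d • x = (linearExtension O ρ c).map φ := by
    intro x hx
    have hx' : x ∈ Submodule.span K (Set.range m) := by
      have := (Algebra.adjoin_eq_span K (MonoidHom.mrange m : Set (Matrix (Fin 2) (Fin 2) K)))
      rw [Submonoid.closure_eq] at this
      have h1 : x ∈ Subalgebra.toSubmodule A := hx
      rw [this] at h1
      exact h1
    clear hx
    induction hx' using Submodule.span_induction with
    | mem x hx =>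
      obtain ⟨g, rfl⟩ := hx
      refine ⟨1, Finsupp.single g 1, one_ne_zero, ?_⟩
      rw [linearExtension_single, map_one, one_smul, one_smul]
      rfl
    | zero => exact ⟨1, 0, one_ne_zero, by ext; simp⟩
    | add x y _ _ hx hy =>
      obtain ⟨d, c, hd, h⟩ := hx
      obtain ⟨d', c', hd', h'⟩ := hy
      refine ⟨d * d', d' • c + d • c', mul_ne_zero hd hd', ?_⟩
      ext i j
      have e := congrFun (congrFun h i) j
      have e' := congrFun (congrFun h' i) j
      simp at e e' ⊢
      linear_combination φ d' * e + φ d * e'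
    | smul a x _ hx =>
      obtain ⟨d, c, hd, h⟩ := hx
      obtain ⟨a₁, b₁, hb₁, rfl⟩ := IsFractionRing.div_surjective (A := O) a
      refine ⟨b₁ * d, a₁ • c, mul_ne_zero (nonZeroDivisors.ne_zero hb₁) hd, ?_⟩
      have hb : φ b₁ ≠ 0 := fun h => nonZeroDivisors.ne_zero hb₁ (hφ (by rw [h, map_zero]))
      have e1 : algebraMap O K b₁ = φ b₁ := rfl
      have e2 : algebraMap O K a₁ = φ a₁ := rfl
      ext i j
      have e := congrFun (congrFun h i) j
      simp only [e1, e2, Matrix.smul_apply, Matrix.map_apply, smul_eq_mul, map_mul, map_smul]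
        at e ⊢
      rw [← e, div_eq_mul_inv]
      linear_combination φ d * φ a₁ * x i j * (mul_inv_cancel₀ hb)
  obtain ⟨d₀, c₀, hd₀, hc₀⟩ := hclear _ (hfA 0)
  obtain ⟨d₁, c₁, hd₁, hc₁⟩ := hclear _ (hfA 1)
  obtain ⟨a₀, b₀, hb₀, hv₀⟩ := IsFractionRing.div_surjective (A := O) (v 0)
  obtain ⟨a₁, b₁, hb₁, hv₁⟩ := IsFractionRing.div_surjective (A := O) (v 1)
  have hb₀' : φ b₀ ≠ 0 := fun h => nonZeroDivisors.ne_zero hb₀ (hφ (by rw [h, map_zero]))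
  have hb₁' : φ b₁ ≠ 0 := fun h => nonZeroDivisors.ne_zero hb₁ (hφ (by rw [h, map_zero]))
  -- Crossing the denominators gives both elements the same factor `d₀ * d₁`, as the linear
  -- relations between them require.
  let c : Fin 2 → Γ →₀ O := ![d₁ • c₀, d₀ • c₁]
  have hc : ∀ j, (linearExtension O ρ (c j)).map φ = φ (d₀ * d₁) • f j := by
    intro j
    fin_cases j
    · change (linearExtension O ρ (d₁ • c₀)).map φ = φ (d₀ * d₁) • f 0
      rw [mul_comm, map_mul, mul_smul, hc₀]
      ext; simp
    · change (linearExtension O ρ (d₀ • c₁)).map φ = φ (d₀ * d₁) • f 1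
      rw [map_mul, mul_smul, hc₁]
      ext; simp
  refine ⟨c, ⟨fun g j => ?_, ![a₀ * b₁, a₁ * b₀], d₀ * d₁ * (b₀ * b₁),
    mul_ne_zero (mul_ne_zero hd₀ hd₁) (mul_ne_zero (nonZeroDivisors.ne_zero hb₀)
      (nonZeroDivisors.ne_zero hb₁)), fun j => ?_⟩⟩
  · have h1 := congrArg (φ (d₀ * d₁) • ·) (hf _ (hmem g) j)
    beta_reduce at h1
    rw [← mul_smul_comm, ← hc, Finset.smul_sum] at h1
    ext i k
    apply hφ
    have h2 := congrFun (congrFun h1 i) k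
    rw [← Matrix.map_mul, Matrix.map_apply] at h2
    rw [h2, Matrix.sum_apply, Matrix.sum_apply, map_sum]
    refine Finset.sum_congr rfl fun l _ => ?_
    have h3 := congrFun (congrFun (hc l) i) k
    rw [Matrix.map_apply] at h3
    rw [Matrix.smul_apply (φ _), Matrix.smul_apply ((ρ g).val l j), smul_eq_mul ((ρ g).val l j),
      map_mul φ ((ρ g).val l j), h3, Matrix.smul_apply, Matrix.smul_apply, Matrix.map_apply]
    simp only [smul_eq_mul]
    ring
  · have h1 := hfv j
    ext i
    apply hφ
    have h2 := congrFun h1 i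
    have h3 : ∀ k, φ (linearExtension O ρ (c j) i k) = φ (d₀ * d₁) * f j i k := fun k =>
      congrFun (congrFun (hc j) i) k
    have e0 : v 0 * φ b₀ = φ a₀ := by
      rw [← hv₀]
      exact div_mul_cancel₀ _ hb₀'
    have e1 : v 1 * φ b₁ = φ a₁ := by
      rw [← hv₁]
      exact div_mul_cancel₀ _ hb₁'
    have h4 : φ ((Pi.single j (d₀ * d₁ * (b₀ * b₁)) : Fin 2 → O) i) =
        φ (d₀ * d₁) * (φ b₀ * φ b₁) * (Pi.single j 1 : Fin 2 → K) i := by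
      simp only [Pi.single_apply]
      split_ifs <;> simp
    rw [h4, ← h2]
    simp only [Matrix.mulVec, dotProduct, Fin.sum_univ_two, map_add, h3, map_mul,
      Matrix.cons_val_zero, Matrix.cons_val_one]
    rw [← e0, ← e1]
    ring

/-- When `ρ` is scalar, the relations already force `r = ρ`. Otherwise some intertwiner has a
regular determinant and becomes invertible over the total ring of fractions. It is found by prime
avoidance for the finitely many associated primes of the Noetherian ring `S`. -/
theorem IsGenericallyIsomorphic.equivalent [CharZero O] [IsNoetherianRing S]
    (htf : ∀ d : O, d ≠ 0 → ∀ x : S, d • x = 0 → x = 0) {ρ : Γ →* GL (Fin 2) O}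
    {r : Γ →* GL (Fin 2) S} (h : IsGenericallyIsomorphic ρ r) {S' : Type*} [CommRing S']
    [Algebra S S'] [IsFractionRing S S'] :
    Equivalent (baseChange (algebraMap S S') r)
      (baseChange ((algebraMap S S').comp (algebraMap O S)) ρ) := by
  by_cases hρ : ∀ g, ∃ t : O, (ρ g).val = t • 1
  · have h1 : r = baseChange (algebraMap O S) ρ := by
      ext g i j
      obtain ⟨t, ht⟩ := hρ g
      have h2 := h.relations (Finsupp.single g 1 - Finsupp.single 1 t) (by
        rw [map_sub, linearExtension_single, linearExtension_single, ht, map_one, Units.val_one,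
          one_smul, sub_self])
      rw [map_sub, linearExtension_single, linearExtension_single, map_one, Units.val_one,
          one_smul, sub_eq_zero] at h2
      rw [h2, baseChange_apply, ht]
      fin_cases i <;> fin_cases j <;> simp [Algebra.smul_def]
    rw [h1, baseChange_baseChange]
    exact Equivalent.refl _
  obtain ⟨c, hc⟩ := exists_isIntertwiningData hρ
  let F : Fin 2 → Fin 2 → Fin 2 → S := fun j => linearExtension O r (c j)
  let a₀ := F 0 0 0 * F 1 1 0 - F 1 0 0 * F 0 1 0
  let a₂ := F 0 0 1 * F 1 1 1 - F 1 0 1 * F 0 1 1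
  let a₁ := F 0 0 0 * F 1 1 1 + F 0 0 1 * F 1 1 0 - F 1 0 0 * F 0 1 1 - F 1 0 1 * F 0 1 0
  have hdet : ∀ y : Fin 2 → S, (intertwiner r c y).det =
      a₀ * y 0 ^ 2 + a₁ * (y 0 * y 1) + a₂ * y 1 ^ 2 := fun y => by
    have e4 : ∀ i j k, linearExtension O r (c j) i k = F j i k := fun _ _ _ => rfl
    simp only [intertwiner, Matrix.det_fin_two, Matrix.mulVec, dotProduct, Fin.sum_univ_two,
      Matrix.of_apply, e4]
    ring
  obtain ⟨n, hn⟩ : ∃ n : ℕ, a₀ + a₁ * n + a₂ * n ^ 2 ∈ nonZeroDivisors S := by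
    have hfin : (⋃ p ∈ associatedPrimes S S, {n : ℕ | a₀ + a₁ * n + a₂ * n ^ 2 ∈ p}).Finite := by
      refine (associatedPrimes.finite S S).biUnion fun p hp => ?_
      obtain ⟨hprime, x, hx⟩ := isAssociatedPrime_iff.1 hp
      have hann : ∀ s : S, s ∈ p ↔ s * x = 0 := fun s => by
        rw [hx]
        simp [Submodule.mem_colon_singleton]
      have hx0 : x ≠ 0 := by
        rintro rfl
        exact hprime.ne_top (eq_top_iff.2 fun s _ => (hann s).2 (mul_zero s))
      -- The prime `p` is the annihilator of `x`, and nonzero elements of `O` kill no nonzero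
      -- element. So the integers stay distinct modulo `p`, and the quadratic form, nonzero modulo
      -- `p`, vanishes at only finitely many vectors `(1, n)`.
      have hinj : ∀ m n : ℕ, (m : S) - n ∈ p → m = n := fun m n hmn => by
        by_contra hne
        refine hx0 (htf ((m : O) - n) (sub_ne_zero.2 (Nat.cast_injective.ne hne)) x ?_)
        rw [Algebra.smul_def, map_sub, map_natCast, map_natCast]
        exact (hann _).1 hmn
      have hnz : ¬ (a₀ ∈ p ∧ a₁ ∈ p ∧ a₂ ∈ p) := fun ⟨h0, h1, h2⟩ => by
        refine hx0 (h.nondegenerate c hc x fun y => ?_)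
        rw [hdet]
        rw [hann] at h0 h1 h2
        linear_combination (algebraMap O S (y 0)) ^ 2 * h0 +
          (algebraMap O S (y 0)) * (algebraMap O S (y 1)) * h1 + (algebraMap O S (y 1)) ^ 2 * h2
      let q := Ideal.Quotient.mk p
      let P : Polynomial (S ⧸ p) :=
        Polynomial.C (q a₀) + Polynomial.C (q a₁) * Polynomial.X +
          Polynomial.C (q a₂) * Polynomial.X ^ 2
      have hP : P ≠ 0 := fun hP => hnz <| by
        have e0 := congrArg (fun P => Polynomial.coeff P 0) hP
        have e1 := congrArg (fun P => Polynomial.coeff P 1) hP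
        have e2 := congrArg (fun P => Polynomial.coeff P 2) hP
        simp [P, Polynomial.coeff_X, Polynomial.coeff_C, Polynomial.coeff_X_pow] at e0 e1 e2
        exact ⟨Ideal.Quotient.eq_zero_iff_mem.1 e0, Ideal.Quotient.eq_zero_iff_mem.1 e1,
          Ideal.Quotient.eq_zero_iff_mem.1 e2⟩
      have hfr : {t | P.IsRoot t}.Finite := Polynomial.finite_setOfPred_isRoot hP
      refine Set.Finite.subset (hfr.preimage (f := fun n : ℕ => (n : S ⧸ p)) ?_) fun n hn => ?_
      · intro m _ n _ hmn
        refine hinj m n ?_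
        rw [← Ideal.Quotient.eq_zero_iff_mem, map_sub, map_natCast, map_natCast]
        exact sub_eq_zero.2 hmn
      · have := Ideal.Quotient.eq_zero_iff_mem.2 hn
        simp only [map_add, map_mul, map_pow, map_natCast] at this
        simpa [P] using this
    obtain ⟨n, hn⟩ := hfin.exists_notMem
    refine ⟨n, ?_⟩
    by_contra hzd
    refine hn ?_
    have : a₀ + a₁ * n + a₂ * n ^ 2 ∈ ⋃ p ∈ associatedPrimes S S, (p : Set S) := by
      rw [biUnion_associatedPrimes_eq_compl_nonZeroDivisors]
      exact hzd
    simpa using this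
  let y : Fin 2 → S := ![1, n]
  let X := intertwiner r c y
  have hX : X.det ∈ nonZeroDivisors S := by
    rw [hdet]
    simpa [y] using hn
  have hXu : IsUnit (X.map (algebraMap S S')).det := by
    have : (X.map (algebraMap S S')).det = algebraMap S S' X.det := ((algebraMap S S').map_det X).symm
    rw [this]
    exact IsLocalization.map_units S' (⟨_, hX⟩ : nonZeroDivisors S)
  obtain ⟨x, hx⟩ := exists_val_eq hXu
  refine ⟨x, fun g => eq_mul_inv_of_mul_eq (Units.ext ?_)⟩
  rw [Units.val_mul, Units.val_mul, hx]
  have h1 := congrArg (fun M => Matrix.map M (algebraMap S S')) (intertwiner_mul h hc y g)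
  simp only [Matrix.map_mul] at h1
  exact h1

end Intertwining

/-! ### Normal forms -/

section NormalForm

variable {ℓ : ℕ} [Fact ℓ.Prime] {A B : Type*} [CommRing A] [CommRing B] {τ : GalQ}

/-- `r` is in ordinary form at `ℓ`, and `r(τ)` maps the first basis vector to the second one. -/
structure IsNormalForm (ℓ : ℕ) [Fact ℓ.Prime] (τ : GalQ) {A : Type*} [CommRing A]
    (r : GalQ →* GL (Fin 2) A) : Prop where
  ordinary : IsOrdinaryForm ℓ (r.comp (decompositionGroup ℓ).subtype)
  apply_zero_zero : (r τ).val 0 0 = 0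
  apply_one_zero : (r τ).val 1 0 = 1

theorem IsNormalForm.baseChange {r : GalQ →* GL (Fin 2) A} (hr : IsNormalForm ℓ τ r) (f : A →+* B) :
    IsNormalForm ℓ τ (baseChange f r) :=
  ⟨hr.ordinary.baseChange f, by simp [hr.apply_zero_zero], by simp [hr.apply_one_zero]⟩

theorem comp_conjRep {G H : Type*} [Group G] [Group H] (h : GL (Fin 2) A) (r : G →* GL (Fin 2) A)
    (i : H →* G) : (conjRep h r).comp i = conjRep h (r.comp i) := rfl

/-- An ordinary form has a conjugate in normal form. -/
theorem exists_isNormalForm_conjRep {r : GalQ →* GL (Fin 2) A}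
    (hr : IsOrdinaryForm ℓ (r.comp (decompositionGroup ℓ).subtype))
    (hτ : IsUnit ((r τ).val 1 0)) : ∃ g, IsNormalForm ℓ τ (conjRep g r) := by
  -- The new basis consists of the first basis vector and its image under `r τ`.
  obtain ⟨g, hg⟩ := exists_val_eq (M := !![1, (r τ).val 0 0; 0, (r τ).val 1 0]) (by simpa using hτ)
  have h00 := conjRep_intertwine g r τ 0 0
  have h10 := conjRep_intertwine g r τ 1 0
  simp [hg] at h00 h10
  have h1 : (conjRep g r τ).val 1 0 = 1 := hτ.mul_left_cancel (h10.trans (mul_one _).symm)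
  refine ⟨g, ?_, ?_, h1⟩
  · rw [comp_conjRep]
    exact hr.conjRep (by rw [hg]; simp)
  · rw [h1] at h00
    linear_combination h00

/-- Equivalent representations in normal form are equal. -/
theorem IsNormalForm.eq_of_equivalent {r r' : GalQ →* GL (Fin 2) A} (hr : IsNormalForm ℓ τ r)
    (hr' : IsNormalForm ℓ τ r') (h : Equivalent r r') {s : decompositionGroup ℓ}
    (hs : (s : GalQ) ∈ inertiaGroup ℓ) (h01 : IsUnit ((r' s).val 0 1)) : r = r' := by
  obtain ⟨g, rfl⟩ := equivalent_iff_exists_conjRep.1 h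
  have h10 : g.val 1 0 = 0 := hr.ordinary.apply_one_zero_eq_zero (g := g) hs
    (by rw [← comp_conjRep]; exact hr'.ordinary.inertia s hs) (by rw [← comp_conjRep]; exact h01)
  -- Comparing the first columns at `τ` forces the upper triangular matrix `g` to be scalar.
  have e0 := conjRep_intertwine g r τ 0 0
  have e1 := conjRep_intertwine g r τ 1 0
  rw [hr'.apply_zero_zero, hr'.apply_one_zero, hr.apply_zero_zero, h10] at e0
  rw [hr'.apply_zero_zero, hr'.apply_one_zero, hr.apply_one_zero, h10] at e1
  have h01 : g.val 0 1 = 0 := by linear_combination e0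
  have h11 : g.val 1 1 = g.val 0 0 := by linear_combination e1
  obtain ⟨hu, -⟩ := isUnit_diag_of_apply_one_zero h10
  ext σ i j
  have e := conjRep_intertwine g r σ i j
  refine (hu.mul_left_cancel ?_).symm
  fin_cases i <;> fin_cases j <;> simp [h10, h01, h11] at e ⊢ <;> linear_combination e

/-- A lift of a representation in normal form is equivalent to a lift in normal form. -/
theorem exists_isNormalForm_conjRep_of_residual [IsLocalRing A] {r : GalQ →* GL (Fin 2) A}
    (hr : IsOrdinary ℓ r) {rbar : GalQ →* GL (Fin 2) (ResidueField A)}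
    (hbar : IsNormalForm ℓ τ rbar) (h : Equivalent (residualRep r) rbar)
    {s : decompositionGroup ℓ} (hs : (s : GalQ) ∈ inertiaGroup ℓ) (h01 : IsUnit ((rbar s).val 0 1)) :
    ∃ g, IsNormalForm ℓ τ (conjRep g r) ∧ residualRep (conjRep g r) = rbar := by
  obtain ⟨g₁, hg₁⟩ := isOrdinaryLocal_iff.1 hr
  rw [← comp_conjRep] at hg₁
  set r₁ := conjRep g₁ r with hr₁
  have h1 : Equivalent (residualRep r₁) rbar := by
    refine Equivalent.trans ?_ h
    exact ((equivalent_conjRep g₁ r).baseChange (residue A)).symm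
  obtain ⟨x, hx⟩ := equivalent_iff_exists_conjRep.1 h1
  have hord₁ : IsOrdinaryForm ℓ ((residualRep r₁).comp (decompositionGroup ℓ).subtype) :=
    hg₁.baseChange (residue A)
  have h10 : x.val 1 0 = 0 := hord₁.apply_one_zero_eq_zero (g := x) hs
    (by rw [← comp_conjRep, ← hx]; exact hbar.ordinary.inertia s hs)
    (by rw [← comp_conjRep, ← hx]; exact h01)
  -- The residual change of basis `x` is upper triangular, so the lower left entry at `τ` is `x₁₁ /
  -- x₀₀`, which is nonzero; the entry of `r₁ τ` is then a unit.
  have e1 := conjRep_intertwine x (residualRep r₁) τ 1 0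
  rw [← hx, hbar.apply_zero_zero, hbar.apply_one_zero, h10] at e1
  obtain ⟨-, hu⟩ := isUnit_diag_of_apply_one_zero h10
  have hτ : IsUnit ((r₁ τ).val 1 0) := by
    by_contra hm
    have h2 : (residualRep r₁ τ).val 1 0 = 0 := (residue_eq_zero_iff _).2 hm
    rw [h2] at e1
    refine hu.ne_zero ?_
    linear_combination e1
  obtain ⟨g₂, hg₂⟩ := exists_isNormalForm_conjRep hg₁ hτ
  rw [hr₁, conjRep_mul] at hg₂
  refine ⟨g₁ * g₂, hg₂, ?_⟩
  refine (hg₂.baseChange (residue A)).eq_of_equivalent hbar (Equivalent.trans ?_ h) hs h01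
  exact ((equivalent_conjRep _ r).baseChange (residue A)).symm

/-- An absolutely irreducible representation has no upper triangular conjugate. -/
theorem exists_conjRep_apply_one_zero_ne_zero {F : Type*} [Field F] {G : Type*} [Group G]
    {r : G →* GL (Fin 2) F} (h : IsAbsolutelyIrreducible r) (x : GL (Fin 2) F) :
    ∃ g, (conjRep x r g).val 1 0 ≠ 0 := by
  by_contra! h0
  let E := AlgebraicClosure F
  let r' := OrdinaryDeformation.baseChange (algebraMap F E) r
  let y := Matrix.GeneralLinearGroup.map (algebraMap F E) x
  have hirr : (toRepresentation r').IsIrreducible := h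
  have hy : ∀ (v : Fin 2 → E) (z z' : GL (Fin 2) E), z.val.mulVec (z'.val.mulVec v) =
      (z * z').val.mulVec v := fun v z z' => by rw [Units.val_mul, Matrix.mulVec_mulVec]
  -- The line spanned by `y e₀`, cut out by the second coordinate of `y⁻¹ v`.
  let W : Subrepresentation (toRepresentation r') :=
    { toSubmodule := LinearMap.ker (LinearMap.proj 1 ∘ₗ (y⁻¹).val.mulVecLin)
      apply_mem_toSubmodule := fun g v hv => by
        have h2 : (conjRep y r' g).val 1 0 = 0 := by
          rw [← baseChange_conjRep, baseChange_apply, h0, map_zero]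
        have hv : ((y⁻¹).val.mulVec v) 1 = 0 := hv
        change ((y⁻¹).val.mulVec ((r' g).val.mulVec v)) 1 = 0
        have h3 : y⁻¹ * r' g = conjRep y r' g * y⁻¹ := by
          rw [conjRep_apply]
          group
        rw [hy, h3, ← hy, Matrix.mulVec, dotProduct, Fin.sum_univ_two, h2, hv, zero_mul, mul_zero,
          add_zero] }
  have hW : ∀ v : Fin 2 → E, y.val.mulVec v ∈ W.toSubmodule ↔ v 1 = 0 := fun v => by
    change ((y⁻¹).val.mulVec (y.val.mulVec v)) 1 = 0 ↔ _
    rw [hy, inv_mul_cancel, Units.val_one, Matrix.one_mulVec]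
  rcases eq_bot_or_eq_top W with h1 | h1
  · have h2 : y.val.mulVec ![1, 0] ∈ W.toSubmodule := by simp [hW]
    rw [h1] at h2
    have h3 := congrArg (fun v => (y⁻¹).val.mulVec v) ((Submodule.mem_bot _).1 h2)
    beta_reduce at h3
    rw [hy, inv_mul_cancel, Units.val_one, Matrix.one_mulVec, Matrix.mulVec_zero] at h3
    have h4 := congrFun h3 0
    simp at h4
  · have h2 : y.val.mulVec ![0, 1] ∈ W.toSubmodule := by
      rw [h1]
      exact Submodule.mem_top
    rw [hW] at h2
    simp at h2

/-- An ordinary representation that is residually absolutely irreducible, and residually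
unipotent at `s`, has a conjugate in normal form. -/
theorem exists_isNormalForm [IsLocalRing A] {r : GalQ →* GL (Fin 2) A} (hr : IsOrdinary ℓ r)
    (hirr : IsAbsolutelyIrreducible (residualRep r)) {s : decompositionGroup ℓ}
    (hs : (s : GalQ) ∈ inertiaGroup ℓ)
    (hres : IsResiduallyUnipotentAt (r.comp (decompositionGroup ℓ).subtype) s) :
    ∃ g τ, IsNormalForm ℓ τ (conjRep g r) ∧ IsUnit ((conjRep g r s).val 0 1) := by
  obtain ⟨g₁, hg₁⟩ := isOrdinaryLocal_iff.1 hr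
  rw [← comp_conjRep] at hg₁
  obtain ⟨τ, hτ⟩ := exists_conjRep_apply_one_zero_ne_zero hirr
    (Matrix.GeneralLinearGroup.map (residue A) g₁)
  have hτ' : IsUnit ((conjRep g₁ r τ).val 1 0) := by
    by_contra hm
    refine hτ ?_
    rw [residualRep, ← baseChange_conjRep]
    exact (residue_eq_zero_iff _).2 hm
  obtain ⟨g₂, hg₂⟩ := exists_isNormalForm_conjRep hg₁ hτ'
  rw [conjRep_mul] at hg₂
  refine ⟨g₁ * g₂, τ, hg₂, ?_⟩
  have hres' : IsResiduallyUnipotentAt ((conjRep (g₁ * g₂) r).comp (decompositionGroup ℓ).subtype) s := by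
    refine hres.of_equivalent (RingHom.id _) ?_
    have h1 := ((equivalent_conjRep (g₁ * g₂) r).symm.baseChange (residue A)).comp
      (decompositionGroup ℓ).subtype
    have h2 : OrdinaryDeformation.baseChange (RingHom.id _)
      (residualRep (r.comp (decompositionGroup ℓ).subtype)) =
        residualRep (r.comp (decompositionGroup ℓ).subtype) := by
      ext
      simp
    rw [h2]
    exact h1
  by_contra hm
  refine hres'.ne_one ?_
  have h01 : residue A ((conjRep (g₁ * g₂) r s).val 0 1) = 0 := (residue_eq_zero_iff _).2 hm
  have h10 : (conjRep (g₁ * g₂) r s).val 1 0 = 0 := hg₂.ordinary.lower s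
  have h11 : (conjRep (g₁ * g₂) r s).val 1 1 = 1 := hg₂.ordinary.inertia s hs
  have htr := hres'.trace_eq
  rw [Matrix.trace_fin_two] at htr
  have e : ∀ i j, (residualRep ((conjRep (g₁ * g₂) r).comp (decompositionGroup ℓ).subtype) s).val i j
      = residue A ((conjRep (g₁ * g₂) r s).val i j) := fun _ _ => rfl
  rw [e, e, h11, map_one] at htr
  have h00 : residue A ((conjRep (g₁ * g₂) r s).val 0 0) = 1 := by linear_combination htr
  ext i j
  rw [e]
  fin_cases i <;> fin_cases j <;> simp [h00, h01, h10, h11]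

end NormalForm

/-! ### Compact local rings -/

section CompactRing

variable {B : Type*} [CommRing B] [IsLocalRing B] [IsNoetherianRing B] [TopologicalSpace B]
  [IsTopologicalRing B] [CompactSpace B] [T2Space B]

-- Powers of the maximal ideal are open, hence closed, and meet in zero by Krull's theorem. By
-- compactness every neighbourhood of zero contains one of them.
variable (B) in
theorem isAdic_maximalIdeal_of_compactSpace : IsAdic (maximalIdeal B) := by
  refine isAdic_iff.2 ⟨isOpen_maximalIdeal_pow B, fun s hs => ?_⟩
  refine exists_subset_nhds_of_compactSpace (V := fun n : ℕ => ((maximalIdeal B ^ n : Ideal B) : Set B))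
    (antitone_nat_of_succ_le fun n => Ideal.pow_le_pow_right n.le_succ).directed_ge
    (fun n => (maximalIdeal B ^ n).toAddSubgroup.isClosed_of_isOpen (isOpen_maximalIdeal_pow B n))
    fun x hx => ?_
  have h1 : x ∈ ⨅ n : ℕ, maximalIdeal B ^ n := by
    rw [Submodule.mem_iInf]
    exact Set.mem_iInter.1 hx
  rw [Ideal.iInf_pow_eq_bot_of_isLocalRing _ (Ideal.IsPrime.ne_top inferInstance),
    Ideal.mem_bot] at h1
  rwa [h1]

variable (B) in
theorem isAdicComplete_maximalIdeal_of_compactSpace : IsAdicComplete (maximalIdeal B) B := by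
  let _ : UniformSpace B := IsTopologicalAddGroup.rightUniformSpace B
  have : IsUniformAddGroup B := isUniformAddGroup_of_addCommGroup
  exact (isAdic_maximalIdeal_of_compactSpace B).isAdicComplete_iff.2 ⟨inferInstance, inferInstance⟩

end CompactRing

/-! ### Continuity in terms of matrix entries -/

section ContinuousEntries

variable {G : Type*} [Group G] [TopologicalSpace G] [IsTopologicalGroup G] {B : Type*} [CommRing B]

theorem continuous_iff_entries [TopologicalSpace B] {r : G →* GL (Fin 2) B} :
    Continuous r ↔ ∀ i j, Continuous fun g => (r g).val i j := by
  refine ⟨fun h i j => (Units.continuous_val.comp h).matrix_elem i j, fun h => ?_⟩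
  have h1 : Continuous fun g => (r g).val := continuous_matrix h
  refine Units.continuous_iff.2 ⟨h1, ?_⟩
  have h2 : (fun g => (r g)⁻¹.val) = fun g => (r g⁻¹).val := by
    ext1 g
    rw [map_inv]
  rw [h2]
  exact h1.comp continuous_inv

theorem isContinuous_iff_entries [IsLocalRing B] [t : TopologicalSpace B]
    (ht : IsAdic (maximalIdeal B)) {r : G →* GL (Fin 2) B} :
    IsContinuous r ↔ ∀ i j, Continuous fun g => (r g).val i j := by
  have ht' : t = (maximalIdeal B).adicTopology := ht
  subst ht'
  let _ := (maximalIdeal B).adicTopology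
  exact continuous_iff_entries

end ContinuousEntries

/-! ### Lifts of type `T` in normal form -/

section Lifts

variable {ℓ : ℕ} [Fact ℓ.Prime] {O : Type u} [CommRing O]

/-- The algebraic conditions on a lift of type `T` in normal form. -/
structure IsNormalOfType (ℓ : ℕ) [Fact ℓ.Prime] {O : Type u} [CommRing O]
    (ρ : GalQ →* GL (Fin 2) O) (τ : GalQ) (T : Set Place) {B : Type*} [CommRing B] [Algebra O B]
    (r : GalQ →* GL (Fin 2) B) : Prop where
  det_eq : ∀ g, (r g).det = Units.map (algebraMap O B).toMonoidHom (ρ g).det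
  normal : IsNormalForm ℓ τ r
  generic : ∀ w : Place, w ∉ T →
    IsGenericallyIsomorphic (ρ.comp w.inertia.subtype) (r.comp w.inertia.subtype)

/-- In normal form every clause is an equation between entries or is covered by
`IsGenericallyIsomorphic.of_injective`. This makes the conditions pass to products and to subrings.
-/
theorem IsNormalOfType.of_injective {ρ : GalQ →* GL (Fin 2) O} {τ : GalQ} {T : Set Place}
    {B : Type*} [CommRing B] [Algebra O B] {r : GalQ →* GL (Fin 2) B}
    (h : ∀ a : B, (∀ (S : Type v) [CommRing S] [Algebra O S] (f : B →ₐ[O] S),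
      IsNormalOfType ℓ ρ τ T (baseChange f.toRingHom r) → f a = 0) → a = 0) :
    IsNormalOfType ℓ ρ τ T r := by
  refine ⟨fun g => ?_, ⟨⟨fun σ => ?_, fun σ hσ => ?_⟩, ?_, ?_⟩, fun w hw => ?_⟩
  · ext
    refine sub_eq_zero.1 (h _ fun S _ _ f hf => ?_)
    have h1 := congrArg Units.val (hf.det_eq g)
    rw [det_baseChange] at h1
    rw [map_sub, sub_eq_zero]
    simpa using h1
  · refine h _ fun S _ _ f hf => ?_
    exact hf.normal.ordinary.lower σ
  · refine sub_eq_zero.1 (h _ fun S _ _ f hf => ?_)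
    rw [map_sub, map_one, sub_eq_zero]
    exact hf.normal.ordinary.inertia σ hσ
  · exact h _ fun S _ _ f hf => hf.normal.apply_zero_zero
  · refine sub_eq_zero.1 (h _ fun S _ _ f hf => ?_)
    rw [map_sub, map_one, sub_eq_zero]
    exact hf.normal.apply_one_zero
  · refine IsGenericallyIsomorphic.of_injective.{v} fun a ha => h a fun S _ _ f hf => ha S f ?_
    exact hf.generic w hw

/-- A continuous lift, in normal form, of the reduction of `ρ` satisfying the algebraic conditions
of type `T`. -/
structure IsLiftOfType (ℓ : ℕ) [Fact ℓ.Prime] {O : Type u} [CommRing O]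
    (ρ : GalQ →* GL (Fin 2) O) (τ : GalQ) (T : Set Place) {B : Type*} [CommRing B] [IsLocalRing B]
    [Algebra O B] (r : GalQ →* GL (Fin 2) B) : Prop extends IsNormalOfType ℓ ρ τ T r where
  continuous : IsContinuous r
  residual : ∀ g i j, (r g).val i j - algebraMap O B ((ρ g).val i j) ∈ maximalIdeal B

variable [IsLocalRing O]

/-- The open normal subgroups that contain inertia at the places outside `T` where `ρ` is
unramified, and have a quotient that is an extension of the image of the reduction of `ρ` by an
`ℓ`-group. -/
structure IsRestricted (ℓ : ℕ) [Fact ℓ.Prime] (ρ : GalQ →* GL (Fin 2) O) (T : Set Place)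
    (N : Subgroup GalQ) : Prop where
  normal : N.Normal
  isOpen : IsOpen (N : Set GalQ)
  inertia_le : ∀ w : Place, w ∉ T → IsUnramifiedAt ρ w → w.inertia ≤ N
  exists_pow_mem : ∀ h ∈ (residualRep ρ).ker, ∃ k : ℕ, h ^ ℓ ^ k ∈ N

theorem isRestricted_finset_inf {ρ : GalQ →* GL (Fin 2) O} {T : Set Place} {ι : Type*}
    (F : Finset ι) (N : ι → Subgroup GalQ) (h : ∀ i ∈ F, IsRestricted ℓ ρ T (N i)) :
    IsRestricted ℓ ρ T (F.inf N) := by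
  classical
  induction F using Finset.induction_on with
  | empty => exact ⟨by rw [Finset.inf_empty]; infer_instance, isOpen_univ, fun _ _ _ => le_top,
      fun _ _ => ⟨0, trivial⟩⟩
  | insert a F _ ih =>
    have h1 := h a (by simp)
    have h2 := ih fun i hi => h i (by simp [hi])
    have := h1.normal
    have := h2.normal
    rw [Finset.inf_insert]
    refine ⟨inferInstance, h1.isOpen.inter h2.isOpen,
      fun w hw hw' => le_inf (h1.inertia_le w hw hw') (h2.inertia_le w hw hw'), fun x hx => ?_⟩
    obtain ⟨k, hk⟩ := h1.exists_pow_mem x hx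
    obtain ⟨k', hk'⟩ := h2.exists_pow_mem x hx
    refine ⟨k + k', ?_, ?_⟩
    · rw [pow_add, pow_mul]
      exact pow_mem hk _
    · rw [add_comm, pow_add, pow_mul]
      exact pow_mem hk' _

/-- Finitely many elements generate all quotients by restricted subgroups. -/
theorem exists_finite_closure_sup_eq_top_of_isRestricted {ρ : GalQ →* GL (Fin 2) O}
    (hcont : IsContinuous ρ) (hram : {w : Place | ¬ IsUnramifiedAt ρ w}.Finite) {T : Set Place}
    (hT : T.Finite) : ∃ s : Set GalQ, s.Finite ∧
      ∀ N, IsRestricted ℓ ρ T N → Subgroup.closure s ⊔ N = ⊤ := by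
  have hinj : Function.Injective fun q : Nat.Primes => Place.finite q := fun _ _ h => by
    injection h
  let S₀ : Set ℕ := (fun q : Nat.Primes => (q : ℕ)) '' ((fun q : Nat.Primes => Place.finite q) ⁻¹'
    (T ∪ {w : Place | ¬ IsUnramifiedAt ρ w}))
  have hS₀ : S₀.Finite := ((hT.union hram).preimage hinj.injOn).image _
  have hS : ∀ (p : ℕ) [hp : Fact p.Prime], p ∉ hS₀.toFinset →
      Place.finite ⟨p, hp.out⟩ ∉ T ∧ IsUnramifiedAt ρ (Place.finite ⟨p, hp.out⟩) := by
    intro p hp hpS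
    rw [Set.Finite.mem_toFinset] at hpS
    by_contra h
    refine hpS ⟨⟨p, hp.out⟩, ?_, rfl⟩
    by_cases h1 : Place.finite ⟨p, hp.out⟩ ∈ T
    · exact Or.inl h1
    · exact Or.inr fun h2 => h ⟨h1, h2⟩
  obtain ⟨s, hs, h⟩ := exists_finite_closure_sup_eq_top_of_unramifiedOutside (p := ℓ) hS₀.toFinset
    (H := (residualRep ρ).ker) ⟨inferInstance, hcont.isOpen_ker_residualRep, fun p _ hp σ hσ => by
      have h1 : ρ σ = 1 := (hS p hp).2 σ hσ
      rw [MonoidHom.mem_ker, residualRep, baseChange, MonoidHom.comp_apply, h1, map_one]⟩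
  exact ⟨s, hs, fun N hN => h N ⟨hN.normal, hN.isOpen, fun p _ hp =>
    hN.inertia_le _ (hS p hp).1 (hS p hp).2⟩ hN.exists_pow_mem⟩

theorem exists_one_add_pow_eq {R : Type*} [Ring R] (y : R) (n : ℕ) :
    ∃ z, (1 + y) ^ n = 1 + n • y + y * y * z := by
  induction n with
  | zero => exact ⟨0, by simp⟩
  | succ n ih =>
    obtain ⟨z, hz⟩ := ih
    refine ⟨n + z + z * y, ?_⟩
    rw [pow_succ, hz, succ_nsmul, nsmul_eq_mul]
    have : (n : R) * y = y * n := (Nat.cast_commute n y).eq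
    rw [this]
    noncomm_ring
    rw [← this]
    abel

variable {B : Type*} [CommRing B]

theorem mem_ker_baseChange_mk_iff {G : Type*} [Group G] (r : G →* GL (Fin 2) B) (I : Ideal B)
    (g : G) : g ∈ (baseChange (Ideal.Quotient.mk I) r).ker ↔
      ∀ i j, ((r g).val - 1) i j ∈ I := by
  rw [MonoidHom.mem_ker]
  have h : ∀ i j, Ideal.Quotient.mk I ((1 : Matrix (Fin 2) (Fin 2) B) i j) =
      (1 : Matrix (Fin 2) (Fin 2) (B ⧸ I)) i j := fun i j => by
    fin_cases i <;> fin_cases j <;> simp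
  simp_rw [Matrix.sub_apply, ← Ideal.Quotient.eq_zero_iff_mem, map_sub, sub_eq_zero, h]
  exact ⟨fun h i j => by rw [← baseChange_apply, h]; rfl, fun h => by ext i j; exact h i j⟩

/-- In `(1 + y) ^ n = 1 + n y + y² z` with `y` congruent to zero modulo `I`, both correction terms
lie in `I * J`. For `n = ℓ` each power goes one step deeper into the congruence filtration. -/
theorem pow_mem_ker_baseChange_mk {G : Type*} [Group G] (r : G →* GL (Fin 2) B) {I J : Ideal B}
    {n : ℕ} (hn : (n : B) ∈ J) (hIJ : I ≤ J) {g : G}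
    (hg : g ∈ (baseChange (Ideal.Quotient.mk I) r).ker) :
    g ^ n ∈ (baseChange (Ideal.Quotient.mk (I * J)) r).ker := by
  rw [mem_ker_baseChange_mk_iff] at hg ⊢
  intro i j
  obtain ⟨z, hz⟩ := exists_one_add_pow_eq ((r g).val - 1) n
  rw [add_sub_cancel, add_assoc] at hz
  rw [map_pow, Units.val_pow_eq_pow_val, hz, add_sub_cancel_left, Matrix.add_apply,
    Matrix.smul_apply, nsmul_eq_mul]
  refine Ideal.add_mem _ (mul_comm (n : B) _ ▸ Ideal.mul_mem_mul (hg i j) hn) ?_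
  rw [Matrix.mul_apply]
  refine Ideal.sum_mem _ fun k _ => Ideal.mul_mem_right _ _ ?_
  rw [Matrix.mul_apply]
  exact Ideal.sum_mem _ fun l _ => Ideal.mul_mem_mul (hg i l) (hIJ (hg l k))

variable [IsLocalRing B] [Algebra O B] [IsLocalHom (algebraMap O B)]

/-- If inertia outside `T` acts trivially through `ρ`, then `σ - 1` is a group ring relation, so it
acts trivially through `r`. On the kernel of the residual representation, repeated `ℓ`-th powers
reach every congruence kernel. -/
theorem IsLiftOfType.isRestricted_ker {ρ : GalQ →* GL (Fin 2) O} {τ : GalQ} {T : Set Place}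
    {r : GalQ →* GL (Fin 2) B} (hr : IsLiftOfType ℓ ρ τ T r) (hℓ : (ℓ : O) ∈ maximalIdeal O)
    (n : ℕ) : IsRestricted ℓ ρ T
      (baseChange (Ideal.Quotient.mk (maximalIdeal B ^ n)) r).ker := by
  have hℓ' : (ℓ : B) ∈ maximalIdeal B := by
    rw [← map_natCast (algebraMap O B)]
    exact map_nonunit _ _ hℓ
  refine ⟨inferInstance, ?_, fun w hw hw' σ hσ => ?_, fun h hh => ?_⟩
  · convert hr.continuous.isOpen_ker_pow n using 1
    ext g
    exact mem_ker_baseChange_mk_iff r _ g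
  · have h1 := (hr.generic w hw).relations
      (Finsupp.single ⟨σ, hσ⟩ 1 - Finsupp.single 1 1) (by
        rw [map_sub, linearExtension_single, linearExtension_single, map_one, MonoidHom.comp_apply,
          Subgroup.subtype_apply, hw' σ hσ, sub_self])
    rw [map_sub, linearExtension_single, linearExtension_single, map_one, MonoidHom.comp_apply,
      Subgroup.subtype_apply, one_smul, one_smul, sub_eq_zero] at h1
    rw [MonoidHom.mem_ker, baseChange, MonoidHom.comp_apply, Units.ext h1, map_one]
  · rw [MonoidHom.mem_ker, residualRep_eq_one_iff] at hh
    have h1 : h ∈ (baseChange (Ideal.Quotient.mk (maximalIdeal B ^ 1)) r).ker := by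
      rw [mem_ker_baseChange_mk_iff, pow_one]
      intro i j
      have h2 : algebraMap O B ((ρ h).val i j - (1 : Matrix (Fin 2) (Fin 2) O) i j) ∈
        maximalIdeal B := map_nonunit _ _ (hh i j)
      have h3 := Ideal.add_mem _ (hr.residual h i j) h2
      have h4 : algebraMap O B ((1 : Matrix (Fin 2) (Fin 2) O) i j) =
          (1 : Matrix (Fin 2) (Fin 2) B) i j := by
        fin_cases i <;> fin_cases j <;> simp
      rw [map_sub, h4, sub_add_sub_cancel] at h3
      exact h3
    have h2 : ∀ k : ℕ, h ^ ℓ ^ k ∈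
        (baseChange (Ideal.Quotient.mk (maximalIdeal B ^ (k + 1))) r).ker := by
      intro k
      induction k with
      | zero => simpa using h1
      | succ k ih =>
        rw [pow_succ ℓ, pow_mul, pow_succ (maximalIdeal B)]
        exact pow_mem_ker_baseChange_mk r hℓ' (Ideal.pow_le_self k.succ_ne_zero) ih
    refine ⟨n, ?_⟩
    have h3 := h2 n
    rw [mem_ker_baseChange_mk_iff] at h3 ⊢
    exact fun i j => Ideal.pow_le_pow_right n.le_succ (h3 i j)

/-- Finitely many lifts of type `T` may be approximated simultaneously by their values on the
subgroup generated by `s`. -/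
theorem exists_mem_closure_sub_mem_pow {ρ : GalQ →* GL (Fin 2) O} {τ : GalQ} {T : Set Place}
    (hℓ : (ℓ : O) ∈ maximalIdeal O) {s : Set GalQ}
    (hs : ∀ N, IsRestricted ℓ ρ T N → Subgroup.closure s ⊔ N = ⊤) {ι : Type*} (F : Finset ι)
    (B : ι → Type*) [∀ i, CommRing (B i)] [∀ i, IsLocalRing (B i)] [∀ i, Algebra O (B i)]
    [∀ i, IsLocalHom (algebraMap O (B i))] (r : ∀ i, GalQ →* GL (Fin 2) (B i))
    (hr : ∀ i, IsLiftOfType ℓ ρ τ T (r i)) (n : ι → ℕ) (h : GalQ) :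
    ∃ w ∈ Subgroup.closure s, ∀ i ∈ F, ∀ a b,
      (r i w).val a b - (r i h).val a b ∈ maximalIdeal (B i) ^ n i := by
  have hN := isRestricted_finset_inf F _ fun i _ => (hr i).isRestricted_ker hℓ (n i)
  have := hN.normal
  have h1 : h ∈ Subgroup.closure s ⊔ F.inf fun i =>
      (baseChange (Ideal.Quotient.mk (maximalIdeal (B i) ^ n i)) (r i)).ker := by
    rw [hs _ hN]
    trivial
  obtain ⟨w, hw, x, hx, rfl⟩ := Subgroup.mem_sup_of_normal_right.1 h1
  refine ⟨w, hw, fun i hi a b => ?_⟩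
  have h2 := (mem_ker_baseChange_mk_iff _ _ _).1 (Finset.inf_le (f := fun i =>
      (baseChange (Ideal.Quotient.mk (maximalIdeal (B i) ^ n i)) (r i)).ker) hi hx)
  have h3 : (r i (w * x)).val - (r i w).val = (r i w).val * ((r i x).val - 1) := by
    rw [map_mul, Units.val_mul, mul_sub, mul_one]
  rw [← Ideal.neg_mem_iff, neg_sub, ← Matrix.sub_apply, h3, Matrix.mul_apply]
  exact Ideal.sum_mem _ fun k _ => Ideal.mul_mem_left _ _ (h2 k b)

end Lifts

/-! ### The universal lift in normal form -/

section UniversalLift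

open scoped MvPowerSeries.WithPiTopology

/-- Power series in the matrix entries at the elements of `s`. -/
abbrev CoordinateRing (O : Type u) [CommRing O] (s : Set GalQ) : Type u :=
  MvPowerSeries (s × Fin 2 × Fin 2) O

instance isLocalRing_quotient {A : Type*} [CommRing A] [IsLocalRing A] (I : Ideal A)
    [Nontrivial (A ⧸ I)] : IsLocalRing (A ⧸ I) :=
  .of_surjective' _ Ideal.Quotient.mk_surjective

theorem mk_mem_maximalIdeal {A : Type*} [CommRing A] [IsLocalRing A] {I : Ideal A}
    [Nontrivial (A ⧸ I)] {x : A} (hx : x ∈ maximalIdeal A) :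
    Ideal.Quotient.mk I x ∈ maximalIdeal (A ⧸ I) := by
  have := IsLocalHom.of_surjective (Ideal.Quotient.mk I) Ideal.Quotient.mk_surjective
  exact map_nonunit _ _ hx

variable {O : Type u} [CommRing O] {s : Set GalQ}

/-- The generic entries at the elements of `s` specialize to those of `r`. -/
def IsCoordinatized (ρ : GalQ →* GL (Fin 2) O) {B : Type*} [CommRing B] [Algebra O B]
    (ψ : CoordinateRing O s →ₐ[O] B) (r : GalQ →* GL (Fin 2) B) : Prop :=
  ∀ (a : s) (i j : Fin 2),
    (r a).val i j = ψ (MvPowerSeries.X (a, i, j)) + algebraMap O B ((ρ a).val i j)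

theorem exists_baseChange_eq {G : Type*} [Group G] {A B : Type*} [CommRing A] [CommRing B]
    {f : A →+* B} (hf : Function.Injective f) {r : G →* GL (Fin 2) B}
    (h : ∀ g i j, ∃ a, f a = (r g).val i j) : ∃ r' : G →* GL (Fin 2) A, baseChange f r' = r := by
  choose a ha using h
  have hmat : ∀ g, (Matrix.of (a g)).map f = (r g).val := fun g => by
    ext i j
    exact ha g i j
  have hinj : Function.Injective fun M : Matrix (Fin 2) (Fin 2) A => M.map f :=
    Matrix.map_injective hf
  let m : G →* Matrix (Fin 2) (Fin 2) A :=
    { toFun := fun g => Matrix.of (a g)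
      map_one' := hinj (by
        beta_reduce
        rw [hmat, map_one, Units.val_one, Matrix.map_one _ (map_zero f) (map_one f)])
      map_mul' := fun g h => hinj (by
        beta_reduce
        rw [Matrix.map_mul, hmat, hmat, hmat, map_mul, Units.val_mul]) }
  refine ⟨m.toHomUnits, ?_⟩
  ext g i j
  exact ha g i j

/-- The determinant of a lift comes from `O`, so this keeps entries of inverses in any
`O`-subalgebra that contains the entries of the matrix. -/
theorem inv_val_eq_smul_adjugate {B : Type*} [CommRing B] (x : GL (Fin 2) B) :
    (x⁻¹).val = (x⁻¹).det.val • x.val.adjugate := by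
  have h1 : (x⁻¹).val * (x.val * x.val.adjugate) = x.val.adjugate := by
    rw [← mul_assoc, ← Units.val_mul, inv_mul_cancel, Units.val_one, one_mul]
  have h2 : (x⁻¹).det.val * x.val.det = 1 := by
    rw [map_inv, ← Matrix.GeneralLinearGroup.val_det_apply]
    exact Units.inv_mul _
  rw [Matrix.mul_adjugate, mul_smul_comm, mul_one] at h1
  rw [← h1, smul_smul, h2, one_smul]

instance [TopologicalSpace O] [CompactSpace O] : CompactSpace (CoordinateRing O s) :=
  inferInstanceAs (CompactSpace ((s × Fin 2 × Fin 2 →₀ ℕ) → O))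

/-- The image of the compact power series ring is a closed subalgebra. It contains the entries at
the generators, hence on the group they generate, hence all limits of these. -/
theorem mem_range_of_mem_closure [TopologicalSpace O] [CompactSpace O]
    {ρ : GalQ →* GL (Fin 2) O} {B : Type*} [CommRing B] [TopologicalSpace B] [T2Space B]
    [Algebra O B] {ψ : CoordinateRing O s →ₐ[O] B} (hψ : Continuous ψ) {r : GalQ →* GL (Fin 2) B}
    (hdet : ∀ g, (r g).det = Units.map (algebraMap O B).toMonoidHom (ρ g).det)
    (hcoord : IsCoordinatized ρ ψ r) (happrox : ∀ h i j, (r h).val i j ∈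
      closure ((fun w => (r w).val i j) '' (Subgroup.closure s : Set GalQ))) (h : GalQ)
    (i j : Fin 2) : (r h).val i j ∈ ψ.range := by
  have hclosed : IsClosed (ψ.range : Set B) := by
    have := (isCompact_range hψ).isClosed
    rwa [← AlgHom.coe_range] at this
  have h1 : ∀ w ∈ Subgroup.closure s, ∀ i j, (r w).val i j ∈ ψ.range := by
    intro w hw
    induction hw using Subgroup.closure_induction with
    | mem a ha =>
      intro i j
      rw [hcoord ⟨a, ha⟩]
      exact add_mem ⟨_, rfl⟩ (ψ.range.algebraMap_mem _)
    | one =>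
      intro i j
      rw [map_one, Units.val_one, Matrix.one_apply]
      split_ifs
      · exact one_mem _
      · exact zero_mem _
    | mul x y _ _ hx hy =>
      intro i j
      rw [map_mul, val_mul_apply]
      exact add_mem (mul_mem (hx _ _) (hy _ _)) (mul_mem (hx _ _) (hy _ _))
    | inv x _ hx =>
      intro i j
      have hd : ((r x)⁻¹).det.val ∈ ψ.range := by
        rw [← map_inv, hdet]
        exact ψ.range.algebraMap_mem _
      rw [map_inv, inv_val_eq_smul_adjugate, Matrix.smul_apply, smul_eq_mul]
      refine mul_mem hd ?_
      rw [Matrix.adjugate_fin_two]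
      fin_cases i <;> fin_cases j <;> simp [-AlgHom.mem_range, hx]
  refine closure_minimal ?_ hclosed (happrox h i j)
  rintro _ ⟨w, hw, rfl⟩
  exact h1 w hw i j

variable {ℓ : ℕ} [Fact ℓ.Prime] [IsLocalRing O]

theorem mem_maximalIdeal_coordinateRing_iff {x : CoordinateRing O s} :
    x ∈ maximalIdeal _ ↔ MvPowerSeries.constantCoeff x ∈ maximalIdeal O := by
  rw [mem_maximalIdeal, mem_maximalIdeal, mem_nonunits_iff, mem_nonunits_iff,
    MvPowerSeries.isUnit_iff_constantCoeff]

instance isLocalHom_algebraMap_quotient (I : Ideal (CoordinateRing O s))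
    [Nontrivial (CoordinateRing O s ⧸ I)] :
    IsLocalHom (algebraMap O (CoordinateRing O s ⧸ I)) where
  map_nonunit x hx := by
    by_contra hu
    have h1 : algebraMap O (CoordinateRing O s) x ∈ maximalIdeal _ := by
      rw [mem_maximalIdeal_coordinateRing_iff, MvPowerSeries.algebraMap_apply,
        MvPowerSeries.constantCoeff_C]
      exact hu
    exact mk_mem_maximalIdeal (I := I) h1 hx

theorem bijective_residueField_quotient (I : Ideal (CoordinateRing O s))
    [Nontrivial (CoordinateRing O s ⧸ I)] :
    Function.Bijective (algebraMap (ResidueField O) (ResidueField (CoordinateRing O s ⧸ I))) := by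
  refine ⟨(algebraMap (ResidueField O) _).injective, fun y => ?_⟩
  obtain ⟨z, rfl⟩ := residue_surjective y
  obtain ⟨x, rfl⟩ := Ideal.Quotient.mk_surjective z
  refine ⟨residue O (MvPowerSeries.constantCoeff x), ?_⟩
  have h1 : x - algebraMap O _ (MvPowerSeries.constantCoeff x) ∈ maximalIdeal _ := by
    rw [mem_maximalIdeal_coordinateRing_iff, map_sub, MvPowerSeries.algebraMap_apply,
        MvPowerSeries.constantCoeff_C, Algebra.algebraMap_self, RingHom.id_apply, sub_self]
    exact zero_mem _
  have h2 := (residue_eq_zero_iff _).2 (mk_mem_maximalIdeal (I := I) h1)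
  rw [map_sub, map_sub, sub_eq_zero] at h2
  exact h2.symm

/-- A lift of type `T` over a quotient of the ring of power series in the matrix entries at the
elements of `s`. -/
structure QuotientLift (ℓ : ℕ) [Fact ℓ.Prime] (ρ : GalQ →* GL (Fin 2) O) (τ : GalQ) (T : Set Place)
    (s : Set GalQ) where
  /-- The ideal of relations. -/
  I : Ideal (CoordinateRing O s)
  nontrivial : Nontrivial (CoordinateRing O s ⧸ I)
  /-- The lift. -/
  r : GalQ →* GL (Fin 2) (CoordinateRing O s ⧸ I)
  isLift : IsLiftOfType ℓ ρ τ T r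
  isCoordinatized : IsCoordinatized ρ (Ideal.Quotient.mkₐ O I) r
  eq_zero_of_smul : ∀ d : O, d ≠ 0 → ∀ x : CoordinateRing O s ⧸ I, d • x = 0 → x = 0

attribute [instance] QuotientLift.nontrivial

variable [TopologicalSpace O] [IsTopologicalRing O] [CompactSpace O]

variable {ρ : GalQ →* GL (Fin 2) O} {τ : GalQ} {T : Set Place}

/-- A lift whose entries are approximated by those at the elements of the group generated by `s`
comes from a lift over a quotient of the ring of power series. -/
theorem exists_quotientLift [IsNoetherianRing O] [T2Space O] [Finite s] {B : Type v} [CommRing B]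
    [Nontrivial B] [TopologicalSpace B] [T2Space B] [Algebra O B]
    {ψ : CoordinateRing O s →ₐ[O] B} (hψ : Continuous ψ) {r : GalQ →* GL (Fin 2) B}
    (hr : IsNormalOfType ℓ ρ τ T r) (hcoord : IsCoordinatized ρ ψ r)
    (hcont : ∀ i j, Continuous fun g => (r g).val i j)
    (happrox : ∀ h i j, (r h).val i j ∈
      closure ((fun w => (r w).val i j) '' (Subgroup.closure s : Set GalQ)))
    (hnu : ∀ g i j, ¬ IsUnit ((r g).val i j - algebraMap O B ((ρ g).val i j)))
    (htf : ∀ d : O, d ≠ 0 → ∀ x : B, d • x = 0 → x = 0) :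
    ∃ (A : QuotientLift ℓ ρ τ T s) (f : CoordinateRing O s ⧸ A.I →ₐ[O] B), Function.Injective f ∧
      baseChange f.toRingHom A.r = r := by
  let f := Ideal.kerLiftAlg ψ
  have hfψ : ∀ x, f (Ideal.Quotient.mk _ x) = ψ x := Ideal.kerLiftAlg_mk ψ
  have hf : Function.Injective f := Ideal.kerLiftAlg_injective ψ
  have hnt : Nontrivial (CoordinateRing O s ⧸ RingHom.ker ψ) :=
    Ideal.Quotient.nontrivial_iff.2 (RingHom.ker_ne_top _)
  obtain ⟨r', hr'⟩ := exists_baseChange_eq (f := f.toRingHom) hf (r := r) fun g i j => by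
    obtain ⟨x, hx⟩ := mem_range_of_mem_closure hψ hr.det_eq hcoord happrox g i j
    exact ⟨Ideal.Quotient.mk _ x, (hfψ x).trans hx⟩
  have hval : ∀ g i j, f ((r' g).val i j) = (r g).val i j := fun g i j => by rw [← hr']; rfl
  have hfcont : Continuous f := continuous_quot_lift _ hψ
  -- A continuous injection of a compact space into a Hausdorff one is an embedding, so continuity
  -- of the entries descends to the quotient.
  have hemb := hfcont.isClosedEmbedding hf
  have hnormal : IsNormalOfType ℓ ρ τ T r' := IsNormalOfType.of_injective.{u, v} fun a ha => hf (by
    rw [map_zero]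
    exact ha B f (by rwa [hr']))
  refine ⟨⟨RingHom.ker ψ, hnt, r', ⟨hnormal, ?_, fun g i j => ?_⟩, fun a i j => hf ?_,
    fun d hd x hx => hf ?_⟩, f, hf, hr'⟩
  · rw [isContinuous_iff_entries (isAdic_maximalIdeal_of_compactSpace _)]
    intro i j
    rw [hemb.isInducing.continuous_iff]
    exact (hcont i j).congr fun g => (hval g i j).symm
  · intro hu
    refine hnu g i j ?_
    have := hu.map f
    rwa [map_sub, AlgHom.commutes, hval] at this
  · rw [hval, hcoord a, map_add, AlgHom.commutes]
    rfl
  · rw [map_zero]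
    exact htf d hd _ (by rw [← map_smul, hx, map_zero])

/-- There is a lift over a quotient of the ring of power series that specializes to all others. -/
theorem exists_universal_quotientLift [IsNoetherianRing O] [T2Space O] [Finite s]
    (hℓ : (ℓ : O) ∈ maximalIdeal O)
    (hs : ∀ N, IsRestricted ℓ ρ T N → Subgroup.closure s ⊔ N = ⊤)
    (hne : Nonempty (QuotientLift ℓ ρ τ T s)) :
    ∃ A : QuotientLift ℓ ρ τ T s, ∀ A' : QuotientLift ℓ ρ τ T s,
      ∃ f : CoordinateRing O s ⧸ A.I →ₐ[O] CoordinateRing O s ⧸ A'.I,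
        baseChange f.toRingHom A.r = A'.r := by
  -- The product of all lifts over quotients; the universal ring will be the image of the power
  -- series ring in it.
  let B := ∀ A : QuotientLift ℓ ρ τ T s, CoordinateRing O s ⧸ A.I
  let π : ∀ A : QuotientLift ℓ ρ τ T s, B →ₐ[O] CoordinateRing O s ⧸ A.I := fun A =>
    Pi.evalAlgHom O (fun A : QuotientLift ℓ ρ τ T s => CoordinateRing O s ⧸ A.I) A
  let ψ : CoordinateRing O s →ₐ[O] B := AlgHom.pi fun A => Ideal.Quotient.mkₐ O A.I
  have hψ : Continuous ψ := continuous_pi fun A => continuous_quot_mk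
  let m : GalQ →* Matrix (Fin 2) (Fin 2) B :=
    { toFun := fun g => Matrix.of fun i j A => (A.r g).val i j
      map_one' := by
        ext i j A
        rw [Matrix.of_apply, map_one, Units.val_one, Matrix.one_apply, Matrix.one_apply]
        split_ifs <;> rfl
      map_mul' := fun g h => by
        ext i j A
        rw [Matrix.of_apply, map_mul, val_mul_apply, Matrix.mul_apply, Fin.sum_univ_two]
        rfl }
  let r : GalQ →* GL (Fin 2) B := m.toHomUnits
  have hπ : ∀ A, baseChange (π A).toRingHom r = A.r := fun A => by
    ext
    rfl
  have hadic : ∀ A : QuotientLift ℓ ρ τ T s, IsAdic (maximalIdeal (CoordinateRing O s ⧸ A.I)) :=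
    fun A => isAdic_maximalIdeal_of_compactSpace _
  have hr : IsNormalOfType ℓ ρ τ T r := IsNormalOfType.of_injective.{u, u} fun a ha => by
    ext A
    exact ha _ (π A) (by rw [hπ]; exact A.isLift.toIsNormalOfType)
  obtain ⟨A₀⟩ := hne
  have : Nontrivial B := (π A₀).toRingHom.domain_nontrivial
  have hcoord : IsCoordinatized ρ ψ r := by
    intro a i j
    ext A
    exact A.isCoordinatized a i j
  have hcont : ∀ i j, Continuous fun g => (r g).val i j := by
    exact fun i j => continuous_pi fun A =>
      (isContinuous_iff_entries (hadic A)).1 A.isLift.continuous i j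
  have happrox : ∀ h i j, (r h).val i j ∈
      closure ((fun w => (r w).val i j) '' (Subgroup.closure s : Set GalQ)) := by
    intro h i j
    rw [mem_closure_iff_nhds]
    intro U hU
    rw [nhds_pi, Filter.mem_pi'] at hU
    obtain ⟨F, t, ht, hU⟩ := hU
    have h1 : ∀ A, ∃ n : ℕ, ∀ y, y - (A.r h).val i j ∈
        maximalIdeal (CoordinateRing O s ⧸ A.I) ^ n → y ∈ t A := fun A => by
      obtain ⟨n, -, hn⟩ := ((hadic A).hasBasis_nhds _).mem_iff.1 (ht A)
      exact ⟨n, fun y hy => hn ⟨_, hy, add_sub_cancel _ _⟩⟩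
    choose n hn using h1
    -- A basic open set of the product constrains only the finitely many factors in `F`, so
    -- simultaneous approximation applies.
    obtain ⟨w, hw, h2⟩ := exists_mem_closure_sub_mem_pow hℓ hs F
      (fun A : QuotientLift ℓ ρ τ T s => CoordinateRing O s ⧸ A.I) (fun A => A.r)
      (fun A => A.isLift) n h
    exact ⟨_, hU fun A hA => hn A _ (h2 A hA i j), w, hw, rfl⟩
  have hnu : ∀ g i j, ¬ IsUnit ((r g).val i j - algebraMap O B ((ρ g).val i j)) := by
    intro g i j hu
    exact A₀.isLift.residual g i j (hu.map (π A₀))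
  have htf : ∀ d : O, d ≠ 0 → ∀ x : B, d • x = 0 → x = 0 := by
    intro d hd x hx
    ext A
    exact A.eq_zero_of_smul d hd _ (congrFun hx A)
  obtain ⟨A, f, -, hf⟩ := exists_quotientLift hψ hr hcoord hcont happrox hnu htf
  refine ⟨A, fun A' => ⟨(π A').comp f, ?_⟩⟩
  rw [← hπ A', ← hf, baseChange_baseChange]
  rfl

end UniversalLift

/-! ### Homomorphisms from rings of power series -/

section PowerSeries

open MvPowerSeries

/-- Each nonconstant monomial is assigned, by `ι`, to a single variable dividing it, so that no
coefficient is counted twice. -/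
theorem exists_eq_C_add_sum_X_mul {σ : Type*} [Fintype σ] {R : Type*} [CommRing R]
    (x : MvPowerSeries σ R) :
    ∃ y : σ → MvPowerSeries σ R, x = C (constantCoeff x) + ∑ i, X i * y i := by
  classical
  have h : ∀ d : σ →₀ ℕ, d ≠ 0 → ∃ i, Finsupp.single i 1 ≤ d := fun d hd => by
    obtain ⟨i, hi⟩ := Finsupp.ne_iff.1 hd
    exact ⟨i, Finsupp.single_le_iff.2 (Nat.one_le_iff_ne_zero.2 hi)⟩
  let ι : (σ →₀ ℕ) → Option σ := fun d => if hd : d = 0 then none else some (h d hd).choose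
  refine ⟨fun i e => if ι (e + Finsupp.single i 1) = some i then
    coeff (e + Finsupp.single i 1) x else 0, ?_⟩
  ext d
  rw [map_add, map_sum, coeff_C]
  have key : ∀ i, coeff d (X i * (show MvPowerSeries σ R from fun e =>
      if ι (e + Finsupp.single i 1) = some i then coeff (e + Finsupp.single i 1) x else 0)) =
      if ι d = some i then coeff d x else 0 := by
    intro i
    rw [X_def, coeff_monomial_mul, one_mul]
    by_cases hle : Finsupp.single i 1 ≤ d
    · rw [if_pos hle]
      change (if ι (d - Finsupp.single i 1 + Finsupp.single i 1) = some i then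
        coeff (d - Finsupp.single i 1 + Finsupp.single i 1) x else 0) = _
      rw [tsub_add_cancel_of_le hle]
    · rw [if_neg hle, if_neg]
      intro hι
      by_cases hd : d = 0
      · simp [ι, hd] at hι
      · have h1 : (h d hd).choose = i := by simpa [ι, hd] using hι
        exact hle (h1 ▸ (h d hd).choose_spec)
  rw [Finset.sum_congr rfl fun i _ => key i]
  by_cases hd : d = 0
  · subst hd
    have h1 : ι 0 = none := by simp [ι]
    simp [h1]
  · have h1 : ι d = some (h d hd).choose := by simp [ι, hd]
    simp [h1, hd]

/-- Homomorphisms from a ring of power series that agree on the variables, and map these to the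
maximal ideal, are equal. -/
theorem mvPowerSeries_algHom_ext {σ : Type*} [Finite σ] {R : Type*} [CommRing R] {A : Type*}
    [CommRing A] [IsLocalRing A] [Algebra R A] [IsHausdorff (maximalIdeal A) A]
    {f g : MvPowerSeries σ R →ₐ[R] A} (hX : ∀ i, f (X i) = g (X i))
    (hm : ∀ i, f (X i) ∈ maximalIdeal A) : f = g := by
  have := Fintype.ofFinite σ
  -- No continuity is assumed: splitting off one variable gains one power of the maximal ideal.
  have key : ∀ (n : ℕ) (x : MvPowerSeries σ R), f x - g x ∈ maximalIdeal A ^ n := by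
    intro n
    induction n with
    | zero => simp
    | succ n ih =>
      intro x
      obtain ⟨y, hy⟩ := exists_eq_C_add_sum_X_mul x
      have hC : ∀ (φ : MvPowerSeries σ R →ₐ[R] A) (c : R), φ (C c) = algebraMap R A c :=
        fun φ c => φ.commutes c
      rw [hy, map_add, map_add, hC, hC, add_sub_add_left_eq_sub, map_sum, map_sum,
        ← Finset.sum_sub_distrib]
      refine Ideal.sum_mem _ fun i _ => ?_
      rw [map_mul, map_mul, ← hX, ← mul_sub, pow_succ']
      exact Ideal.mul_mem_mul (hm i) (ih _)
  ext x
  refine sub_eq_zero.1 (IsHausdorff.haus (I := maximalIdeal A) inferInstance _ fun n => ?_)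
  rw [SModEq.zero, smul_eq_mul, Ideal.mul_top]
  exact key n x

end PowerSeries

/-! ### Deformations and lifts -/

theorem eq_zero_of_smul_of_flat {O : Type*} {B : Type*} [CommRing O] [IsDomain O] [AddCommGroup B]
    [Module O B] [Module.Flat O B] (d : O) (hd : d ≠ 0) (x : B) (hx : d • x = 0) : x = 0 :=
  (smul_eq_zero.1 hx).resolve_left hd

section Deformations

variable {ℓ : ℕ} [Fact ℓ.Prime] {O : Type u} [CommRing O] [IsLocalRing O]

theorem Equivalent.isContinuous {G : Type*} [Group G] [TopologicalSpace G] {A : Type*} [CommRing A]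
    [IsLocalRing A] {r r' : G →* GL (Fin 2) A} (h : Equivalent r r') (hr : IsContinuous r) :
    IsContinuous r' := by
  obtain ⟨x, rfl⟩ := equivalent_iff_exists_conjRep.1 h
  let _ : TopologicalSpace A := (maximalIdeal A).adicTopology
  have : IsTopologicalRing A := (maximalIdeal A).nonarchimedean.toIsTopologicalRing
  have hr' : Continuous r := hr
  have h1 : (conjRep x r : G → GL (Fin 2) A) = fun g => x⁻¹ * r g * x := by
    ext1 g
    exact conjRep_apply x r g
  change Continuous (conjRep x r : G → GL (Fin 2) A)
  rw [h1]
  exact (continuous_const.mul hr').mul continuous_const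

variable {O' : Type v} [CommRing O'] [IsLocalRing O'] [Algebra O O'] [IsLocalHom (algebraMap O O')]
  {ρ : GalQ →* GL (Fin 2) O} {T : Set Place}

/-- The deformations of type `T` depend on `ρ` only up to isomorphism. -/
theorem IsDeformationOfType.of_equivalent {ρ' : GalQ →* GL (Fin 2) O} (h : Equivalent ρ ρ')
    {r : GalQ →* GL (Fin 2) O'} (hr : IsDeformationOfType ℓ ρ T r) :
    IsDeformationOfType ℓ ρ' T r where
  continuous := hr.continuous
  residual_equiv := hr.residual_equiv.trans ((h.baseChange _).baseChange _)
  det_eq g := by rw [hr.det_eq, h.det_eq]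
  inertia_equiv w hw := (hr.inertia_equiv w hw).trans ((h.baseChange _).comp _)
  ordinary := hr.ordinary

theorem IsLiftOfType.isDeformationOfType [IsDomain O] [CharZero O] [IsNoetherianRing O']
    (htf : ∀ d : O, d ≠ 0 → ∀ x : O', d • x = 0 → x = 0) {τ : GalQ} {r : GalQ →* GL (Fin 2) O'}
    (hr : IsLiftOfType ℓ ρ τ T r) : IsDeformationOfType ℓ ρ T r where
  continuous := hr.continuous
  residual_equiv := by
    have h : residualRep r =
        baseChange (algebraMap (ResidueField O) (ResidueField O')) (residualRep ρ) := by
      ext g i j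
      have h1 := (residue_eq_zero_iff _).2 (hr.residual g i j)
      rw [map_sub, sub_eq_zero] at h1
      exact h1
    rw [h]
    exact Equivalent.refl _
  det_eq := hr.det_eq
  inertia_equiv w hw := (hr.generic w hw).equivalent htf
  ordinary := hr.normal.ordinary.isOrdinaryLocal

/-- A deformation of type `T` is equivalent to a lift in normal form. -/
theorem IsDeformationOfType.exists_isLiftOfType
    (htf : ∀ d : O, d ≠ 0 → ∀ x : O', d • x = 0 → x = 0) {τ : GalQ} (hρ : IsNormalForm ℓ τ ρ)
    {s : decompositionGroup ℓ} (hs : (s : GalQ) ∈ inertiaGroup ℓ) (h01 : IsUnit ((ρ s).val 0 1))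
    {r : GalQ →* GL (Fin 2) O'} (hr : IsDeformationOfType ℓ ρ T r) :
    ∃ g, IsLiftOfType ℓ ρ τ T (conjRep g r) := by
  obtain ⟨g, hg, hres⟩ := exists_isNormalForm_conjRep_of_residual (τ := τ) hr.ordinary
    ((hρ.baseChange (residue O)).baseChange _) hr.residual_equiv hs
    ((h01.map (residue O)).map (algebraMap (ResidueField O) (ResidueField O')))
  have he := equivalent_conjRep g r
  refine ⟨g, ⟨fun σ => ?_, hg, fun w hw => ?_⟩, he.isContinuous hr.continuous, fun σ i j => ?_⟩
  · rw [← he.det_eq, hr.det_eq]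
  · refine isGenericallyIsomorphic_of_equivalent
      (IsFractionRing.injective O' (FractionRing O')) htf ?_
    exact ((he.symm.baseChange (algebraMap O' (FractionRing O'))).comp w.inertia.subtype).trans
      (hr.inertia_equiv w hw)
  · rw [← residue_eq_zero_iff, map_sub, sub_eq_zero]
    exact congrArg (fun x : GalQ →* GL (Fin 2) (ResidueField O') => (x σ).val i j) hres

end Deformations

/-! ### Evaluation of the universal lift -/

section Evaluation

open scoped MvPowerSeries.WithPiTopology

/-- Evaluation of power series at topologically nilpotent elements. The structure map is local,
hence continuous for the adic topologies; the residue field of `B` plays no role. -/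
theorem exists_continuous_algHom_apply_X {σ : Type*} [Finite σ] {O : Type*} [CommRing O]
    [IsLocalRing O] [TopologicalSpace O] [IsTopologicalRing O] (hO : IsAdic (maximalIdeal O))
    {B : Type*} [CommRing B] [IsLocalRing B] [IsAdicComplete (maximalIdeal B) B] [Algebra O B]
    [IsLocalHom (algebraMap O B)] [TopologicalSpace B] (hB : IsAdic (maximalIdeal B)) {a : σ → B}
    (ha : ∀ i, a i ∈ maximalIdeal B) :
    ∃ ψ : MvPowerSeries σ O →ₐ[O] B, Continuous ψ ∧ ∀ i, ψ (MvPowerSeries.X i) = a i := by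
  let _ : WithIdeal B := ⟨maximalIdeal B⟩
  have hB' : ‹TopologicalSpace B› = (maximalIdeal B).adicTopology := hB
  subst hB'
  let _ : UniformSpace O := IsTopologicalAddGroup.rightUniformSpace O
  have : IsUniformAddGroup O := isUniformAddGroup_of_addCommGroup
  obtain ⟨_, _⟩ := hB.isAdicComplete_iff.1 inferInstance
  have hc : Continuous (algebraMap O B) := by
    refine continuous_of_continuousAt_zero (algebraMap O B) ?_
    rw [ContinuousAt, map_zero, hO.hasBasis_nhds_zero.tendsto_iff hB.hasBasis_nhds_zero]
    refine fun n _ => ⟨n, trivial, fun x hx => ?_⟩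
    have h1 := Ideal.mem_map_of_mem (algebraMap O B) hx
    rw [Ideal.map_pow] at h1
    exact Ideal.pow_right_mono (Ideal.map_le_iff_le_comap.2 fun y hy => map_nonunit _ _ hy) n h1
  have : ContinuousSMul O B := continuousSMul_of_algebraMap O B hc
  have hE : MvPowerSeries.HasEval a :=
    ⟨fun i => WithIdeal.isTopologicallyNilpotent_of_mem (ha i), by
      rw [Filter.cofinite_eq_bot]
      exact Filter.tendsto_bot⟩
  refine ⟨MvPowerSeries.aeval hE, MvPowerSeries.continuous_aeval hE, fun i => ?_⟩
  rw [MvPowerSeries.coe_aeval, MvPowerSeries.eval₂_X]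

variable {ℓ : ℕ} [Fact ℓ.Prime] {O : Type u} [CommRing O] [IsLocalRing O] [IsNoetherianRing O]
  [TopologicalSpace O] [IsTopologicalRing O] [CompactSpace O] [T2Space O] {s : Set GalQ} [Finite s]
  {ρ : GalQ →* GL (Fin 2) O} {τ : GalQ} {T : Set Place} {O' : Type v} [CommRing O']
  [IsLocalRing O'] [IsAdicComplete (maximalIdeal O') O'] [Algebra O O']
  [IsLocalHom (algebraMap O O')] {r : GalQ →* GL (Fin 2) O'}

/-- A lift to a complete local ring comes from a lift over a quotient of the ring of power
series. -/
theorem IsLiftOfType.exists_quotientLift (hr : IsLiftOfType ℓ ρ τ T r)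
    (hℓ : (ℓ : O) ∈ maximalIdeal O)
    (hs : ∀ N, IsRestricted ℓ ρ T N → Subgroup.closure s ⊔ N = ⊤)
    (htf : ∀ d : O, d ≠ 0 → ∀ x : O', d • x = 0 → x = 0) :
    ∃ (A : QuotientLift ℓ ρ τ T s) (f : CoordinateRing O s ⧸ A.I →ₐ[O] O'), Function.Injective f ∧
      baseChange f.toRingHom A.r = r := by
  let _ : TopologicalSpace O' := (maximalIdeal O').adicTopology
  have hadic : IsAdic (maximalIdeal O') := rfl
  have : T2Space O' := by
    let _ : WithIdeal O' := ⟨maximalIdeal O'⟩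
    exact (hadic.isAdicComplete_iff.1 inferInstance).2
  obtain ⟨ψ, hψ, hX⟩ := exists_continuous_algHom_apply_X (σ := s × Fin 2 × Fin 2)
    (isAdic_maximalIdeal_of_compactSpace O) hadic
    (a := fun x => (r x.1).val x.2.1 x.2.2 - algebraMap O O' ((ρ x.1).val x.2.1 x.2.2))
    fun x => hr.residual _ _ _
  refine OrdinaryDeformation.exists_quotientLift hψ hr.toIsNormalOfType (fun a i j => ?_)
    ((isContinuous_iff_entries hadic).1 hr.continuous) (fun h i j => ?_) hr.residual htf
  · rw [hX, sub_add_cancel]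
  · rw [mem_closure_iff_nhds']
    intro U hU
    obtain ⟨n, -, hn⟩ := (hadic.hasBasis_nhds _).mem_iff.1 hU
    obtain ⟨w, hw, h2⟩ := exists_mem_closure_sub_mem_pow hℓ hs {()} (fun _ => O') (fun _ => r)
      (fun _ => hr) (fun _ => n) h
    exact ⟨⟨_, w, hw, rfl⟩, hn ⟨_, h2 () (by simp) i j, add_sub_cancel _ _⟩⟩

end Evaluation

/-! ### The topology of a finite extension of `ℤ_ℓ` -/

section PadicTopology

/-- Characteristic zero makes `ℤ_[ℓ] → O` injective, a nonzero `ℓ`-adic integer being a unit times a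
power of `ℓ`. So `O` is free of finite rank and is homeomorphic to a power of `ℤ_[ℓ]`. -/
theorem exists_compact_topology (ℓ : ℕ) [Fact ℓ.Prime] (O : Type*) [CommRing O] [IsDomain O]
    [CharZero O] [Algebra ℤ_[ℓ] O] [Module.Finite ℤ_[ℓ] O] :
    ∃ _ : TopologicalSpace O, IsTopologicalRing O ∧ CompactSpace O ∧ T2Space O := by
  let _ : TopologicalSpace O := moduleTopology ℤ_[ℓ] O
  have : IsModuleTopology ℤ_[ℓ] O := ⟨rfl⟩
  have hinj : Function.Injective (algebraMap ℤ_[ℓ] O) := by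
    rw [injective_iff_map_eq_zero]
    intro x hx
    by_contra hne
    rw [PadicInt.unitCoeff_spec hne, map_mul, map_pow, map_natCast] at hx
    rcases mul_eq_zero.1 hx with h | h
    · exact ((PadicInt.unitCoeff hne).isUnit.map (algebraMap ℤ_[ℓ] O)).ne_zero h
    · exact NeZero.ne ℓ (Nat.cast_eq_zero.1 (eq_zero_of_pow_eq_zero h))
  have := (faithfulSMul_iff_algebraMap_injective ℤ_[ℓ] O).2 hinj
  let e := (Module.Free.chooseBasis ℤ_[ℓ] O).equivFun
  have : IsTopologicalRing O := IsModuleTopology.isTopologicalRing ℤ_[ℓ] O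
  refine ⟨_, this, ?_, ?_⟩
  · exact e.symm.surjective.compactSpace
      (IsModuleTopology.continuous_of_linearMap e.symm.toLinearMap)
  · exact T2Space.of_injective_continuous e.injective
      (IsModuleTopology.continuous_of_linearMap e.toLinearMap)

end PadicTopology

/-! ### The universal deformation -/

section Universal

variable {ℓ : ℕ} [Fact ℓ.Prime] {O : Type u} [CommRing O] [IsLocalRing O]
  {ρ : GalQ →* GL (Fin 2) O} {τ : GalQ} {T : Set Place}

/-- The representation itself is a lift, so the family whose product is formed is not empty. -/
theorem IsNormalForm.isLiftOfType [IsDomain O] (h : IsNormalForm ℓ τ ρ) (hcont : IsContinuous ρ) :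
    IsLiftOfType ℓ ρ τ T ρ where
  det_eq g := by
    ext
    rfl
  normal := h
  generic w _ := isGenericallyIsomorphic_of_equivalent
    (IsFractionRing.injective O (FractionRing O))
    (fun _ hd _ hx => (smul_eq_zero.1 hx).resolve_left hd) (Equivalent.refl _)
  continuous := hcont
  residual g i j := by
    rw [Algebra.algebraMap_self, RingHom.id_apply, sub_self]
    exact zero_mem _

variable {s : Set GalQ}

/-- Up to constants from `O`, the variables are entries of the lift, so a homomorphism is determined
by its effect on the entries. -/
theorem QuotientLift.algHom_ext (A : QuotientLift ℓ ρ τ T s) [Finite s] {O' : Type v} [CommRing O']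
    [IsLocalRing O'] [IsHausdorff (maximalIdeal O') O'] [Algebra O O']
    [IsLocalHom (algebraMap O O')]
    {φ φ' : CoordinateRing O s ⧸ A.I →ₐ[O] O'}
    (hφ : ∀ g i j, φ ((A.r g).val i j) - algebraMap O O' ((ρ g).val i j) ∈ maximalIdeal O')
    (h : ∀ g i j, φ ((A.r g).val i j) = φ' ((A.r g).val i j)) : φ = φ' := by
  have hX : ∀ (f : CoordinateRing O s ⧸ A.I →ₐ[O] O') (i : s × Fin 2 × Fin 2),
      f.comp (Ideal.Quotient.mkₐ O A.I) (MvPowerSeries.X i) =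
        f ((A.r i.1).val i.2.1 i.2.2) - algebraMap O O' ((ρ i.1).val i.2.1 i.2.2) :=
    fun f i => by
      rw [A.isCoordinatized i.1, map_add, AlgHom.commutes, add_sub_cancel_right]
      rfl
  refine Ideal.Quotient.algHom_ext O (mvPowerSeries_algHom_ext (fun i => ?_) fun i => ?_)
  · rw [hX, hX, h]
  · rw [hX]
    exact hφ _ _ _

end Universal

open scoped MvPowerSeries.WithPiTopology in
/-- There is a universal deformation of type `T`. -/
theorem exists_isUniversalOfType {ℓ : ℕ} [Fact ℓ.Prime] {O : Type u} [CommRing O] [IsDomain O]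
    [IsDiscreteValuationRing O] [CharZero O] [Algebra ℤ_[ℓ] O] [Module.Finite ℤ_[ℓ] O]
    {ρ : GalQ →* GL (Fin 2) O} (hcont : IsContinuous ρ) (hord : IsOrdinary ℓ ρ)
    (hram : {w : Place | ¬ IsUnramifiedAt ρ w}.Finite)
    (hirr : IsAbsolutelyIrreducible (residualRep ρ))
    {σ : decompositionGroup ℓ} (hσ : (σ : GalQ) ∈ inertiaGroup ℓ)
    (hres : IsResiduallyUnipotentAt (ρ.comp (decompositionGroup ℓ).subtype) σ)
    {T : Set Place} (hT : T.Finite) :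
    ∃ (R : Type u) (_ : CommRing R) (_ : IsLocalRing R) (_ : IsNoetherianRing R)
      (_ : IsAdicComplete (maximalIdeal R) R) (_ : Algebra O R)
      (_ : IsLocalHom (algebraMap O R)) (_ : Module.Flat O R) (ρuniv : GalQ →* GL (Fin 2) R),
      Function.Bijective (algebraMap (ResidueField O) (ResidueField R)) ∧
        IsUniversalOfType.{u, v} ℓ ρ T ρuniv := by
  obtain ⟨_, _, _, _⟩ := exists_compact_topology ℓ O
  have hℓ : (ℓ : O) ∈ maximalIdeal O := natCast_mem_maximalIdeal
  have hcomplete := isAdicComplete_maximalIdeal_of_compactSpace O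
  obtain ⟨g, τ, hnormal, h01⟩ := exists_isNormalForm hord hirr hσ hres
  have he := equivalent_conjRep g ρ
  -- Deformations of type `T` depend only on the isomorphism class, so `ρ` may be replaced by its
  -- normal form.
  generalize conjRep g ρ = ρ' at hnormal h01 he
  have hcont' : IsContinuous ρ' := he.isContinuous hcont
  have hram' : {w : Place | ¬ IsUnramifiedAt ρ' w}.Finite := by
    refine hram.subset fun w hw h => hw fun x hx => ?_
    exact (he.eq_one_iff x).1 (h x hx)
  obtain ⟨s, hsfin, hs⟩ :=
    exists_finite_closure_sup_eq_top_of_isRestricted (ℓ := ℓ) hcont' hram' hT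
  have := hsfin.to_subtype
  obtain ⟨A, hA⟩ := exists_universal_quotientLift (τ := τ) hℓ hs <| by
    obtain ⟨A, -⟩ := (hnormal.isLiftOfType (T := T) hcont').exists_quotientLift hℓ hs
      fun _ hd _ hx => (smul_eq_zero.1 hx).resolve_left hd
    exact ⟨A⟩
  -- Over the discrete valuation ring `O` this is flatness.
  have : Module.IsTorsionFree O (CoordinateRing O s ⧸ A.I) :=
    .of_smul_eq_zero fun d x hdx => or_iff_not_imp_left.2 fun hd => A.eq_zero_of_smul d hd x hdx
  refine ⟨CoordinateRing O s ⧸ A.I, inferInstance, inferInstance, inferInstance,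
    isAdicComplete_maximalIdeal_of_compactSpace _, inferInstance, inferInstance, inferInstance, A.r,
    bijective_residueField_quotient A.I,
    (A.isLift.isDeformationOfType A.eq_zero_of_smul).of_equivalent he.symm, ?_⟩
  intro O' _ _ _ _ _ _ _ r hr
  have htf := eq_zero_of_smul_of_flat (O := O) (B := O')
  obtain ⟨x, hx⟩ := (hr.of_equivalent he).exists_isLiftOfType htf hnormal hσ h01
  obtain ⟨A', f, -, hf⟩ := hx.exists_quotientLift hℓ hs htf
  obtain ⟨h, hh⟩ := hA A'
  have hφ : baseChange (f.comp h).toRingHom A.r = conjRep x r := by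
    rw [← hf, ← hh, baseChange_baseChange]
    rfl
  refine ⟨f.comp h, ?_, fun φ' hφ' => ?_⟩
  · beta_reduce
    rw [hφ]
    exact equivalent_conjRep x r
  -- Both sides are in normal form and equivalent, hence equal. The required unit at `σ` survives
  -- because the lift is congruent to `ρ'` there.
  · have h1 : baseChange φ'.toRingHom A.r = conjRep x r := by
      refine (A.isLift.normal.baseChange _).eq_of_equivalent hx.normal
        (hφ'.symm.trans (equivalent_conjRep x r)) hσ ?_
      by_contra hu
      exact notMem_maximalIdeal.2 (h01.map (algebraMap O O'))
        ((Submodule.sub_mem_iff_right _ hu).1 (hx.residual σ 0 1))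
    have hval : ∀ g i j, f.comp h ((A.r g).val i j) = ((conjRep x r) g).val i j := fun g i j =>
      congrArg (fun y : GalQ →* GL (Fin 2) O' => (y g).val i j) hφ
    symm
    refine A.algHom_ext (fun g i j => ?_) fun g i j => ?_
    · rw [hval]
      exact hx.residual g i j
    · exact congrArg (fun y : GalQ →* GL (Fin 2) O' => (y g).val i j) (hφ.trans h1.symm)

end OrdinaryDeformation

end

theorem mainTheorem10 (ℓ : ℕ) [Fact ℓ.Prime]
    (O : Type u) [CommRing O] [IsDomain O] [IsDiscreteValuationRing O] [CharZero O]
    [Algebra ℤ_[ℓ] O] [Module.Finite ℤ_[ℓ] O]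
    (ρ : OrdinaryDeformation.GalQ →* GL (Fin 2) O)
    (hcont : OrdinaryDeformation.IsContinuous ρ)
    (hord : OrdinaryDeformation.IsOrdinary ℓ ρ)
    (hram : {w : OrdinaryDeformation.Place |
      ¬ OrdinaryDeformation.IsUnramifiedAt ρ w}.Finite)
    (hirr : OrdinaryDeformation.IsAbsolutelyIrreducible (OrdinaryDeformation.residualRep ρ))
    (hwild : OrdinaryDeformation.IsWildlyRamifiedAt (OrdinaryDeformation.residualRep ρ) ℓ) :
    (∀ T : Set OrdinaryDeformation.Place, T.Finite →
      ∃ (R : Type u) (_ : CommRing R) (_ : IsLocalRing R) (_ : IsNoetherianRing R)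
        (_ : IsAdicComplete (IsLocalRing.maximalIdeal R) R) (_ : Algebra O R)
        (_ : IsLocalHom (algebraMap O R)) (_ : Module.Flat O R)
        (ρuniv : OrdinaryDeformation.GalQ →* GL (Fin 2) R),
        Function.Bijective
          (algebraMap (IsLocalRing.ResidueField O) (IsLocalRing.ResidueField R)) ∧
        OrdinaryDeformation.IsUniversalOfType.{u, v} ℓ ρ T ρuniv) ∧
    OrdinaryDeformation.IsDeformationCondition
      ((OrdinaryDeformation.residualRep ρ).comp
        (OrdinaryDeformation.decompositionGroup ℓ).subtype)
      (fun A _ _ r => OrdinaryDeformation.OrdinaryCondition ℓ ρ A r) := by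
  obtain ⟨s, hs, hres⟩ := OrdinaryDeformation.exists_isResiduallyUnipotentAt hcont hord hwild
  exact ⟨fun T hT => OrdinaryDeformation.exists_isUniversalOfType hcont hord hram hirr hs hres hT,
    OrdinaryDeformation.isDeformationCondition_ordinaryCondition hord hs hres⟩
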